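/- Let $R$ be a unital associative ring (not necessarily commutative) that is free as a $\mathbb Z$-module, and let $I$ be a $\mathbb Z$-basis of $R$, possibly infinite, with structure constants $VW=\sum_{U\in I}N_{V,W}^U\,U$. Let $$G_\infty^{\mathbb Q}(R)=\bigotimes_{l\ge 1}U(\mathbb Q\otimes_{\mathbb Z}R)$$ be the infinite tensor product (spanned by the pure tensors with almost all entries equal to $1$) of copies of the universal enveloping algebra of $\mathbb Q\otimes R$ with the commutator bracket, and let $T_l(r)$ be the image of $r\in\mathbb Q\otimes R$ in the $l$-th factor. Let $\mathcal P^I$ be the set of families $\vec\lambda=(\vec\lambda(U))_{U\in I}$ of partitions of finite total size. For each $U\in I$ let $\mathbf x_U$ be a set of variables, let $\Lambda^{(U)}_{\mathbb Q}=\mathbb Q[p_1^{(U)},p_2^{(U)},\dots]$ be the ring of symmetric functions in $\mathbf x_U$ over $\mathbb Q$, and write $f^{(U)}=f(\mathbf x_U)$ for a symmetric function $f$; $p_l$ are the power sums and $s_\lambda$ the Schur functions. Extend $T_l$ linearly to formal series in the $p_l^{(U)}$ with coefficients in $\mathbb Q\otimes R$. Then: 1. There is exactly one family $(Z_{\vec\lambda})_{\vec\lambda\in\mathcal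 P^I}$ in $G_\infty^{\mathbb Q}(R)$ with $$\sum_{\vec\lambda\in\mathcal P^I}\Big(\prod_{U\in I}s_{\vec\lambda(U)}^{(U)}\Big)\otimes Z_{\vec\lambda}=\prod_{l=1}^{\infty}\exp\Big(T_l\Big(\log\Big(1+\sum_{U\in I}p_l^{(U)}U\Big)\Big)\Big)$$ as formal series in the $p_l^{(U)}$ with coefficients in $G_\infty^{\mathbb Q}(R)$. 2. The $\mathbb Z$-span $G_\infty^{\mathbb Z}(R)$ of the $Z_{\vec\lambda}$ contains $1$ and is closed under the multiplication of $G_\infty^{\mathbb Q}(R)$, so it is a subring. 3. It is an integral form of $G_\infty^{\mathbb Q}(R)$: the elements $Z_{\vec\lambda}$ are a $\mathbb Q$-basis of $G_\infty^{\mathbb Q}(R)$ (and hence a $\mathbb Z$-basis of $G_\infty^{\mathbb Z}(R)$). 4. For all $\vec\mu,\vec\nu\in\mathcal P^I$, $$Z_{\vec\mu}Z_{\vec\nu}=\sum_{\vec\lambda}a_{\vec\mu,\vec\nu}^{\vec\lambda}\,Z_{\vec\lambda}$$ with integers $a_{\vec\mu,\vec\nu}^{\vec\lambda}$, only finitely many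 nonzero for given $\vec\mu,\vec\nu$, where $a_{\vec\mu,\vec\nu}^{\vec\lambda}$ is the coefficient of $\prod_{V}s_{\vec\mu(V)}(\mathbf x_V)\prod_{W}s_{\vec\nu(W)}(\mathbf y_W)$ in the (unique) expansion of $$\prod_{U\in I}s_{\vec\lambda(U)}\Big(\mathbf x_U,\ \mathbf y_U,\ \bigoplus_{V,W\in I}(\mathbf x_V\mathbf y_W)^{\oplus N_{V,W}^U}\Big),$$ which is the result of the substitution $p_l\mapsto p_l(\mathbf x_U)+p_l(\mathbf y_U)+\sum_{V,W}N_{V,W}^U\,p_l(\mathbf x_V)p_l(\mathbf y_W)$ for all $l\ge1$ in $s_{\vec\lambda(U)}$. -/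

import Mathlib

namespace WreathRing

open scoped TensorProduct

noncomputable section

/-! ### Symmetric functions

`Λ_ℚ = ℚ ⊗ Λ` is the polynomial ring `ℚ[p₁, p₂, …]` on the power sums; the variable indexed by
`l : ℕ+` is `p_l`. -/

/-- The ring of symmetric functions with rational coefficients, `Λ_ℚ = ℚ[p₁, p₂, …]`. -/
abbrev SymQ : Type := MvPolynomial ℕ+ ℚ

/-- `z_μ = ∏ᵢ i ^ mᵢ * mᵢ!`, where `mᵢ` is the number of parts of `μ` equal to `i`. -/
def zPart {n : ℕ} (μ : n.Partition) : ℕ :=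
  ∏ i ∈ μ.parts.toFinset, i ^ μ.parts.count i * (μ.parts.count i).factorial

/-- `p_μ = ∏ p_{μᵢ}`, the product over the (positive) parts of `μ`. -/
def pPart {n : ℕ} (μ : n.Partition) : SymQ :=
  (μ.parts.map fun i => (MvPolynomial.X i.toPNat' : SymQ)).prod

/-- The complete symmetric function `h_n = ∑_{μ ⊢ n} p_μ / z_μ`. -/
def hSym (n : ℕ) : SymQ :=
  ∑ μ : n.Partition, ((zPart μ : ℚ)⁻¹) • pPart μ

/-- `h_k` for an integer index, zero when `k < 0`. -/
def hSymInt (k : ℤ) : SymQ := if k < 0 then 0 else hSym k.toNat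

/-- The Schur function `s_μ = det (h_{μ_i - i + j})`, where `i, j` run over the rows of `μ`
(a partition is given by its Young diagram; `μ.rowLen i` is its `i`-th part and `μ.colLen 0` the
number of its nonzero parts). -/
def schur (μ : YoungDiagram) : SymQ :=
  Matrix.det (Matrix.of fun i j : Fin (μ.colLen 0) =>
    hSymInt ((μ.rowLen i : ℤ) - (i : ℤ) + (j : ℤ)))

/-- Multipartitions indexed by `ι`: partition-valued functions on `ι` of finite total size. -/
def MultiPartition (ι : Type*) : Type _ :=
  {f : ι → YoungDiagram // (Function.support fun U => (f U).card).Finite}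

/-- The product `∏_U s_{lam(U)}[A_U]` of Schur functions evaluated at a family `A` of (virtual)
alphabets.  The alphabet `A_U` is given by the values `A U l = p_l[A_U]` of the power sums, and
`f ↦ f[A_U]` is the ring homomorphism from `Λ_ℚ` with `p_l ↦ A U l`.  So disjoint unions of
variable sets add power sums, an integer multiplicity `⊕N` (possibly negative) multiplies them
by `N`, and the product alphabet `𝐱𝐲` multiplies them. -/
def schurProd {ι : Type*} {B : Type*} [CommRing B] [Algebra ℚ B] (lam : MultiPartition ι)
    (A : ι → ℕ+ → B) : B :=
  ∏ U ∈ lam.2.toFinset, MvPolynomial.aeval (A U) (schur (lam.1 U))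

/-! ### Formal series

Completed tensor products with `⨂_{U ∈ ι} Λ_ℚ^{(U)}` are rings of formal power series in the power
sums: the variable indexed by `(U, l)` is `p_l^{(U)} = p_l(𝐱_U)`.  The coefficients lie in a possibly
noncommutative `ℚ`-algebra, and commute with the variables. -/

section Series

variable {σ κ A : Type*} [Ring A]

/-- The coefficientwise sum of a family of formal series, of which only finitely many are expected
to involve any given monomial. -/
def formalSum (f : κ → MvPowerSeries σ A) : MvPowerSeries σ A :=
  fun m => ∑ᶠ k, MvPowerSeries.coeff m (f k)

variable [Algebra ℚ A]

/-- `exp f = ∑_{n ≥ 0} fⁿ / n!`, for `f` without constant term. -/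
def expSeries (f : MvPowerSeries σ A) : MvPowerSeries σ A :=
  formalSum fun n : ℕ => ((n.factorial : ℚ)⁻¹) • f ^ n

/-- `log (1 + f) = ∑_{n ≥ 1} (-1)ⁿ⁻¹ fⁿ / n`, for `f` without constant term. -/
def logOneAdd (f : MvPowerSeries σ A) : MvPowerSeries σ A :=
  formalSum fun n : ℕ => ((-1 : ℚ) ^ n / (n + 1)) • f ^ (n + 1)

/-- The series `f ⊗ a`, for a scalar series `f` and a coefficient `a`. -/
def tensorCoeff (f : MvPowerSeries σ ℚ) (a : A) : MvPowerSeries σ A :=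
  fun m => MvPowerSeries.coeff m f • a

/-- A linear map of coefficients, extended to series coefficient by coefficient. -/
def mapCoeff {A' : Type*} [Ring A'] [Algebra ℚ A'] (φ : A →ₗ[ℚ] A') (f : MvPowerSeries σ A) :
    MvPowerSeries σ A' :=
  fun m => φ (MvPowerSeries.coeff m f)

end Series

/-! ### The rational algebra -/

section Algebra

attribute [local instance 100] LieRing.ofAssociativeRing

variable (R : Type*) [Ring R]

/-- The `ℚ`-algebra `ℚ ⊗ R`. -/
def RatExt : Type _ := ℚ ⊗[ℤ] R

instance : Ring (RatExt R) := inferInstanceAs (Ring (ℚ ⊗[ℤ] R))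

instance : Algebra ℚ (RatExt R) := inferInstanceAs (Algebra ℚ (ℚ ⊗[ℤ] R))

/-- The commutator bracket on `ℚ ⊗ R`. -/
instance : LieRing (RatExt R) := LieRing.ofAssociativeRing

instance : LieAlgebra ℚ (RatExt R) := LieAlgebra.ofAssociativeAlgebra

/-- The element `1 ⊗ r` of `ℚ ⊗ R`. -/
def toRatExt {R : Type*} [Ring R] (r : R) : RatExt R := (1 : ℚ) ⊗ₜ[ℤ] r

/-- The universal enveloping algebra `U(ℚ ⊗ R)`. -/
abbrev Env : Type _ := UniversalEnvelopingAlgebra ℚ (RatExt R)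

/-- The infinite tensor product `⨂_{i ≥ 1} U(ℚ ⊗ R)`, spanned by the pure tensors
`a₁ ⊗ a₂ ⊗ ⋯` with all but finitely many `aᵢ = 1`. -/
def GQ : Subalgebra ℚ (⨂[ℚ] _ : ℕ+, Env R) :=
  Submodule.toSubalgebra
    (Submodule.span ℚ {x | ∃ a : ℕ+ → Env R, {i | a i ≠ 1}.Finite ∧ PiTensorProduct.tprod ℚ a = x})
    (Submodule.subset_span ⟨1, by simp, rfl⟩)
    (by
      intro x y hx hy
      have h := Submodule.mul_mem_mul hx hy
      rw [Submodule.span_mul_span] at h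
      refine Submodule.span_mono ?_ h
      rintro _ ⟨_, ⟨a, ha, rfl⟩, _, ⟨b, hb, rfl⟩, rfl⟩
      refine ⟨a * b, (ha.union hb).subset fun i hi => ?_, ?_⟩
      · by_contra hc
        simp only [Set.mem_union, Set.mem_ofPred_eq, not_or, not_not] at hc
        exact hi (by simp [hc.1, hc.2])
      · simp)

variable {R} in
theorem single_mem_GQ (l : ℕ+) (x : Env R) : PiTensorProduct.singleAlgHom (R := ℚ) l x ∈ GQ R := by
  refine Submodule.subset_span ⟨Pi.mulSingle l x, ?_, ?_⟩
  · refine (Set.finite_singleton l).subset fun i hi => ?_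
    by_contra h
    exact hi (by simp [Pi.mulSingle_eq_of_ne h])
  · rfl

/-- `T_l(r)`: the image of `r ∈ ℚ ⊗ R` in the `l`-th tensor factor. -/
def T (l : ℕ+) : RatExt R →ₗ[ℚ] GQ R :=
  (((PiTensorProduct.singleAlgHom (R := ℚ) (A := fun _ : ℕ+ => Env R) l).codRestrict (GQ R)
      (single_mem_GQ l)).toLinearMap).comp
    (UniversalEnvelopingAlgebra.ι ℚ (L := RatExt R)).toLinearMap

end Algebra

/-! ### The elements `Z_lam` and the structure constants -/

section Generating

variable {R : Type*} [Ring R] {ι : Type*} (b : Module.Basis ι ℤ R)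

/-- The series `∑_U p_l^{(U)} U`, with coefficients in `ℚ ⊗ R`. -/
def pSeries (l : ℕ+) : MvPowerSeries (ι × ℕ+) (RatExt R) :=
  formalSum fun U => MvPowerSeries.monomial (Finsupp.single (U, l) 1) (toRatExt (b U))

/-- The factor `exp (T_l (log (1 + ∑_U p_l^{(U)} U)))`. -/
def thetaFactor (l : ℕ+) : MvPowerSeries (ι × ℕ+) (GQ R) :=
  expSeries (mapCoeff (T R l) (logOneAdd (pSeries b l)))

/-- The element `∏_U s_{lam(U)}^{(U)}`, as a series in the power sums `p_l^{(U)}`. -/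
def schurSeries (lam : MultiPartition ι) : MvPowerSeries (ι × ℕ+) ℚ :=
  schurProd lam fun U l => MvPowerSeries.X (U, l)

/-- The identity that defines the family `Z`:
`∑_lam (∏_U s_{lam(U)}^{(U)}) ⊗ Z_lam = ∏_{l ≥ 1} exp (T_l (log (1 + ∑_U p_l^{(U)} U)))`.
The infinite product on the right is the coefficientwise limit of the partial products: each
coefficient of the partial products is eventually that of the left-hand side. -/
def IsZFamily (Z : MultiPartition ι → GQ R) : Prop :=
  ∀ m : (ι × ℕ+) →₀ ℕ, ∀ᶠ N : ℕ in Filter.atTop,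
    MvPowerSeries.coeff m
        (((List.range N).map fun l => thetaFactor b l.succPNat).prod) =
      MvPowerSeries.coeff m (formalSum fun lam => tensorCoeff (schurSeries lam) (Z lam))

/-- Series in the power sums of two families of variable sets: `p_l(𝐱_U)` is the variable
`Sum.inl (U, l)` and `p_l(𝐲_U)` is the variable `Sum.inr (U, l)`. -/
abbrev TwoSeries (ι : Type*) : Type _ := MvPowerSeries ((ι × ℕ+) ⊕ (ι × ℕ+)) ℚ

/-- The power sums `p_l(𝐱_U) + p_l(𝐲_U) + ∑_{V,W} N_{V,W}^U p_l(𝐱_V) p_l(𝐲_W)` of the alphabet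
`𝐱_U, 𝐲_U, ⨁_{V,W} (𝐱_V 𝐲_W)^{⊕ N_{V,W}^U}`, where `V W = ∑_U N_{V,W}^U U` in `R`. -/
def combinedAlphabet (U : ι) (l : ℕ+) : TwoSeries ι :=
  MvPowerSeries.X (Sum.inl (U, l)) + MvPowerSeries.X (Sum.inr (U, l)) +
    formalSum fun VW : ι × ι => ((b.repr (b VW.1 * b VW.2) U : ℤ) : ℚ) •
      (MvPowerSeries.X (Sum.inl (VW.1, l)) * MvPowerSeries.X (Sum.inr (VW.2, l)) : TwoSeries ι)

/-- `∏_U s_{lam(U)}(𝐱_U, 𝐲_U, ⨁_{V,W} (𝐱_V 𝐲_W)^{⊕ N_{V,W}^U})`. -/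
def combinedSchur (lam : MultiPartition ι) : TwoSeries ι :=
  schurProd lam (combinedAlphabet b)

/-- `f = ∑_{mu, nu} c mu nu ∏_V s_{mu(V)}(𝐱_V) ∏_W s_{nu(W)}(𝐲_W)`. -/
def IsSchurExpansion (f : TwoSeries ι) (c : MultiPartition ι → MultiPartition ι → ℚ) : Prop :=
  f = formalSum fun mn : MultiPartition ι × MultiPartition ι => c mn.1 mn.2 •
    (schurProd mn.1 (fun V l => MvPowerSeries.X (Sum.inl (V, l))) *
      schurProd mn.2 (fun W l => MvPowerSeries.X (Sum.inr (W, l))) : TwoSeries ι)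

end Generating

end

end WreathRing

open WreathRing

namespace WreathRing

noncomputable section

section

open MvPowerSeries Finset

/-! ### Formal series over a noncommutative ring: the Euler operator, exp and log -/

section SeriesTools

variable {σ A : Type*} [Ring A]

/-! Everything rests on one multiplicativity. For F(x) = ∑ x_U U put Θ(x) = exp(ι(log(1 + F(x)))),
with coefficients in the enveloping algebra of ℚ ⊗ R. The structure constants are exactly what makes
(1 + F(x))(1 + F(y)) = 1 + F(z) for the combined alphabet z (`subs_combinedFamily`), and this lifts
to Θ(x)Θ(y) = Θ(z) (`subs_envTheta_mul`). In place of the Baker–Campbell–Hausdorff formula a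
representation is used: ℚ ⊗ R acts by derivations on a polynomial ring, through left multiplication
on the generators, and Θ(x) then acts as the substitution Y_j ↦ (1 + F(x)) Y_j
(`implements_envTheta`, from a differential equation for the Euler operator). Such substitutions
compose as expected (`Implements.mul`), and the representation is faithful (`envAction_injective`).

Faithfulness comes together with a basis of Poincaré–Birkhoff–Witt type: the coefficients of Θ are
independent already as operators, and they span by a leading term argument on words. Tensoring over
the levels l, the coefficients D_m of the full product are a ℚ-basis of the infinite tensor product
(`linearIndependent_fullCoeff`, `span_fullCoeff`), and multiplicativity becomes the product rule
`fullCoeff_mul`.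

The products of Schur functions are a second basis of the polynomial ring in the power sums, and the
change of basis is block diagonal with finite blocks. Hence the defining identity can be solved for
the Z in exactly one way (`transition_iff`, `isZFamily_iff`), the Z are again a basis, and
`fullCoeff_mul` turns into multiplication of the Z with the coefficients of the Schur expansion of
the combined alphabets.

It remains to see that these coefficients are integers. Call an alphabet integral over a subring C
if its complete symmetric functions take values in C. Integral alphabets are closed under sums and
negatives, and also under products when C is integrally closed in an algebraically closed field,
because up to any degree such an alphabet is a finite set of roots in C (`IsIntegralAlphabet.mul`).
So a Schur function of a combined alphabet is integral over ℤ[h], hence lies in ℤ[h], and ℤ[h] is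
spanned over ℤ by the products of Schur functions, since the determinantal formula is unitriangular
(`isLeading_schurPoly`). -/

theorem coeff_formalSum {κ : Type*} (f : κ → MvPowerSeries σ A) (m : σ →₀ ℕ) :
    coeff m (formalSum f) = ∑ᶠ k, coeff m (f k) := rfl

/-- A sequence of series whose `n`-th member has order at least `n`. -/
def OrderGE (f : ℕ → MvPowerSeries σ A) : Prop :=
  ∀ n m, Finsupp.degree m < n → coeff m (f n) = 0

/-- Terms of index above the degree of `m` do not reach `m`. Identities between infinite sums are
reduced by this to identities between finite ones. -/
theorem OrderGE.coeff_formalSum {f : ℕ → MvPowerSeries σ A} (hf : OrderGE f) {m : σ →₀ ℕ} {N : ℕ}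
    (h : Finsupp.degree m < N) : coeff m (formalSum f) = coeff m (∑ n ∈ range N, f n) := by
  rw [WreathRing.coeff_formalSum, map_sum, finsum_eq_sum_of_support_subset]
  intro n hn
  simp only [coe_range, Set.mem_Iio]
  by_contra hc
  exact hn (hf n m (by omega))

theorem coeff_mul_congr {u u' v v' : MvPowerSeries σ A} {m : σ →₀ ℕ}
    (hu : ∀ k ≤ m, coeff k u = coeff k u') (hv : ∀ k ≤ m, coeff k v = coeff k v') :
    coeff m (u * v) = coeff m (u' * v') := by
  classical
  rw [coeff_mul, coeff_mul]
  refine sum_congr rfl fun p hp => ?_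
  rw [HasAntidiagonal.mem_antidiagonal] at hp
  rw [hu _ (hp ▸ le_self_add), hv _ (hp ▸ le_add_self)]

theorem degree_lt_of_le {k m : σ →₀ ℕ} {N : ℕ} (h : k ≤ m) (hm : Finsupp.degree m < N) :
    Finsupp.degree k < N := (Finsupp.degree_mono h).trans_lt hm

theorem OrderGE.coeff_mul {f g : ℕ → MvPowerSeries σ A} (hf : OrderGE f) (hg : OrderGE g)
    {m : σ →₀ ℕ} {N : ℕ} (h : Finsupp.degree m < N) :
    coeff m (formalSum f * formalSum g) =
      coeff m ((∑ n ∈ range N, f n) * (∑ n ∈ range N, g n)) :=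
  coeff_mul_congr (fun _ hk => hf.coeff_formalSum (degree_lt_of_le hk h))
    fun _ hk => hg.coeff_formalSum (degree_lt_of_le hk h)

theorem OrderGE.mul_formalSum {g : ℕ → MvPowerSeries σ A} (hg : OrderGE g)
    (u : MvPowerSeries σ A) : u * formalSum g = formalSum fun n => u * g n := by
  have h' : OrderGE fun n => u * g n := by
    classical
    intro n m hm
    rw [MvPowerSeries.coeff_mul]
    refine sum_eq_zero fun p hp => ?_
    rw [HasAntidiagonal.mem_antidiagonal] at hp
    rw [hg n p.2 (degree_lt_of_le (hp ▸ le_add_self) hm), mul_zero]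
  ext m
  rw [h'.coeff_formalSum (Nat.lt_succ_self _), ← mul_sum]
  exact coeff_mul_congr (fun _ _ => rfl)
    fun _ hk => hg.coeff_formalSum (degree_lt_of_le hk (Nat.lt_succ_self _))

theorem OrderGE.commute {f g : ℕ → MvPowerSeries σ A} (hf : OrderGE f) (hg : OrderGE g)
    (h : ∀ i j, Commute (f i) (g j)) : Commute (formalSum f) (formalSum g) := by
  ext m
  rw [hf.coeff_mul hg (Nat.lt_succ_self _), hg.coeff_mul hf (Nat.lt_succ_self _)]
  congr 1
  exact Commute.sum_left _ _ _ fun i _ => Commute.sum_right _ _ _ fun j _ => h i j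

theorem coeff_pow_of_degree_lt {F : MvPowerSeries σ A} (hF : coeff 0 F = 0) (n : ℕ) (m : σ →₀ ℕ)
    (hm : Finsupp.degree m < n) : coeff m (F ^ n) = 0 := by
  classical
  induction n generalizing m with
  | zero => omega
  | succ n ih =>
    rw [pow_succ, coeff_mul]
    refine sum_eq_zero fun p hp => ?_
    rw [HasAntidiagonal.mem_antidiagonal] at hp
    by_cases h0 : p.2 = 0
    · rw [h0, hF, mul_zero]
    · rw [ih p.1, zero_mul]
      have h1 : 0 < Finsupp.degree p.2 :=
        Nat.pos_of_ne_zero fun h => h0 ((Finsupp.degree_eq_zero_iff _).1 h)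
      have h2 := congrArg Finsupp.degree hp
      rw [map_add] at h2
      omega

theorem coeff_mul_swap [DecidableEq σ] (f g : MvPowerSeries σ A) (m : σ →₀ ℕ) :
    coeff m (f * g) = ∑ p ∈ antidiagonal m, coeff p.2 f * coeff p.1 g := by
  conv_lhs => rw [coeff_mul, ← HasAntidiagonal.map_swap_antidiagonal, sum_map]
  rfl

/-- The Euler operator, multiplying each coefficient by its total degree. -/
def euler : MvPowerSeries σ A →+ MvPowerSeries σ A where
  toFun f := fun m => Finsupp.degree m • coeff m f
  map_zero' := funext fun m => smul_zero _
  map_add' f g := by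
    ext m
    change Finsupp.degree m • coeff m (f + g) =
      Finsupp.degree m • coeff m f + Finsupp.degree m • coeff m g
    rw [map_add, smul_add]

@[simp] theorem coeff_euler (f : MvPowerSeries σ A) (m : σ →₀ ℕ) :
    coeff m (euler f) = Finsupp.degree m • coeff m f := rfl

theorem euler_mul (f g : MvPowerSeries σ A) : euler (f * g) = euler f * g + f * euler g := by
  classical
  ext m
  rw [coeff_euler, map_add, coeff_mul, coeff_mul, coeff_mul, smul_sum, ← sum_add_distrib]
  refine sum_congr rfl fun p hp => ?_
  rw [HasAntidiagonal.mem_antidiagonal] at hp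
  rw [← hp, map_add, add_smul, coeff_euler, coeff_euler, smul_mul_assoc, mul_smul_comm]

theorem euler_one : euler (1 : MvPowerSeries σ A) = 0 := by
  classical
  ext m
  rw [coeff_euler, coeff_one]
  split_ifs with h <;> simp [h]

/-- Leibniz rule with `euler f` collected on the left; over noncommutative coefficients this needs
`euler f` to commute with `f`. -/
theorem euler_pow {f : MvPowerSeries σ A} (h : Commute (euler f) f) (n : ℕ) :
    euler (f ^ (n + 1)) = (n + 1) • (euler f * f ^ n) := by
  induction n with
  | zero => simp
  | succ n ih =>
    rw [pow_succ f (n + 1), euler_mul, ih, smul_mul_assoc, mul_assoc, ← pow_succ, ← (h.pow_right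
      (n + 1)).eq, add_smul (n + 1) 1, one_smul]

theorem OrderGE.euler_formalSum {f : ℕ → MvPowerSeries σ A} (hf : OrderGE f) :
    euler (formalSum f) = formalSum fun n => euler (f n) := by
  have h' : OrderGE fun n => euler (f n) := fun n m h => by rw [coeff_euler, hf n m h, smul_zero]
  ext m
  rw [coeff_euler, hf.coeff_formalSum (Nat.lt_succ_self _),
    h'.coeff_formalSum (Nat.lt_succ_self _), ← map_sum, coeff_euler]

variable [Algebra ℚ A]

theorem coeff_rat_smul (c : ℚ) (f : MvPowerSeries σ A) (m : σ →₀ ℕ) :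
    coeff m (c • f) = c • coeff m f := rfl

theorem euler_smul (c : ℚ) (f : MvPowerSeries σ A) : euler (c • f) = c • euler f := by
  ext m
  rw [coeff_euler, coeff_rat_smul, coeff_rat_smul, coeff_euler, smul_comm]

theorem orderGE_smul_pow {F : MvPowerSeries σ A} (hF : coeff 0 F = 0) (c : ℕ → ℚ) (e : ℕ → ℕ)
    (he : ∀ n, n ≤ e n) : OrderGE fun n => c n • F ^ e n := fun n m h => by
  rw [coeff_rat_smul, coeff_pow_of_degree_lt hF _ _ (h.trans_le (he n)), smul_zero]

theorem coeff_zero_expSeries {G : MvPowerSeries σ A} (hG : coeff 0 G = 0) :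
    coeff 0 (expSeries G) = 1 := by
  have h := (orderGE_smul_pow hG (fun n => (n.factorial : ℚ)⁻¹) (fun n => n) fun _ => le_rfl)
  rw [expSeries, h.coeff_formalSum (N := 1) (by simp)]
  simp

/-- Termwise differentiation: the term of index `n + 1` yields `euler G` times the term of index
`n`. This replaces the exponential by a linear differential equation of first order. -/
theorem euler_expSeries {G : MvPowerSeries σ A} (hG : coeff 0 G = 0) (h : Commute (euler G) G) :
    euler (expSeries G) = euler G * expSeries G := by
  have hE := (orderGE_smul_pow hG (fun n => (n.factorial : ℚ)⁻¹) (fun n => n) fun _ => le_rfl)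
  rw [expSeries, hE.euler_formalSum, hE.mul_formalSum]
  ext m
  -- Differentiation lowers the index by one, so the left side is truncated one term later than the
  -- right.
  rw [OrderGE.coeff_formalSum (N := Finsupp.degree m + 2) _ (by omega),
    OrderGE.coeff_formalSum (N := Finsupp.degree m + 1) _ (by omega), sum_range_succ']
  · congr 1
    simp only [pow_zero, euler_smul, euler_one, smul_zero, add_zero]
    refine sum_congr rfl fun n _ => ?_
    rw [euler_pow h, ← Nat.cast_smul_eq_nsmul ℚ, smul_smul, mul_smul_comm]
    congr 1
    rw [Nat.factorial_succ]
    have : (n + 1 : ℚ) ≠ 0 := by positivity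
    have : (n.factorial : ℚ) ≠ 0 := by positivity
    push_cast
    field_simp
  · intro n m hm
    classical
    simp only [mul_smul_comm]
    rw [coeff_rat_smul, coeff_mul, sum_eq_zero, smul_zero]
    intro p hp
    rw [HasAntidiagonal.mem_antidiagonal] at hp
    rw [coeff_pow_of_degree_lt hG n p.2 (degree_lt_of_le (hp ▸ le_add_self) hm), mul_zero]
  · intro n m hm
    rw [coeff_euler, hE n m hm, smul_zero]

/-- The series `F / (1 + F) = ∑ (-1)ⁿ Fⁿ⁺¹`. -/
def geomSeries (F : MvPowerSeries σ A) : MvPowerSeries σ A :=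
  formalSum fun n : ℕ => ((-1 : ℚ) ^ n) • F ^ (n + 1)

theorem geomSeries_eq {F : MvPowerSeries σ A} (hF : coeff 0 F = 0) :
    geomSeries F = F - F * geomSeries F := by
  have hE := orderGE_smul_pow hF (fun n => (-1 : ℚ) ^ n) (· + 1) fun n => Nat.le_succ n
  have h2 := orderGE_smul_pow hF (fun n => (-1 : ℚ) ^ n) (· + 1 + 1) fun n => by omega
  rw [geomSeries, hE.mul_formalSum]
  simp only [mul_smul_comm, ← pow_succ']
  ext m
  rw [map_sub, hE.coeff_formalSum (N := Finsupp.degree m + 2) (by omega),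
    h2.coeff_formalSum (N := Finsupp.degree m + 1) (by omega), sum_range_succ', ← map_sub]
  congr 1
  simp [pow_succ _ (_ + 1), pow_succ (-1 : ℚ), sum_neg_distrib]
  abel

theorem geomSeries_eq' {F : MvPowerSeries σ A} (hF : coeff 0 F = 0) :
    geomSeries F = F - geomSeries F * F := by
  have hE := orderGE_smul_pow hF (fun n => (-1 : ℚ) ^ n) (· + 1) fun n => Nat.le_succ n
  have hc : Commute F (geomSeries F) := by
    ext m
    rw [geomSeries, coeff_mul_congr (v' := ∑ n ∈ range (Finsupp.degree m + 1), _) (fun _ _ => rfl)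
        fun k hk => hE.coeff_formalSum (degree_lt_of_le hk (Nat.lt_succ_self _)),
      coeff_mul_congr (u' := ∑ n ∈ range (Finsupp.degree m + 1), _)
        (fun k hk => hE.coeff_formalSum (degree_lt_of_le hk (Nat.lt_succ_self _)))
        fun _ _ => rfl]
    congr 1
    exact Commute.sum_right _ _ _ fun i _ => ((Commute.refl F).pow_right _).smul_right _
  conv_lhs => rw [geomSeries_eq hF]
  rw [hc.eq]

theorem coeff_zero_logOneAdd {F : MvPowerSeries σ A} (hF : coeff 0 F = 0) :
    coeff 0 (logOneAdd F) = 0 := by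
  have hE := orderGE_smul_pow hF (fun n => (-1 : ℚ) ^ n / (n + 1)) (· + 1) fun n => Nat.le_succ n
  rw [logOneAdd, hE.coeff_formalSum (N := 1) (by simp)]
  simp [hF]

/-- `euler F = F` says that `F` is homogeneous of degree 1. The operator multiplies `F ^ (n + 1)` by
`n + 1`, which cancels the denominator and leaves a geometric series. -/
theorem euler_logOneAdd {F : MvPowerSeries σ A} (hF : coeff 0 F = 0) (h : euler F = F) :
    euler (logOneAdd F) = geomSeries F := by
  have hE := orderGE_smul_pow hF (fun n => (-1 : ℚ) ^ n / (n + 1)) (· + 1) fun n => Nat.le_succ n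
  rw [logOneAdd, hE.euler_formalSum, geomSeries]
  congr 1
  funext n
  rw [euler_smul, euler_pow (h.symm ▸ Commute.refl F), h, ← pow_succ', ← Nat.cast_smul_eq_nsmul ℚ,
    smul_smul]
  congr 1
  have : (n + 1 : ℚ) ≠ 0 := by positivity
  push_cast
  field_simp

theorem commute_geomSeries_logOneAdd {F : MvPowerSeries σ A} (hF : coeff 0 F = 0) :
    Commute (geomSeries F) (logOneAdd F) :=
  (orderGE_smul_pow hF (fun n => (-1 : ℚ) ^ n) (· + 1) fun n => Nat.le_succ n).commute
    (orderGE_smul_pow hF (fun n => (-1 : ℚ) ^ n / (n + 1)) (· + 1) fun n => Nat.le_succ n)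
    fun _ _ => (((Commute.refl F).pow_pow _ _).smul_left _).smul_right _

variable {B : Type*} [Ring B] [Algebra ℚ B]

@[simp] theorem coeff_mapCoeff (φ : A →ₗ[ℚ] B) (f : MvPowerSeries σ A) (m : σ →₀ ℕ) :
    coeff m (mapCoeff φ f) = φ (coeff m f) := rfl

theorem euler_mapCoeff (φ : A →ₗ[ℚ] B) (f : MvPowerSeries σ A) :
    euler (mapCoeff φ f) = mapCoeff φ (euler f) := by
  ext m
  rw [coeff_euler, coeff_mapCoeff, coeff_mapCoeff, coeff_euler, map_nsmul]

/-- `φ` preserves commutators but not products. Each coefficient of `f * g - g * f` is a sum of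
commutators of coefficients, so its vanishing survives `φ`. -/
theorem Commute.mapCoeff {φ : A →ₗ[ℚ] B} (hφ : ∀ a b, φ (a * b - b * a) = φ a * φ b - φ b * φ a)
    {f g : MvPowerSeries σ A} (h : Commute f g) :
    Commute (mapCoeff φ f) (mapCoeff φ g) := by
  classical
  ext m
  have h1 := congrArg (coeff m) h.eq
  rw [← sub_eq_zero, coeff_mul, coeff_mul_swap, ← sum_sub_distrib] at h1 ⊢
  have h2 := congrArg φ h1
  rw [map_sum, map_zero] at h2
  rw [← h2]
  exact sum_congr rfl fun p _ => by simp [hφ]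

/-- The differential equation of `exp (φ (log (1 + F)))`, for a Lie algebra homomorphism `φ`. -/
theorem euler_exp_map_log {φ : A →ₗ[ℚ] B} (hφ : ∀ a b, φ (a * b - b * a) = φ a * φ b - φ b * φ a)
    {F : MvPowerSeries σ A} (hF : coeff 0 F = 0) (h : euler F = F) :
    euler (expSeries (mapCoeff φ (logOneAdd F))) =
      mapCoeff φ (geomSeries F) * expSeries (mapCoeff φ (logOneAdd F)) := by
  have h0 : coeff 0 (mapCoeff φ (logOneAdd F)) = 0 := by
    rw [coeff_mapCoeff, coeff_zero_logOneAdd hF, map_zero]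
  have he : euler (mapCoeff φ (logOneAdd F)) = mapCoeff φ (geomSeries F) := by
    rw [euler_mapCoeff, euler_logOneAdd hF h]
  rw [euler_expSeries h0, he]
  rw [he]
  exact Commute.mapCoeff hφ (commute_geomSeries_logOneAdd hF)

theorem coeff_zero_exp_map_log (φ : A →ₗ[ℚ] B) {F : MvPowerSeries σ A} (hF : coeff 0 F = 0) :
    coeff 0 (expSeries (mapCoeff φ (logOneAdd F))) = 1 :=
  coeff_zero_expSeries (by rw [coeff_mapCoeff, coeff_zero_logOneAdd hF, map_zero])

theorem map_expSeries (g : B →ₐ[ℚ] A) {G : MvPowerSeries σ B} (hG : coeff 0 G = 0) :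
    expSeries (MvPowerSeries.map g.toRingHom G) = MvPowerSeries.map g.toRingHom (expSeries G) := by
  have hG' : coeff 0 (MvPowerSeries.map g.toRingHom G) = 0 := by
    rw [coeff_map, hG, map_zero]
  have hE := (orderGE_smul_pow hG (fun n => (n.factorial : ℚ)⁻¹) (fun n => n) fun _ => le_rfl)
  have hE' := (orderGE_smul_pow hG' (fun n => (n.factorial : ℚ)⁻¹) (fun n => n) fun _ => le_rfl)
  ext m
  rw [expSeries, hE'.coeff_formalSum (Nat.lt_succ_self _), coeff_map, expSeries,
    hE.coeff_formalSum (Nat.lt_succ_self _), map_sum, map_sum, map_sum]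
  refine sum_congr rfl fun n _ => ?_
  rw [coeff_rat_smul, coeff_rat_smul, ← map_pow, coeff_map]
  exact (map_smul g _ _).symm

end SeriesTools

end

section

open MvPowerSeries Finset

/-! ### Substitution of scalar series into series with noncommutative coefficients -/

section Substitution

variable {σ τ A : Type*} [Ring A] [Algebra ℚ A]

/-- The monomial `∏ z_s ^ k_s` in a family of series. -/
def powProd (z : σ → MvPowerSeries τ ℚ) (k : σ →₀ ℕ) : MvPowerSeries τ ℚ :=
  k.prod fun s n => z s ^ n

theorem powProd_zero (z : σ → MvPowerSeries τ ℚ) : powProd z 0 = 1 := Finsupp.prod_zero_index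

theorem powProd_add (z : σ → MvPowerSeries τ ℚ) (i j : σ →₀ ℕ) :
    powProd z (i + j) = powProd z i * powProd z j :=
  Finsupp.prod_add_index' (fun _ => pow_zero _) fun _ _ _ => pow_add _ _ _

theorem powProd_single (z : σ → MvPowerSeries τ ℚ) (s : σ) : powProd z (Finsupp.single s 1) = z s := by
  rw [powProd, Finsupp.prod_single_index (h := fun s n => z s ^ n) (pow_zero _), pow_one]

/-- Finiteness of substitution, used for the series all of whose coefficients are 1, which does not
hide any exponent. It makes the `finsum` in `subs` an honest finite sum. -/
theorem finite_coeff_powProd {z : σ → MvPowerSeries τ ℚ} (hz : HasSubst z) (e : τ →₀ ℕ) :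
    {k | coeff e (powProd z k) ≠ 0}.Finite := by
  have h := coeff_subst_finite (R := ℚ) hz (fun _ => (1 : ℚ)) e
  refine Set.Finite.subset h fun k hk => ?_
  rw [Function.mem_support]
  change (1 : ℚ) • coeff e (powProd z k) ≠ 0
  rwa [one_smul]

/-- The substitution `x_s ↦ z_s` of scalar series into a series with coefficients in `A`. -/
def subs (z : σ → MvPowerSeries τ ℚ) (f : MvPowerSeries σ A) : MvPowerSeries τ A :=
  fun e => ∑ᶠ k, coeff e (powProd z k) • coeff k f

theorem coeff_subs (z : σ → MvPowerSeries τ ℚ) (f : MvPowerSeries σ A) (e : τ →₀ ℕ) :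
    coeff e (subs z f) = ∑ᶠ k, coeff e (powProd z k) • coeff k f := rfl

theorem coeff_subs_eq_sum {z : σ → MvPowerSeries τ ℚ} {e : τ →₀ ℕ} {K : Finset (σ →₀ ℕ)}
    (hK : ∀ k, coeff e (powProd z k) ≠ 0 → k ∈ K) (f : MvPowerSeries σ A) :
    coeff e (subs z f) = ∑ k ∈ K, coeff e (powProd z k) • coeff k f := by
  rw [coeff_subs, finsum_eq_sum_of_support_subset]
  intro k hk
  refine hK k fun h => hk ?_
  simp only [h, zero_smul]

/-- Both sides are sums over pairs of exponents, because `powProd z` turns sums of exponents into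
products. The left side groups the pairs by their sum, the right side by the splitting of `e`. -/
theorem subs_mul {z : σ → MvPowerSeries τ ℚ} (hz : HasSubst z) (f g : MvPowerSeries σ A) :
    subs z (f * g) = subs z f * subs z g := by
  classical
  ext e
  let K (e : τ →₀ ℕ) : Finset (σ →₀ ℕ) := (finite_coeff_powProd hz e).toFinset
  have hK : ∀ e k, coeff e (powProd z k) ≠ 0 → k ∈ K e := fun e k h => by simpa [K] using h
  -- All exponents that can contribute to either half of any splitting of `e`.
  let I : Finset (σ →₀ ℕ) := (antidiagonal e).biUnion fun p => K p.1 ∪ K p.2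
  have hI1 : ∀ p ∈ antidiagonal e, ∀ k, coeff p.1 (powProd z k) ≠ 0 → k ∈ I := fun p hp k h =>
    mem_biUnion.2 ⟨p, hp, mem_union_left _ (hK _ _ h)⟩
  have hI2 : ∀ p ∈ antidiagonal e, ∀ k, coeff p.2 (powProd z k) ≠ 0 → k ∈ I := fun p hp k h =>
    mem_biUnion.2 ⟨p, hp, mem_union_right _ (hK _ _ h)⟩
  have hR : coeff e (subs z f * subs z g) = ∑ q ∈ I ×ˢ I,
      coeff e (powProd z (q.1 + q.2)) • (coeff q.1 f * coeff q.2 g) := by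
    rw [coeff_mul]
    have : ∀ p ∈ antidiagonal e, coeff p.1 (subs z f) * coeff p.2 (subs z g) =
        ∑ q ∈ I ×ˢ I, (coeff p.1 (powProd z q.1) * coeff p.2 (powProd z q.2)) •
          (coeff q.1 f * coeff q.2 g) := fun p hp => by
      rw [coeff_subs_eq_sum (hI1 p hp), coeff_subs_eq_sum (hI2 p hp), sum_mul_sum, sum_product]
      refine sum_congr rfl fun i _ => sum_congr rfl fun j _ => ?_
      rw [smul_mul_smul_comm]
    rw [sum_congr rfl this, sum_comm]
    refine sum_congr rfl fun q _ => ?_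
    rw [powProd_add, coeff_mul, sum_smul]
  have hL : ∀ k, coeff e (powProd z k) ≠ 0 → k ∈ (I ×ˢ I).image (fun q => q.1 + q.2) ∪ K e :=
    fun k h => mem_union_right _ (hK _ _ h)
  rw [hR, coeff_subs_eq_sum hL, ← sum_fiberwise_of_maps_to (s := I ×ˢ I)
    (t := (I ×ˢ I).image (fun q => q.1 + q.2) ∪ K e) (g := fun q => q.1 + q.2)
    fun q hq => mem_union_left _ (mem_image_of_mem _ hq)]
  refine sum_congr rfl fun k _ => ?_
  rw [coeff_mul, smul_sum]
  symm
  -- The fibre over `k` inside the box is compared with the whole antidiagonal of `k`: a pair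
  -- outside of the box has coefficient 0, by `powProd_add`.
  refine sum_congr_of_eq_on_inter ?_ ?_ ?_
  · intro q hq hq'
    rw [mem_filter] at hq
    exact absurd (HasAntidiagonal.mem_antidiagonal.2 hq.2) hq'
  · intro q hq hq'
    rw [HasAntidiagonal.mem_antidiagonal] at hq
    by_contra hne
    have h1 : coeff e (powProd z (q.1 + q.2)) ≠ 0 := fun h => hne (by rw [← hq, h, zero_smul])
    rw [powProd_add, coeff_mul] at h1
    obtain ⟨p, hp, hp'⟩ := exists_ne_zero_of_sum_ne_zero h1
    exact hq' (mem_filter.2 ⟨mem_product.2 ⟨hI1 p hp _ (left_ne_zero_of_mul hp'),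
      hI2 p hp _ (right_ne_zero_of_mul hp')⟩, hq⟩)
  · intro q hq _
    rw [mem_filter] at hq
    rw [hq.2]

theorem subs_add {z : σ → MvPowerSeries τ ℚ} (hz : HasSubst z) (f g : MvPowerSeries σ A) :
    subs z (f + g) = subs z f + subs z g := by
  ext e
  have hK : ∀ k, coeff e (powProd z k) ≠ 0 → k ∈ (finite_coeff_powProd hz e).toFinset :=
    fun k h => by simpa using h
  rw [map_add, coeff_subs_eq_sum hK, coeff_subs_eq_sum hK, coeff_subs_eq_sum hK, ← sum_add_distrib]
  simp only [map_add, smul_add]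

theorem subs_C {z : σ → MvPowerSeries τ ℚ} (a : A) : subs z (C a) = C a := by
  classical
  ext e
  rw [coeff_subs, finsum_eq_single _ 0, powProd_zero, coeff_one, coeff_C, coeff_C, if_pos rfl]
  · split_ifs <;> simp
  · intro k hk
    rw [coeff_C, if_neg hk, smul_zero]

theorem subs_mapCoeff {z : σ → MvPowerSeries τ ℚ} (hz : HasSubst z) {B : Type*} [Ring B]
    [Algebra ℚ B] (φ : A →ₗ[ℚ] B) (f : MvPowerSeries σ A) :
    subs z (mapCoeff φ f) = mapCoeff φ (subs z f) := by
  ext e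
  have hK : ∀ k, coeff e (powProd z k) ≠ 0 → k ∈ (finite_coeff_powProd hz e).toFinset :=
    fun k h => by simpa using h
  rw [coeff_mapCoeff, coeff_subs_eq_sum hK, coeff_subs_eq_sum hK, map_sum]
  exact sum_congr rfl fun k _ => by rw [coeff_mapCoeff, map_smul]

/-- Renaming the variables along an injection. -/
theorem hasSubst_X {j : σ → τ} (hj : Function.Injective j) :
    HasSubst fun s => (X (j s) : MvPowerSeries τ ℚ) where
  const_coeff s := by simp
  coeff_zero d := by
    classical
    refine Set.Subsingleton.finite fun s hs t ht => hj ?_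
    simp only [coeff_X, ne_eq, ite_eq_right_iff, one_ne_zero, imp_false, not_not,
      Set.mem_ofPred_eq] at hs ht
    exact Finsupp.single_left_injective one_ne_zero (hs.symm.trans ht)

theorem powProd_X (j : σ → τ) (k : σ →₀ ℕ) :
    powProd (fun s => (X (j s) : MvPowerSeries τ ℚ)) k = monomial (k.mapDomain j) 1 := by
  induction k using Finsupp.induction_linear with
  | zero => rw [powProd_zero, Finsupp.mapDomain_zero, monomial_zero_one]
  | add f g hf hg =>
    rw [powProd_add, hf, hg, monomial_mul_monomial, Finsupp.mapDomain_add, one_mul]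
  | single s n =>
    rw [powProd, Finsupp.prod_single_index
      (h := fun s n => (X (j s) : MvPowerSeries τ ℚ) ^ n) (pow_zero _), Finsupp.mapDomain_single,
      X_pow_eq]

theorem coeff_subs_X {j : σ → τ} (hj : Function.Injective j) (f : MvPowerSeries σ A) (k : σ →₀ ℕ) :
    coeff (k.mapDomain j) (subs (fun s => X (j s)) f) = coeff k f := by
  classical
  rw [coeff_subs, finsum_eq_single _ k, powProd_X, coeff_monomial_same, one_smul]
  intro i hi
  rw [powProd_X, coeff_monomial_ne fun h => hi (Finsupp.mapDomain_injective hj h).symm, zero_smul]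

theorem coeff_subs_X_of_notMem {j : σ → τ} (f : MvPowerSeries σ A) {e : τ →₀ ℕ}
    (he : ∀ k : σ →₀ ℕ, k.mapDomain j ≠ e) :
    coeff e (subs (fun s => X (j s)) f) = 0 := by
  classical
  rw [coeff_subs, finsum_eq_zero_of_forall_eq_zero]
  intro i
  rw [powProd_X, coeff_monomial_ne (he i).symm, zero_smul]

end Substitution

/-! ### Generic linear series -/

section Generic

variable {σ ι A : Type*} [Ring A]

/-- The generic element `∑ x_{e U} v_U`. -/
def genSeries (e : ι → σ) (v : ι → A) : MvPowerSeries σ A :=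
  formalSum fun U => monomial (Finsupp.single (e U) 1) (v U)

variable {e : ι → σ} (he : Function.Injective e) (v : ι → A)
include he

theorem coeff_genSeries_single (U : ι) : coeff (Finsupp.single (e U) 1) (genSeries e v) = v U := by
  rw [genSeries, coeff_formalSum, finsum_eq_single _ U, coeff_monomial_same]
  intro V hV
  exact coeff_monomial_ne (fun h => hV (he (Finsupp.single_left_injective one_ne_zero h)).symm) _

omit he in
theorem coeff_genSeries_of_ne {m : σ →₀ ℕ} (hm : ∀ U, m ≠ Finsupp.single (e U) 1) :
    coeff m (genSeries e v) = 0 := by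
  rw [genSeries, coeff_formalSum, finsum_eq_zero_of_forall_eq_zero]
  exact fun U => coeff_monomial_ne (hm U) _

omit he in
theorem coeff_zero_genSeries : coeff 0 (genSeries e v) = 0 :=
  coeff_genSeries_of_ne v fun U h => by simpa using (DFunLike.congr_fun h (e U)).symm

omit he in
theorem euler_genSeries : euler (genSeries e v) = genSeries e v := by
  ext m
  rw [coeff_euler]
  by_cases hm : ∀ U, m ≠ Finsupp.single (e U) 1
  · rw [coeff_genSeries_of_ne v hm, smul_zero]
  · push Not at hm
    obtain ⟨U, rfl⟩ := hm
    rw [Finsupp.degree_single, one_smul]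

theorem mapCoeff_genSeries {B : Type*} [Ring B] [Algebra ℚ A] [Algebra ℚ B] (φ : A →ₗ[ℚ] B) :
    mapCoeff φ (genSeries e v) = genSeries e (φ ∘ v) := by
  ext m
  rw [coeff_mapCoeff]
  by_cases hm : ∀ U, m ≠ Finsupp.single (e U) 1
  · rw [coeff_genSeries_of_ne v hm, coeff_genSeries_of_ne _ hm, map_zero]
  · push Not at hm
    obtain ⟨U, rfl⟩ := hm
    rw [coeff_genSeries_single he, coeff_genSeries_single he, Function.comp_apply]

end Generic

end

section

open MvPowerSeries Finset

/-! ### The enveloping algebra and its action by derivations -/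

section Enveloping

attribute [local instance 100] LieRing.ofAssociativeRing

variable {R : Type*} [Ring R] {ι σ : Type*} (b : Module.Basis ι ℤ R)

/-- The basis `1 ⊗ b_U` of `ℚ ⊗ R`. -/
def ratBasis : Module.Basis ι ℚ (RatExt R) :=
  (b.baseChange ℚ : Module.Basis ι ℚ (TensorProduct ℤ ℚ R))

theorem ratBasis_apply (U : ι) : ratBasis b U = toRatExt (b U) :=
  Module.Basis.baseChange_apply ℚ b U

theorem toRatExt_mul (r s : R) : toRatExt r * toRatExt s = toRatExt (r * s) := by
  change ((1 : ℚ) ⊗ₜ[ℤ] r : TensorProduct ℤ ℚ R) * (1 : ℚ) ⊗ₜ[ℤ] s = (1 : ℚ) ⊗ₜ[ℤ] (r * s)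
  rw [Algebra.TensorProduct.tmul_mul_tmul, one_mul]

/-- The inclusion of `ℚ ⊗ R` into its enveloping algebra. -/
def envι : RatExt R →ₗ[ℚ] Env R := (UniversalEnvelopingAlgebra.ι ℚ (L := RatExt R)).toLinearMap

theorem envι_lie (a c : RatExt R) : envι (a * c - c * a) = envι a * envι c - envι c * envι a :=
  LieHom.map_lie (UniversalEnvelopingAlgebra.ι ℚ (L := RatExt R)) a c

/-- `exp (ι (log (1 + ∑ x_{e U} U)))`, with coefficients in the enveloping algebra. -/
def envTheta (e : ι → σ) : MvPowerSeries σ (Env R) :=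
  expSeries (mapCoeff envι (logOneAdd (genSeries e (ratBasis b))))

/-- The series `F / (1 + F)` for `F = ∑ x_{e U} U`. -/
def genGeom (e : ι → σ) : MvPowerSeries σ (RatExt R) := geomSeries (genSeries e (ratBasis b))

variable (e : ι → σ)

theorem genGeom_eq : genGeom b e =
    genSeries e (ratBasis b) - genGeom b e * genSeries e (ratBasis b) :=
  geomSeries_eq' (coeff_zero_genSeries _)

theorem coeff_zero_genGeom : coeff 0 (genGeom b e) = 0 := by
  classical
  rw [genGeom_eq, map_sub, coeff_zero_genSeries, coeff_mul]
  simp [coeff_zero_genSeries]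

theorem euler_envTheta : euler (envTheta b e) = mapCoeff envι (genGeom b e) * envTheta b e :=
  euler_exp_map_log envι_lie (coeff_zero_genSeries _) (euler_genSeries _)

theorem coeff_zero_envTheta : coeff 0 (envTheta b e) = 1 :=
  coeff_zero_exp_map_log _ (coeff_zero_genSeries _)

/-! ### The representation by derivations of a polynomial ring -/

/-- The linear form attached to an element of `ℚ ⊗ R`. -/
def linForm : RatExt R →ₗ[ℚ] MvPolynomial (Option ι) ℚ :=
  (ratBasis b).constr ℚ fun U => MvPolynomial.X (some U)

theorem linForm_basis (U : ι) : linForm b (ratBasis b U) = MvPolynomial.X (some U) :=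
  Module.Basis.constr_basis _ _ _ _

/-- The right action `a ↦ a * j`, where `none` acts as an identity. -/
def rightAct (j : Option ι) : RatExt R →ₗ[ℚ] RatExt R :=
  j.elim LinearMap.id fun U => LinearMap.mulRight ℚ (ratBasis b U)

/-- Left and right multiplications commute, which is why left multiplication on the generators
respects brackets. The additional generator `none` is free: `a` sends it to the linear form of `a`
itself, and the proof of faithfulness tests operators on its powers. -/
theorem mul_rightAct (j : Option ι) (a c : RatExt R) :
    a * rightAct b j c = rightAct b j (a * c) := by
  cases j with
  | none => rfl
  | some U => simp [rightAct, mul_assoc]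

/-- The derivation of `ℚ[Y]` given by left multiplication on the generators. -/
def leftDer (a : RatExt R) :
    Derivation ℚ (MvPolynomial (Option ι) ℚ) (MvPolynomial (Option ι) ℚ) :=
  MvPolynomial.mkDerivation ℚ fun j => linForm b (rightAct b j a)

theorem leftDer_X (a : RatExt R) (j : Option ι) :
    leftDer b a (MvPolynomial.X j) = linForm b (rightAct b j a) :=
  MvPolynomial.mkDerivation_X _ _ _

theorem leftDer_linForm (a r : RatExt R) : leftDer b a (linForm b r) = linForm b (a * r) := by
  have : (leftDer b a).toLinearMap ∘ₗ linForm b = linForm b ∘ₗ LinearMap.mulLeft ℚ a := by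
    refine (ratBasis b).ext fun U => ?_
    simp only [LinearMap.comp_apply, LinearMap.mulLeft_apply, linForm_basis]
    exact leftDer_X b a (some U)
  exact LinearMap.congr_fun this r

theorem leftDer_add (a c : RatExt R) : leftDer b (a + c) = leftDer b a + leftDer b c :=
  MvPolynomial.derivation_ext fun j => by
    rw [Derivation.add_apply, leftDer_X, leftDer_X, leftDer_X, map_add, map_add]

theorem leftDer_smul (q : ℚ) (a : RatExt R) : leftDer b (q • a) = q • leftDer b a :=
  MvPolynomial.derivation_ext fun j => by
    rw [Derivation.smul_apply, leftDer_X, leftDer_X, map_smul, map_smul]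

/-- Derivations are determined on the generators; there the commutator is the one of two left
multiplications, by `leftDer_linForm`. -/
theorem leftDer_lie (a c : RatExt R) : leftDer b (a * c - c * a) = ⁅leftDer b a, leftDer b c⁆ :=
  MvPolynomial.derivation_ext fun j => by
    rw [Derivation.commutator_apply, leftDer_X, leftDer_X, leftDer_X, leftDer_linForm,
      leftDer_linForm, mul_rightAct, mul_rightAct, map_sub, map_sub]

/-- The Lie algebra action of `ℚ ⊗ R` on `ℚ[Y]`. -/
def derAction : RatExt R →ₗ⁅ℚ⁆ Module.End ℚ (MvPolynomial (Option ι) ℚ) where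
  toFun a := (leftDer b a).toLinearMap
  map_add' a c := by rw [leftDer_add]; rfl
  map_smul' q a := by rw [leftDer_smul]; rfl
  map_lie' {a c} := by
    change (leftDer b (a * c - c * a)).toLinearMap = _
    rw [leftDer_lie]
    rfl

/-- The action of the enveloping algebra on `ℚ[Y]`. -/
def envAction : Env R →ₐ[ℚ] Module.End ℚ (MvPolynomial (Option ι) ℚ) :=
  UniversalEnvelopingAlgebra.lift ℚ (derAction b)

theorem envAction_ι (a : RatExt R) (q : MvPolynomial (Option ι) ℚ) :
    envAction b (envι a) q = leftDer b a q := by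
  have := UniversalEnvelopingAlgebra.lift_ι_apply ℚ (derAction b) a
  exact LinearMap.congr_fun this q

/-- Universal property: the lift of the inclusion into the generated subalgebra, followed by its
embedding, is the identity. -/
theorem adjoin_range_envι : Algebra.adjoin ℚ (Set.range (envι (R := R))) = ⊤ := by
  let S : Subalgebra ℚ (Env R) := Algebra.adjoin ℚ (Set.range (envι (R := R)))
  have hS (a : RatExt R) : envι a ∈ S := Algebra.subset_adjoin (Set.mem_range_self a)
  let f : RatExt R →ₗ⁅ℚ⁆ S :=
    { toFun := fun a => ⟨envι a, hS a⟩
      map_add' := fun a c => Subtype.ext (map_add _ _ _)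
      map_smul' := fun q a => Subtype.ext (map_smul _ _ _)
      map_lie' := fun {a c} => Subtype.ext (envι_lie a c) }
  have h : S.val.comp (UniversalEnvelopingAlgebra.lift ℚ f) = AlgHom.id ℚ (Env R) := by
    refine UniversalEnvelopingAlgebra.hom_ext ℚ (LieHom.ext fun a => ?_)
    exact congrArg S.val (UniversalEnvelopingAlgebra.lift_ι_apply ℚ f a)
  rw [eq_top_iff]
  intro x _
  have := AlgHom.congr_fun h x
  rw [AlgHom.id_apply] at this
  rw [← this]
  exact (UniversalEnvelopingAlgebra.lift ℚ f x).2

end Enveloping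

end

section

open MvPowerSeries Finset

/-! ### Uniqueness for the Euler equation; moving series past operators -/

section Uniqueness

variable {σ A B : Type*} [Ring A] [Ring B] [Algebra ℚ A] [Algebra ℚ B]

/-- As `G` has no constant term, the equation expresses each coefficient, times its degree, by
coefficients of smaller degree; positive degrees are invertible over ℚ. -/
theorem eq_zero_of_euler_eq {G Ψ : MvPowerSeries σ A} (hG : coeff 0 G = 0)
    (h : euler Ψ = G * Ψ) (h0 : coeff 0 Ψ = 0) : Ψ = 0 := by
  classical
  have key : ∀ n : ℕ, ∀ m : σ →₀ ℕ, Finsupp.degree m < n → coeff m Ψ = 0 := by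
    intro n
    induction n with
    | zero => intro m hm; omega
    | succ n ih =>
      intro m hm
      by_cases hm0 : m = 0
      · rw [hm0, h0]
      have h1 := congrArg (coeff m) h
      rw [coeff_euler, coeff_mul, sum_eq_zero, ← Nat.cast_smul_eq_nsmul ℚ] at h1
      · refine (smul_eq_zero.1 h1).resolve_left ?_
        exact Nat.cast_ne_zero.2 fun h => hm0 ((Finsupp.degree_eq_zero_iff _).1 h)
      · intro p hp
        rw [HasAntidiagonal.mem_antidiagonal] at hp
        by_cases hp0 : p.1 = 0
        · rw [hp0, hG, zero_mul]
        · rw [ih p.2, mul_zero]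
          have h2 : 0 < Finsupp.degree p.1 :=
            Nat.pos_of_ne_zero fun h => hp0 ((Finsupp.degree_eq_zero_iff _).1 h)
          have h3 := congrArg Finsupp.degree hp
          rw [map_add] at h3
          omega
  ext m
  exact key _ m (Nat.lt_succ_self _)

omit [Algebra ℚ A] in
theorem euler_C (a : A) : euler (C a : MvPowerSeries σ A) = 0 := by
  classical
  ext m
  rw [coeff_euler, coeff_C]
  split_ifs with h <;> simp [h]

theorem mapCoeff_add (φ : A →ₗ[ℚ] B) (f g : MvPowerSeries σ A) :
    mapCoeff φ (f + g) = mapCoeff φ f + mapCoeff φ g := by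
  ext m
  simp only [coeff_mapCoeff, map_add]

theorem mapCoeff_smul (φ : A →ₗ[ℚ] B) (c : ℚ) (f : MvPowerSeries σ A) :
    mapCoeff φ (c • f) = c • mapCoeff φ f := by
  ext m
  rw [coeff_mapCoeff, coeff_rat_smul, coeff_rat_smul, coeff_mapCoeff, map_smul]

theorem C_rat_smul (c : ℚ) (a : A) : (C (c • a) : MvPowerSeries σ A) = c • C a := by
  classical
  ext m
  rw [coeff_rat_smul, coeff_C, coeff_C]
  split_ifs <;> simp

theorem mapCoeff_C (φ : A →ₗ[ℚ] B) (a : A) :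
    mapCoeff φ (C a : MvPowerSeries σ A) = C (φ a) := by
  classical
  ext m
  rw [coeff_mapCoeff, coeff_C, coeff_C]
  split_ifs <;> simp

omit [Algebra ℚ A] in
theorem coeff_zero_mul' (f g : MvPowerSeries σ A) : coeff 0 (f * g) = coeff 0 f * coeff 0 g := by
  simp only [coeff_zero_eq_constantCoeff, map_mul]

/-- Extends a commutation rule from constants to series. The operator need not be a homomorphism on
coefficients, so the sums are rearranged by hand. -/
theorem mul_mapCoeff_of_forall {φ : A →ₗ[ℚ] B} {Ξ : MvPowerSeries σ B} {H : MvPowerSeries σ A}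
    (h : ∀ a, Ξ * C (φ a) = mapCoeff φ (H * C a) * Ξ) (f : MvPowerSeries σ A) :
    Ξ * mapCoeff φ f = mapCoeff φ (H * f) * Ξ := by
  classical
  ext e
  have h' : ∀ i a, coeff i Ξ * φ a =
      ∑ q ∈ antidiagonal i, φ (coeff q.1 H * a) * coeff q.2 Ξ := fun i a => by
    have := congrArg (coeff i) (h a)
    rw [coeff_mul_C, coeff_mul] at this
    rw [this]
    exact sum_congr rfl fun q _ => by rw [coeff_mapCoeff, coeff_mul_C]
  rw [coeff_mul, coeff_mul]
  have hL : ∀ p ∈ antidiagonal e, coeff p.1 Ξ * coeff p.2 (mapCoeff φ f) =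
      ∑ q ∈ antidiagonal p.1, φ (coeff q.1 H * coeff p.2 f) * coeff q.2 Ξ := fun p _ => by
    rw [coeff_mapCoeff, h']
  have hR : ∀ p ∈ antidiagonal e, coeff p.1 (mapCoeff φ (H * f)) * coeff p.2 Ξ =
      ∑ q ∈ antidiagonal p.1, φ (coeff q.1 H * coeff q.2 f) * coeff p.2 Ξ := fun p _ => by
    rw [coeff_mapCoeff, coeff_mul, map_sum, sum_mul]
  rw [sum_congr rfl hL, sum_congr rfl hR, sum_sigma', sum_sigma']
  -- Both sums run over ordered triples of exponents with sum `e`, bracketed differently; the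
  -- involution exchanges the last two members of the triple.
  refine sum_nbij' (fun x => ⟨(x.2.1 + x.1.2, x.2.2), (x.2.1, x.1.2)⟩)
    (fun x => ⟨(x.2.1 + x.1.2, x.2.2), (x.2.1, x.1.2)⟩) ?_ ?_ ?_ ?_ ?_
  · rintro ⟨⟨i, j⟩, ⟨k, l⟩⟩ hx
    simp only [mem_sigma, HasAntidiagonal.mem_antidiagonal] at hx ⊢
    refine ⟨?_, trivial⟩
    rw [← hx.1, ← hx.2]
    abel
  · rintro ⟨⟨i, j⟩, ⟨k, l⟩⟩ hx
    simp only [mem_sigma, HasAntidiagonal.mem_antidiagonal] at hx ⊢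
    refine ⟨?_, trivial⟩
    rw [← hx.1, ← hx.2]
    abel
  · rintro ⟨⟨i, j⟩, ⟨k, l⟩⟩ hx
    simp only [mem_sigma, HasAntidiagonal.mem_antidiagonal] at hx
    obtain ⟨-, rfl⟩ := hx
    rfl
  · rintro ⟨⟨i, j⟩, ⟨k, l⟩⟩ hx
    simp only [mem_sigma, HasAntidiagonal.mem_antidiagonal] at hx
    obtain ⟨-, rfl⟩ := hx
    rfl
  · rintro ⟨⟨i, j⟩, ⟨k, l⟩⟩ hx
    rfl

end Uniqueness

/-! ### Operators that implement a substitution -/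

section Implements

variable {R : Type*} [Ring R] {ι σ τ : Type*} (b : Module.Basis ι ℤ R)

/-- The polynomial ring on which the enveloping algebra acts. -/
abbrev PolyMod (ι : Type*) : Type _ := MvPolynomial (Option ι) ℚ

/-- Multiplication by the linear form of `a * j`. -/
def formMul (j : Option ι) : RatExt R →ₗ[ℚ] Module.End ℚ (PolyMod ι) :=
  (Algebra.lmul ℚ (PolyMod ι)).toLinearMap ∘ₗ linForm b ∘ₗ rightAct b j

/-- A series of operators on `ℚ[Y]` that fixes `1` and implements the substitution
`Y_j ↦ (1 + H) Y_j`. -/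
structure Implements (Ξ : MvPowerSeries τ (Module.End ℚ (PolyMod ι)))
    (H : MvPowerSeries τ (RatExt R)) : Prop where
  comm (j : Option ι) : Ξ * C (Algebra.lmul ℚ (PolyMod ι) (MvPolynomial.X j)) =
    (C (Algebra.lmul ℚ (PolyMod ι) (MvPolynomial.X j)) + mapCoeff (formMul b j) H) * Ξ
  one_zero : coeff 0 Ξ 1 = 1
  one_of_ne (e : τ →₀ ℕ) (he : e ≠ 0) : coeff e Ξ 1 = 0

/-- The substitution `Y_j ↦ (1 + H) Y_j`. -/
def substHom (H : MvPowerSeries τ (RatExt R)) : PolyMod ι →ₐ[ℚ] MvPowerSeries τ (PolyMod ι) :=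
  MvPolynomial.aeval fun j => C (MvPolynomial.X j) + mapCoeff (linForm b ∘ₗ rightAct b j) H

variable {b}

theorem map_lmul_substHom_X (H : MvPowerSeries τ (RatExt R)) (j : Option ι) :
    MvPowerSeries.map (Algebra.lmul ℚ (PolyMod ι)).toRingHom (substHom b H (MvPolynomial.X j)) =
      C (Algebra.lmul ℚ (PolyMod ι) (MvPolynomial.X j)) + mapCoeff (formMul b j) H := by
  rw [substHom, MvPolynomial.aeval_X, map_add, map_C]
  rfl

variable {Ξ Ξ₁ Ξ₂ : MvPowerSeries τ (Module.End ℚ (PolyMod ι))}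
  {H H₁ H₂ : MvPowerSeries τ (RatExt R)}

/-- The rule on generators propagates to all polynomials, since both sides are multiplicative and
linear in `q`. -/
theorem Implements.mul_C (h : Implements b Ξ H) (q : PolyMod ι) :
    Ξ * C (Algebra.lmul ℚ (PolyMod ι) q) =
      MvPowerSeries.map (Algebra.lmul ℚ (PolyMod ι)).toRingHom (substHom b H q) * Ξ := by
  induction q using MvPolynomial.induction_on with
  | C a =>
    have h1 : substHom b H (MvPolynomial.C a) = C (MvPolynomial.C a) := by
      rw [substHom, MvPolynomial.aeval_C, MvPowerSeries.algebraMap_apply]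
      rfl
    rw [h1, map_C]
    ext1 e
    rw [coeff_mul_C]
    refine Eq.trans ?_ (coeff_C_mul e Ξ _).symm
    refine LinearMap.ext fun q => ?_
    change coeff e Ξ (MvPolynomial.C a * q) = MvPolynomial.C a * coeff e Ξ q
    rw [← MvPolynomial.smul_eq_C_mul, ← MvPolynomial.smul_eq_C_mul, map_smul]
  | add p q hp hq => rw [map_add, map_add, mul_add, hp, hq, map_add, map_add, add_mul]
  | mul_X p j hp =>
    rw [map_mul, map_mul, ← mul_assoc, hp, mul_assoc, h.comm, map_mul, map_mul,
      map_lmul_substHom_X, mul_assoc]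

/-- Apply `Implements.mul_C` to the polynomial 1, which `Ξ` fixes. So `Ξ` is determined by `H`, and
two operators can be compared through their substitutions alone. -/
theorem Implements.coeff_apply (h : Implements b Ξ H) (e : τ →₀ ℕ) (q : PolyMod ι) :
    coeff e Ξ q = coeff e (substHom b H q) := by
  classical
  have h1 := congrArg (fun x : MvPowerSeries τ (Module.End ℚ (PolyMod ι)) => coeff e x 1) (h.mul_C q)
  simp only [coeff_mul_C] at h1
  rw [Module.End.mul_apply, Algebra.coe_lmul_eq_mul, LinearMap.mul_apply', mul_one, coeff_mul,
    LinearMap.sum_apply] at h1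
  rw [h1, sum_eq_single (e, 0)]
  · rw [Module.End.mul_apply, h.one_zero, coeff_map]
    exact mul_one _
  · rintro ⟨i, j⟩ hp hne
    rw [Module.End.mul_apply, h.one_of_ne, map_zero]
    rintro rfl
    rw [HasAntidiagonal.mem_antidiagonal, add_zero] at hp
    exact hne (Prod.ext hp rfl)
  · intro hn
    exact absurd (HasAntidiagonal.mem_antidiagonal.2 (add_zero e)) hn

theorem Implements.ext (h₁ : Implements b Ξ₁ H) (h₂ : Implements b Ξ₂ H) : Ξ₁ = Ξ₂ :=
  MvPowerSeries.ext fun e => LinearMap.ext fun q => by rw [h₁.coeff_apply, h₂.coeff_apply]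

theorem Implements.mul_C_formMul_none (h : Implements b Ξ H) (a : RatExt R) :
    Ξ * C (formMul b none a) =
      mapCoeff (formMul b none) ((1 + H) * C a) * Ξ := by
  have ha : a ∈ Submodule.span ℚ (Set.range (ratBasis b)) := by
    rw [(ratBasis b).span_eq]; trivial
  induction ha using Submodule.span_induction with
  | mem x hx =>
    obtain ⟨U, rfl⟩ := hx
    have h1 : formMul b none (ratBasis b U) =
        Algebra.lmul ℚ (PolyMod ι) (MvPolynomial.X (some U)) := by
      rw [← linForm_basis b U]
      rfl
    rw [h1, h.comm]
    refine congrArg (· * Ξ) ?_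
    rw [add_mul, one_mul, mapCoeff_add]
    refine congrArg₂ (· + ·) ?_ ?_
    · rw [← h1, mapCoeff_C]
    · ext1 e
      rw [coeff_mapCoeff, coeff_mapCoeff, coeff_mul_C]
      rfl
  | zero =>
    have h0 : mapCoeff (formMul b none) (0 : MvPowerSeries τ (RatExt R)) = 0 :=
      MvPowerSeries.ext fun _ => map_zero _
    rw [map_zero, map_zero, map_zero, mul_zero, mul_zero, h0, zero_mul]
  | add x y _ _ hx hy =>
    rw [map_add, map_add, mul_add Ξ, hx, hy, map_add, mul_add, mapCoeff_add, add_mul _ _ Ξ]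
  | smul c x _ hx =>
    rw [map_smul, C_rat_smul, C_rat_smul, mul_smul_comm, hx, mul_smul_comm, mapCoeff_smul,
      smul_mul_assoc]

/-- The form attached to `a` and `j` is the form of the element `rightAct b j a`, so the case `none`
covers every `j`. -/
theorem Implements.mul_C_formMul (h : Implements b Ξ H) (j : Option ι) (a : RatExt R) :
    Ξ * C (formMul b j a) = mapCoeff (formMul b j) ((1 + H) * C a) * Ξ := by
  refine (h.mul_C_formMul_none (rightAct b j a)).trans (congrArg (· * Ξ) ?_)
  ext1 e
  rw [coeff_mapCoeff, coeff_mapCoeff, coeff_mul_C, coeff_mul_C, mul_rightAct]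
  rfl

/-- The composite multiplies the generators by `(1 + H₁) * (1 + H₂)`. -/
theorem Implements.mul (h₁ : Implements b Ξ₁ H₁) (h₂ : Implements b Ξ₂ H₂) :
    Implements b (Ξ₁ * Ξ₂) (H₁ + H₂ + H₁ * H₂) where
  comm j := by
    have h := mul_mapCoeff_of_forall (h₁.mul_C_formMul j) H₂
    rw [mul_assoc, h₂.comm, ← mul_assoc, mul_add, h₁.comm, h, ← add_mul, mul_assoc, add_assoc,
      ← mapCoeff_add, add_mul 1, one_mul, add_assoc]
  one_zero := by
    rw [coeff_zero_mul', Module.End.mul_apply, h₂.one_zero, h₁.one_zero]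
  one_of_ne e he := by
    classical
    rw [coeff_mul, LinearMap.sum_apply, sum_eq_zero]
    rintro ⟨i, j⟩ hp
    rw [Module.End.mul_apply]
    by_cases hj : j = 0
    · rw [HasAntidiagonal.mem_antidiagonal, hj, add_zero] at hp
      rw [hj, h₂.one_zero, h₁.one_of_ne _ fun h => he (hp.symm.trans h)]
    · rw [h₂.one_of_ne _ hj, map_zero]

theorem coeff_subs_one {z : τ → MvPowerSeries σ ℚ} (hz : HasSubst z) (h : Implements b Ξ H)
    (e : σ →₀ ℕ) : coeff e (subs z Ξ) 1 = coeff e (powProd z 0) • (1 : PolyMod ι) := by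
  classical
  have hK : ∀ k, coeff e (powProd z k) ≠ 0 → k ∈ insert 0 (finite_coeff_powProd hz e).toFinset :=
    fun k h => mem_insert_of_mem (by simpa using h)
  rw [coeff_subs_eq_sum hK, LinearMap.sum_apply, sum_eq_single 0]
  · rw [LinearMap.smul_apply, h.one_zero]
  · intro k _ hk
    rw [LinearMap.smul_apply, h.one_of_ne k hk, smul_zero]
  · intro hn
    exact absurd (mem_insert_self _ _) hn

theorem Implements.subs {z : τ → MvPowerSeries σ ℚ} (hz : HasSubst z) (h : Implements b Ξ H) :
    Implements b (subs z Ξ) (subs z H) where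
  comm j := by
    have h1 := congrArg (WreathRing.subs z) (h.comm j)
    rwa [subs_mul hz, subs_mul hz, subs_add hz, subs_C, subs_mapCoeff hz] at h1
  one_zero := by
    rw [coeff_subs_one hz h, powProd_zero, coeff_zero_one, one_smul]
  one_of_ne e he := by
    classical
    rw [coeff_subs_one hz h, powProd_zero, coeff_one, if_neg he, zero_smul]

variable (b) in
/-- The image of `envTheta` under the representation. -/
theorem implements_envTheta (e : ι → σ) :
    Implements b (MvPowerSeries.map (envAction b).toRingHom (envTheta b e))
      (genSeries e (ratBasis b)) := by
  classical
  set Ξ := MvPowerSeries.map (envAction b).toRingHom (envTheta b e) with hΞ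
  set F := genSeries e (ratBasis b) with hF
  set Y := genGeom b e with hY
  set G : MvPowerSeries σ (Module.End ℚ (PolyMod ι)) :=
    MvPowerSeries.map (envAction b).toRingHom (mapCoeff envι Y) with hG
  have hG' (i) (q : PolyMod ι) : coeff i G q = leftDer b (coeff i Y) q := by
    rw [hG, coeff_map, coeff_mapCoeff]
    exact envAction_ι b _ q
  have hG0 : coeff 0 G = 0 := by
    rw [hG, coeff_map, coeff_mapCoeff, coeff_zero_genGeom, map_zero, map_zero]
  have hE : euler Ξ = G * Ξ := by
    have h := congrArg (MvPowerSeries.map (envAction b).toRingHom) (euler_envTheta b e)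
    rw [map_mul] at h
    rw [← h]
    ext1 m
    rw [coeff_euler, hΞ, coeff_map, coeff_map, coeff_euler, map_nsmul]
  have h0 : coeff 0 Ξ = 1 := by rw [hΞ, coeff_map, coeff_zero_envTheta, map_one]
  constructor
  · intro j
    set L : MvPowerSeries σ (Module.End ℚ (PolyMod ι)) :=
      C (Algebra.lmul ℚ (PolyMod ι) (MvPolynomial.X j)) with hL
    have hEM : euler (mapCoeff (formMul b j) F) = mapCoeff (formMul b j) F := by
      rw [euler_mapCoeff, euler_genSeries]
    -- The commutator of a derivation with a multiplication is multiplication by the derivative.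
    have hGL : G * L = L * G + mapCoeff (formMul b j) Y := by
      ext1 m
      rw [map_add, hL, coeff_mul_C, coeff_C_mul]
      refine LinearMap.ext fun q => ?_
      change coeff m G (MvPolynomial.X j * q) =
        MvPolynomial.X j * coeff m G q + linForm b (rightAct b j (coeff m Y)) * q
      rw [hG', hG', Derivation.leibniz, leftDer_X, smul_eq_mul, smul_eq_mul, mul_comm q]
    have hGM : G * mapCoeff (formMul b j) F =
        mapCoeff (formMul b j) F * G + mapCoeff (formMul b j) (Y * F) := by
      ext1 m
      rw [map_add, coeff_mapCoeff, coeff_mul, coeff_mul_swap, coeff_mul, map_sum,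
        ← sum_add_distrib]
      refine sum_congr rfl fun p _ => ?_
      refine LinearMap.ext fun q => ?_
      change coeff p.1 G (linForm b (rightAct b j (coeff p.2 F)) * q) =
        linForm b (rightAct b j (coeff p.2 F)) * coeff p.1 G q +
          linForm b (rightAct b j (coeff p.1 Y * coeff p.2 F)) * q
      rw [hG', hG', Derivation.leibniz, leftDer_linForm, mul_rightAct, smul_eq_mul, smul_eq_mul,
        mul_comm q]
    -- This is `F = Y + Y * F`, that is `Y = F / (1 + F)`. With it the terms `Y` and `Y * F`
    -- produced by the two commutators combine into the `F` that the Euler operator produces.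
    have hYF : mapCoeff (formMul b j) F =
        mapCoeff (formMul b j) Y + mapCoeff (formMul b j) (Y * F) := by
      rw [← mapCoeff_add]
      refine congrArg (mapCoeff (formMul b j)) ?_
      rw [eq_comm, ← eq_sub_iff_add_eq]
      exact genGeom_eq b e
    rw [← sub_eq_zero]
    -- The difference of the two sides solves the same equation as `Ξ` and has no constant term.
    refine eq_zero_of_euler_eq hG0 ?_ ?_
    · rw [map_sub, euler_mul, euler_mul, hE, map_add, hEM, hL, euler_C, ← hL, mul_zero, add_zero,
        zero_add, mul_sub, mul_assoc, ← mul_assoc G (L + _), mul_add G, hGL, hGM, ← mul_assoc (L + _)]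
      rw [← add_mul]
      refine congrArg₂ (· - ·) rfl (congrArg (· * Ξ) ?_)
      rw [add_mul]
      nth_rewrite 1 [hYF]
      abel
    · rw [map_sub, coeff_zero_mul', coeff_zero_mul', h0, map_add, coeff_mapCoeff, hF,
        coeff_zero_genSeries, map_zero, add_zero, mul_one, one_mul, sub_self]
  · rw [h0, Module.End.one_apply]
  -- Derivations kill 1, so the Euler equation gives by induction on the degree that `Ξ` fixes 1.
  · have key : ∀ n : ℕ, ∀ m : σ →₀ ℕ, Finsupp.degree m < n →
        m ≠ 0 → coeff m Ξ 1 = 0 := by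
      intro n
      induction n with
      | zero => intro m hm; omega
      | succ n ih =>
        intro m hm hm0
        have h1 := congrArg (fun x : MvPowerSeries σ (Module.End ℚ (PolyMod ι)) => coeff m x 1) hE
        simp only [coeff_euler] at h1
        rw [coeff_mul, LinearMap.sum_apply, sum_eq_zero, ← Nat.cast_smul_eq_nsmul ℚ,
          LinearMap.smul_apply] at h1
        · refine (smul_eq_zero.1 h1).resolve_left ?_
          exact Nat.cast_ne_zero.2 fun h => hm0 ((Finsupp.degree_eq_zero_iff _).1 h)
        · intro p hp
          rw [HasAntidiagonal.mem_antidiagonal] at hp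
          rw [Module.End.mul_apply]
          by_cases hp0 : p.1 = 0
          · rw [hp0, hG0, LinearMap.zero_apply]
          by_cases hp2 : p.2 = 0
          · rw [hp2, h0, Module.End.one_apply, hG']
            exact Derivation.map_one_eq_zero _
          · rw [ih p.2 _ hp2, map_zero]
            have h2 : 0 < Finsupp.degree p.1 :=
              Nat.pos_of_ne_zero fun h => hp0 ((Finsupp.degree_eq_zero_iff _).1 h)
            have h3 := congrArg Finsupp.degree hp
            rw [map_add] at h3
            omega
    exact fun m => key _ m (Nat.lt_succ_self _)

end Implements

end

section

open MvPowerSeries Finset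

/-! ### A basis of the enveloping algebra -/

section EnvBasis

variable {R : Type*} [Ring R] {ι σ : Type*} (b : Module.Basis ι ℤ R)

/-- The coefficients of `exp (ι (log (1 + ∑ x_U U)))`. -/
def envCoeff (n : ι →₀ ℕ) : Env R := coeff n (envTheta b id)

theorem envCoeff_zero : envCoeff b 0 = 1 := coeff_zero_envTheta b id

/-! ### Linear independence -/

variable (ι) in
/-- The generic linear form `∑ x_U X_U`. -/
def genForm : MvPowerSeries ι (MvPolynomial ι ℚ) := genSeries id MvPolynomial.X

theorem coeff_genForm (n : ι →₀ ℕ) : ∃ c : ℚ, coeff n (genForm ι) = MvPolynomial.monomial n c ∧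
    0 ≤ c ∧ ∀ U, n = Finsupp.single U 1 → 0 < c := by
  by_cases h : ∃ U : ι, n = Finsupp.single U 1
  · obtain ⟨U, rfl⟩ := h
    exact ⟨1, coeff_genSeries_single (e := id) Function.injective_id _ U, zero_le_one,
      fun _ _ => one_pos⟩
  · push Not at h
    exact ⟨0, by rw [genForm, coeff_genSeries_of_ne (e := id) _ h, map_zero], le_rfl,
      fun U hU => absurd hU (h U)⟩

/-- In degree `N` the scalar is a multinomial coefficient. Only its positivity is used later;
nonnegativity of all scalars rules out cancellation in the induction. -/
theorem coeff_genForm_pow (N : ℕ) (n : ι →₀ ℕ) : ∃ c : ℚ,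
    coeff n (genForm ι ^ N) = MvPolynomial.monomial n c ∧ 0 ≤ c ∧
      (Finsupp.degree n = N → 0 < c) := by
  classical
  induction N generalizing n with
  | zero =>
    by_cases h : n = 0
    · exact ⟨1, by rw [h, pow_zero, coeff_zero_one]; rfl, zero_le_one, fun _ => one_pos⟩
    · refine ⟨0, by rw [pow_zero, coeff_one, if_neg h, map_zero], le_rfl, fun h' => ?_⟩
      exact absurd ((Finsupp.degree_eq_zero_iff _).1 h') h
  | succ N ih =>
    choose c hc hc0 hcp using ih
    choose g hg hg0 hgp using coeff_genForm (ι := ι)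
    refine ⟨∑ p ∈ antidiagonal n, c p.1 * g p.2, ?_,
      sum_nonneg fun p _ => mul_nonneg (hc0 _) (hg0 _), fun hn => ?_⟩
    · rw [pow_succ, coeff_mul, map_sum]
      refine sum_congr rfl fun p hp => ?_
      rw [HasAntidiagonal.mem_antidiagonal] at hp
      rw [hc, hg, MvPolynomial.monomial_mul, hp]
    · have hn0 : n ≠ 0 := by
        rintro rfl
        simp at hn
      obtain ⟨U, hU⟩ := Finsupp.support_nonempty_iff.2 hn0
      have hle : Finsupp.single U 1 ≤ n := by
        rw [Finsupp.single_le_iff]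
        exact Nat.one_le_iff_ne_zero.2 (Finsupp.mem_support_iff.1 hU)
      have hadd := tsub_add_cancel_of_le hle
      refine sum_pos' (fun p _ => mul_nonneg (hc0 _) (hg0 _))
        ⟨(n - Finsupp.single U 1, Finsupp.single U 1), HasAntidiagonal.mem_antidiagonal.2 hadd, ?_⟩
      refine mul_pos (hcp _ ?_) (hgp _ U rfl)
      have := congrArg Finsupp.degree hadd
      rw [map_add, Finsupp.degree_single] at this
      change Finsupp.degree (n - Finsupp.single U 1) = N
      omega

/-- Operators are tested on the power `N` of the free generator, where the coefficient at `n`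
becomes a multiple of the monomial `n`. Because the hypothesis concerns operators, the result gives
both linear independence and, once spanning is known, faithfulness. -/
theorem eq_zero_of_envAction_sum (l : (ι →₀ ℕ) →₀ ℚ)
    (h : envAction b (l.sum fun n c => c • envCoeff b n) = 0) : l = 0 := by
  classical
  by_contra hl
  obtain ⟨n₀, hn₀⟩ := Finsupp.support_nonempty_iff.2 hl
  set N := Finsupp.degree n₀
  -- Killing the free generator leaves only the generic linear form out of `(1 + F) Y`. The choice
  -- of `N` as the degree of `n₀` makes the scalar at `n₀` positive.
  let κ : PolyMod ι →ₐ[ℚ] MvPolynomial ι ℚ :=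
    MvPolynomial.aeval fun j : Option ι => j.elim 0 MvPolynomial.X
  have hκ (n : ι →₀ ℕ) : κ (envAction b (envCoeff b n) (MvPolynomial.X none ^ N)) =
      coeff n (genForm ι ^ N) := by
    have h1 := (implements_envTheta b (id : ι → ι)).coeff_apply n (MvPolynomial.X none ^ N)
    rw [coeff_map] at h1
    refine (congrArg κ h1).trans ?_
    have h2 : MvPowerSeries.map κ.toRingHom (substHom b (genSeries id (ratBasis b))
        (MvPolynomial.X none ^ N)) = genForm ι ^ N := by
      rw [map_pow, map_pow]
      congr 1
      rw [substHom, MvPolynomial.aeval_X, map_add, map_C]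
      have h3 : κ.toRingHom (MvPolynomial.X none) = 0 :=
        MvPolynomial.aeval_X (fun j : Option ι => j.elim 0 MvPolynomial.X) none
      rw [h3, map_zero, zero_add, genForm]
      have h4 : ∀ f : MvPowerSeries ι (PolyMod ι), MvPowerSeries.map κ.toRingHom f =
          mapCoeff κ.toLinearMap f := fun _ => rfl
      rw [h4, mapCoeff_genSeries Function.injective_id, mapCoeff_genSeries Function.injective_id]
      congr 1
      funext U
      change κ (linForm b (ratBasis b U)) = _
      rw [linForm_basis]
      exact MvPolynomial.aeval_X (fun j : Option ι => j.elim 0 MvPolynomial.X) (some U)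
    rw [← h2]
    exact (coeff_map _ _ _).symm
  choose c hc hc0 hcp using coeff_genForm_pow (ι := ι) N
  have h1 := congrArg (fun x : Module.End ℚ (PolyMod ι) =>
    MvPolynomial.coeff n₀ (κ (x (MvPolynomial.X none ^ N)))) h
  simp only [Finsupp.sum, map_sum, map_smul, LinearMap.sum_apply, LinearMap.smul_apply, hκ, hc,
    LinearMap.zero_apply, map_zero, MvPolynomial.coeff_sum, MvPolynomial.coeff_smul,
    MvPolynomial.coeff_monomial, MvPolynomial.coeff_zero] at h1
  rw [sum_eq_single n₀] at h1
  · rw [if_pos rfl, smul_eq_mul, mul_eq_zero] at h1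
    exact h1.elim (Finsupp.mem_support_iff.1 hn₀) (hcp n₀ rfl).ne'
  · intro n _ hn
    rw [if_neg hn, smul_zero]
  · intro hn
    exact absurd hn₀ hn

theorem linearIndependent_envCoeff : LinearIndependent ℚ (envCoeff b) := by
  rw [linearIndependent_iff]
  intro l hl
  refine eq_zero_of_envAction_sum b l ?_
  rw [Finsupp.linearCombination_apply] at hl
  rw [hl, map_zero]

/-! ### Spanning -/

/-- The product of the images of the letters of a word in the enveloping algebra. -/
def wordProd (w : List ι) : Env R := (w.map fun U => envι (ratBasis b U)).prod

theorem wordProd_cons (U : ι) (w : List ι) :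
    wordProd b (U :: w) = envι (ratBasis b U) * wordProd b w := by
  rw [wordProd, List.map_cons, List.prod_cons]; rfl

/-- The span of the words with fewer than `k` letters. -/
def wordFil (k : ℕ) : Submodule ℚ (Env R) :=
  Submodule.span ℚ {x | ∃ w : List ι, w.length < k ∧ wordProd b w = x}

variable {b}

theorem wordFil_mono {k l : ℕ} (h : k ≤ l) : wordFil b k ≤ wordFil b l :=
  Submodule.span_mono fun _ ⟨w, hw, e⟩ => ⟨w, hw.trans_le h, e⟩

theorem wordProd_mem {w : List ι} {k : ℕ} (h : w.length < k) : wordProd b w ∈ wordFil b k :=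
  Submodule.subset_span ⟨w, h, rfl⟩

theorem envι_mul_mem_wordFil (a : RatExt R) {k : ℕ} {x : Env R} (hx : x ∈ wordFil b k) :
    envι a * x ∈ wordFil b (k + 1) := by
  have ha : a ∈ Submodule.span ℚ (Set.range (ratBasis b)) := by
    rw [(ratBasis b).span_eq]; trivial
  induction ha using Submodule.span_induction with
  | zero => rw [map_zero, zero_mul]; exact zero_mem _
  | add a c _ _ ha hc => rw [map_add, add_mul]; exact add_mem ha hc
  | smul q a _ ha => rw [map_smul, smul_mul_assoc]; exact Submodule.smul_mem _ _ ha
  | mem a ha =>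
    obtain ⟨U, rfl⟩ := ha
    induction hx using Submodule.span_induction with
    | zero => rw [mul_zero]; exact zero_mem _
    | add x y _ _ hx hy => rw [mul_add]; exact add_mem hx hy
    | smul q x _ hx => rw [mul_smul_comm]; exact Submodule.smul_mem _ _ hx
    | mem x hx =>
      obtain ⟨w, hw, rfl⟩ := hx
      rw [← wordProd_cons]
      exact wordProd_mem (by simpa using hw)

/-- Exchanging two adjacent letters costs a commutator, which lies in `ℚ ⊗ R` and so counts as a
single letter: the error consists of strictly shorter words. -/
theorem wordProd_sub_mem_of_perm {w w' : List ι} (h : w.Perm w') :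
    wordProd b w - wordProd b w' ∈ wordFil b w.length := by
  induction h with
  | nil => rw [sub_self]; exact zero_mem _
  | cons U h ih =>
    rw [wordProd_cons, wordProd_cons, ← mul_sub]
    exact envι_mul_mem_wordFil _ ih
  | swap U V w =>
    rw [wordProd_cons, wordProd_cons, wordProd_cons, wordProd_cons, ← mul_assoc, ← mul_assoc,
      ← sub_mul, ← envι_lie]
    exact envι_mul_mem_wordFil _ (wordProd_mem (by simp))
  | trans h₁ h₂ ih₁ ih₂ =>
    rw [← sub_add_sub_cancel]
    exact add_mem ih₁ (h₁.length_eq ▸ ih₂)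

/-- The content of a word. -/
def content (w : List ι) : ι →₀ ℕ := (w.map fun U => Finsupp.single U 1).sum

theorem content_cons (U : ι) (w : List ι) : content (U :: w) = Finsupp.single U 1 + content w := by
  rw [content, List.map_cons, List.sum_cons]; rfl

theorem degree_content (w : List ι) : Finsupp.degree (content w) = w.length := by
  induction w with
  | nil => simp [content]
  | cons U w ih => rw [content_cons, map_add, ih, Finsupp.degree_single, List.length_cons, add_comm]

theorem content_perm {w w' : List ι} (h : w.Perm w') : content w = content w' :=
  (h.map _).sum_eq

theorem mem_of_content_ne_zero {w : List ι} {U : ι} (h : content w U ≠ 0) : U ∈ w := by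
  induction w with
  | nil => simp [content] at h
  | cons V w ih =>
    by_cases hV : V = U
    · exact hV ▸ List.mem_cons_self
    · refine List.mem_cons_of_mem _ (ih ?_)
      rwa [content_cons, Finsupp.add_apply, Finsupp.single_eq_of_ne (Ne.symm hV), zero_add] at h

variable (b)

theorem coeff_genGeom_single (U : ι) :
    coeff (Finsupp.single U 1) (genGeom b id) = ratBasis b U := by
  classical
  have h : coeff (Finsupp.single U 1) (genSeries id (ratBasis b)) = ratBasis b U :=
    coeff_genSeries_single (e := id) Function.injective_id _ U
  rw [genGeom_eq, map_sub, h, coeff_mul, sum_eq_zero, sub_zero]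
  intro p hp
  rw [HasAntidiagonal.mem_antidiagonal] at hp
  have h3 := congrArg Finsupp.degree hp
  rw [map_add, Finsupp.degree_single] at h3
  by_cases h1 : p.1 = 0
  · rw [h1, coeff_zero_genGeom, zero_mul]
  · have h2 : 0 < Finsupp.degree p.1 :=
      Nat.pos_of_ne_zero fun h => h1 ((Finsupp.degree_eq_zero_iff _).1 h)
    rw [(Finsupp.degree_eq_zero_iff p.2).1 (by omega), coeff_zero_genSeries, mul_zero]

theorem degree_smul_envCoeff [DecidableEq ι] (n : ι →₀ ℕ) : ((Finsupp.degree n : ℕ) : ℚ) • envCoeff b n =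
    ∑ p ∈ antidiagonal n, envι (coeff p.1 (genGeom b id)) * envCoeff b p.2 := by
  have h := congrArg (coeff n) (euler_envTheta b (id : ι → ι))
  rw [coeff_euler, coeff_mul] at h
  rw [Nat.cast_smul_eq_nsmul]
  exact h

theorem envCoeff_mem_wordFil (n : ι →₀ ℕ) : envCoeff b n ∈ wordFil b (Finsupp.degree n + 1) := by
  classical
  have key : ∀ N : ℕ, ∀ n : ι →₀ ℕ, Finsupp.degree n < N →
      envCoeff b n ∈ wordFil b (Finsupp.degree n + 1) := by
    intro N
    induction N with
    | zero => intro n hn; omega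
    | succ N ih =>
      intro n hn
      by_cases hn0 : n = 0
      · rw [hn0, envCoeff_zero]
        exact wordProd_mem (b := b) (w := []) (by simp)
      have hd : ((Finsupp.degree n : ℕ) : ℚ) ≠ 0 :=
        Nat.cast_ne_zero.2 fun h => hn0 ((Finsupp.degree_eq_zero_iff _).1 h)
      rw [← inv_smul_smul₀ hd (envCoeff b n), degree_smul_envCoeff]
      refine Submodule.smul_mem _ _ (sum_mem fun p hp => ?_)
      rw [HasAntidiagonal.mem_antidiagonal] at hp
      by_cases h1 : p.1 = 0
      · rw [h1, coeff_zero_genGeom, map_zero, zero_mul]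
        exact zero_mem _
      have h2 : 0 < Finsupp.degree p.1 :=
        Nat.pos_of_ne_zero fun h => h1 ((Finsupp.degree_eq_zero_iff _).1 h)
      have h3 := congrArg Finsupp.degree hp
      rw [map_add] at h3
      exact wordFil_mono (by omega) (envι_mul_mem_wordFil _ (ih p.2 (by omega)))
  exact key _ n (Nat.lt_succ_self _)

/-- Leading terms. In the Euler recursion only the linear part of `F / (1 + F)` prefixes a letter
without losing length, and all words of one content agree modulo shorter ones; positivity prevents
the scalars from cancelling. -/
theorem exists_envCoeff_sub_smul_mem (w : List ι) : ∃ c : ℚ, 0 < c ∧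
    envCoeff b (content w) - c • wordProd b w ∈ wordFil b w.length := by
  classical
  have key : ∀ N : ℕ, ∀ w : List ι, w.length = N → ∃ c : ℚ, 0 < c ∧
    envCoeff b (content w) - c • wordProd b w ∈ wordFil b w.length := by
    intro N
    induction N with
    | zero =>
      intro w hw
      rw [List.length_eq_zero_iff] at hw
      subst hw
      refine ⟨1, one_pos, ?_⟩
      change envCoeff b 0 - (1 : ℚ) • (1 : Env R) ∈ _
      rw [envCoeff_zero, one_smul, sub_self]
      exact zero_mem _
    | succ N ih =>
      intro w hw
      set n := content w with hn
      have hdeg : Finsupp.degree n = N + 1 := by rw [hn, degree_content, hw]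
      -- A splitting whose first part is a single variable contributes a positive multiple of `w`;
      -- for any other the first part is 0 or has degree at least 2, and only shorter words arise.
      have hterm : ∀ p : (ι →₀ ℕ) × (ι →₀ ℕ), p ∈ antidiagonal n → ∃ c : ℚ, 0 ≤ c ∧
          ((∃ U, p.1 = Finsupp.single U 1) → 0 < c) ∧
          envι (coeff p.1 (genGeom b id)) * envCoeff b p.2 - c • wordProd b w ∈
            wordFil b w.length := by
        intro p hp
        rw [HasAntidiagonal.mem_antidiagonal] at hp
        have h3 := congrArg Finsupp.degree hp
        rw [map_add] at h3
        by_cases hU : ∃ U, p.1 = Finsupp.single U 1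
        · obtain ⟨U, hU⟩ := hU
          have hUw : U ∈ w := by
            refine mem_of_content_ne_zero ?_
            rw [← hn, ← hp, hU, Finsupp.add_apply, Finsupp.single_eq_same]
            omega
          have hperm : w.Perm (U :: w.erase U) := List.perm_cons_erase hUw
          have hcont : content (w.erase U) = p.2 := by
            have := content_perm hperm
            rw [content_cons, ← hn, ← hp, hU] at this
            exact (add_left_cancel this).symm
          have hlen : (w.erase U).length = N := by
            rw [List.length_erase_of_mem hUw, hw]; rfl
          obtain ⟨c, hc, hmem⟩ := ih _ hlen
          refine ⟨c, hc.le, fun _ => hc, ?_⟩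
          rw [hcont] at hmem
          have h4 := envι_mul_mem_wordFil (ratBasis b U) hmem
          rw [mul_sub, mul_smul_comm, ← wordProd_cons, hlen, ← hw] at h4
          have h5 := Submodule.smul_mem _ (-c) (wordProd_sub_mem_of_perm (b := b) hperm)
          rw [hU, coeff_genGeom_single]
          have h6 := add_mem h4 h5
          rw [neg_smul, smul_sub, neg_sub, sub_add_sub_cancel] at h6
          exact h6
        · refine ⟨0, le_rfl, fun h => absurd h hU, ?_⟩
          rw [zero_smul, sub_zero]
          by_cases h1 : p.1 = 0
          · rw [h1, coeff_zero_genGeom, map_zero, zero_mul]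
            exact zero_mem _
          have h2 : Finsupp.degree p.1 ≠ 0 := fun h => h1 ((Finsupp.degree_eq_zero_iff _).1 h)
          have h4 : Finsupp.degree p.1 ≠ 1 := fun h => hU (by
            have : p.1 ∈ {d : ι →₀ ℕ | Finsupp.degree d = 1} := h
            rw [← Finsupp.range_single_one] at this
            obtain ⟨U, hU⟩ := this
            exact ⟨U, hU.symm⟩)
          exact wordFil_mono (by omega)
            (envι_mul_mem_wordFil _ (envCoeff_mem_wordFil b p.2))
      choose! c hc0 hcp hmem using hterm
      have hsum : 0 < ∑ p ∈ antidiagonal n, c p := by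
        cases w with
        | nil => simp at hw
        | cons U w' =>
          refine sum_pos' hc0 ⟨(Finsupp.single U 1, content w'), ?_, ?_⟩
          · rw [HasAntidiagonal.mem_antidiagonal, hn, content_cons]
          · refine hcp _ ?_ ⟨U, rfl⟩
            rw [HasAntidiagonal.mem_antidiagonal, hn, content_cons]
      have hd : (0 : ℚ) < (Finsupp.degree n : ℕ) := by rw [hdeg]; positivity
      refine ⟨((Finsupp.degree n : ℕ) : ℚ)⁻¹ * ∑ p ∈ antidiagonal n, c p, by positivity, ?_⟩
      rw [← inv_smul_smul₀ hd.ne' (envCoeff b n), mul_smul, ← smul_sub, degree_smul_envCoeff,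
        sum_smul, ← sum_sub_distrib]
      exact Submodule.smul_mem _ _ (sum_mem hmem)
  exact key _ w rfl

/-- Triangularity: the leading scalar is invertible, so each word is recovered modulo shorter words.
-/
theorem wordFil_le_span (k : ℕ) : wordFil b k ≤ Submodule.span ℚ (Set.range (envCoeff b)) := by
  induction k with
  | zero => exact Submodule.span_le.2 fun x ⟨w, hw, _⟩ => absurd hw (Nat.not_lt_zero _)
  | succ k ih =>
    refine Submodule.span_le.2 ?_
    rintro x ⟨w, hw, rfl⟩
    obtain ⟨c, hc, hmem⟩ := exists_envCoeff_sub_smul_mem b w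
    have h1 := ih (wordFil_mono (Nat.lt_succ_iff.1 hw) hmem)
    have h2 : envCoeff b (content w) ∈ Submodule.span ℚ (Set.range (envCoeff b)) :=
      Submodule.subset_span ⟨_, rfl⟩
    have h3 := Submodule.smul_mem _ c⁻¹ (sub_mem h2 h1)
    rwa [sub_sub_cancel, inv_smul_smul₀ hc.ne'] at h3

theorem span_envCoeff : Submodule.span ℚ (Set.range (envCoeff b)) = ⊤ := by
  rw [eq_top_iff]
  intro x _
  have hx : x ∈ Algebra.adjoin ℚ (Set.range (envι (R := R))) := by
    rw [adjoin_range_envι]; trivial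
  suffices h : ∃ k, x ∈ wordFil b k from h.elim fun k hk => wordFil_le_span b k hk
  rw [← Subalgebra.mem_toSubmodule, Algebra.adjoin_eq_span] at hx
  induction hx using Submodule.span_induction with
  | zero => exact ⟨0, zero_mem _⟩
  | add x y _ _ hx hy =>
    obtain ⟨k, hk⟩ := hx trivial
    obtain ⟨l, hl⟩ := hy trivial
    exact ⟨max k l, add_mem (wordFil_mono (le_max_left _ _) hk)
      (wordFil_mono (le_max_right _ _) hl)⟩
  | smul c x _ hx =>
    obtain ⟨k, hk⟩ := hx trivial
    exact ⟨k, Submodule.smul_mem _ _ hk⟩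
  | mem x hx =>
    obtain ⟨L, hL, rfl⟩ := Submonoid.exists_list_of_mem_closure hx
    clear hx
    induction L with
    | nil => exact ⟨1, wordProd_mem (b := b) (w := []) (by simp)⟩
    | cons y L ih =>
      obtain ⟨k, hk⟩ := ih (fun z hz => hL z (List.mem_cons_of_mem _ hz)) trivial
      obtain ⟨a, rfl⟩ := hL y List.mem_cons_self
      rw [List.prod_cons]
      exact ⟨_, envι_mul_mem_wordFil a hk⟩

/-- The basis of the enveloping algebra given by the coefficients of `envTheta`. -/
def envBasis : Module.Basis (ι →₀ ℕ) ℚ (Env R) :=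
  Module.Basis.mk (linearIndependent_envCoeff b) (span_envCoeff b).ge

theorem envBasis_apply (n : ι →₀ ℕ) : envBasis b n = envCoeff b n := Module.Basis.mk_apply _ _ n

theorem envAction_injective : Function.Injective (envAction b) := by
  rw [injective_iff_map_eq_zero]
  intro x hx
  have h := (envBasis b).linearCombination_repr x
  rw [Finsupp.linearCombination_apply] at h
  simp only [envBasis_apply] at h
  rw [← h] at hx
  rw [← h, eq_zero_of_envAction_sum b _ hx, Finsupp.sum_zero_index]

end EnvBasis

end

section

open MvPowerSeries Finset

/-! ### Combined alphabets and multiplicativity in the enveloping algebra -/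

section Alphabets

variable {R : Type*} [Ring R] {ι σ τ : Type*} (b : Module.Basis ι ℤ R)

theorem coeff_subs_genSeries {A : Type*} [Ring A] [Algebra ℚ A] {e : ι → σ}
    (he : Function.Injective e) (v : ι → A) (z : σ → MvPowerSeries τ ℚ) (d : τ →₀ ℕ) :
    coeff d (subs z (genSeries e v)) = ∑ᶠ U, coeff d (z (e U)) • v U := by
  have hg : Function.Injective fun U => Finsupp.single (e U) 1 := fun U V h =>
    he (Finsupp.single_left_injective one_ne_zero h)
  have h1 : (∑ᶠ U, coeff d (z (e U)) • v U) = ∑ᶠ U, (fun k : σ →₀ ℕ =>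
      coeff d (powProd z k) • coeff k (genSeries e v)) (Finsupp.single (e U) 1) :=
    finsum_congr fun U => by simp only [powProd_single, coeff_genSeries_single he]
  rw [h1, ← finsum_mem_range (f := fun k : σ →₀ ℕ =>
    coeff d (powProd z k) • coeff k (genSeries e v)) hg, coeff_subs, ← finsum_mem_univ]
  refine finsum_mem_inter_support_eq _ _ _ ?_
  ext k
  simp only [Set.mem_inter_iff, Set.mem_univ, true_and, Function.mem_support, Set.mem_range,
    iff_and_self]
  intro h
  by_contra hn
  push Not at hn
  exact h (by rw [coeff_genSeries_of_ne v fun U => (hn U).symm, smul_zero])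

theorem coeff_X_ne_zero {s : τ} {d : τ →₀ ℕ} (h : coeff d (X s : MvPowerSeries τ ℚ) ≠ 0) :
    d = Finsupp.single s 1 := by
  classical
  rw [coeff_X] at h
  by_contra hn
  exact h (if_neg hn)

theorem coeff_X_mul_X_ne_zero {s t : τ} {d : τ →₀ ℕ}
    (h : coeff d (X s * X t : MvPowerSeries τ ℚ) ≠ 0) :
    d = Finsupp.single s 1 + Finsupp.single t 1 := by
  classical
  rw [coeff_mul] at h
  obtain ⟨p, hp, hne⟩ := exists_ne_zero_of_sum_ne_zero h
  rw [HasAntidiagonal.mem_antidiagonal] at hp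
  rw [← hp, coeff_X_ne_zero (left_ne_zero_of_mul hne), coeff_X_ne_zero (right_ne_zero_of_mul hne)]

theorem subs_X_genSeries {A : Type*} [Ring A] [Algebra ℚ A] {e : ι → σ} {j : σ → τ}
    (he : Function.Injective e) (hj : Function.Injective j) (v : ι → A) :
    subs (fun s => X (j s)) (genSeries e v) = genSeries (fun U => j (e U)) v := by
  ext d
  rw [coeff_subs_genSeries he]
  by_cases h : ∃ U, d = Finsupp.single (j (e U)) 1
  · obtain ⟨U, rfl⟩ := h
    rw [coeff_genSeries_single (e := fun U => j (e U)) (hj.comp he), finsum_eq_single _ U,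
      coeff_index_single_self_X, one_smul]
    intro V hV
    by_contra hn
    have := coeff_X_ne_zero fun h => hn (by rw [h, zero_smul])
    exact hV (he (hj (Finsupp.single_left_injective one_ne_zero this))).symm
  · push Not at h
    rw [coeff_genSeries_of_ne _ h]
    refine finsum_eq_zero_of_forall_eq_zero fun U => ?_
    by_contra hn
    exact h U (coeff_X_ne_zero fun h => hn (by rw [h, zero_smul]))

theorem coeff_genSeries_mul_genSeries {A : Type*} [Ring A] [Algebra ℚ A] {e₁ e₂ : ι → τ}
    (h₁ : Function.Injective e₁) (h₂ : Function.Injective e₂) (v w : ι → A) (d : τ →₀ ℕ) :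
    coeff d (genSeries e₁ v * genSeries e₂ w) =
      ∑ᶠ VW : ι × ι, coeff d (X (e₁ VW.1) * X (e₂ VW.2) : MvPowerSeries τ ℚ) •
        (v VW.1 * w VW.2) := by
  classical
  have hgen {e : ι → τ} (he : Function.Injective e) (v : ι → A) (c : τ →₀ ℕ) :
      coeff c (genSeries e v) = ∑ᶠ U, coeff c (X (e U) : MvPowerSeries τ ℚ) • v U := by
    have h := subs_X_genSeries (j := (id : τ → τ)) he Function.injective_id v
    conv_lhs => rw [show genSeries e v = genSeries (fun U => id (e U)) v from rfl, ← h]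
    rw [coeff_subs_genSeries he]
    rfl
  let I (e : ι → τ) (he : Function.Injective e) : Finset ι := d.support.preimage e he.injOn
  have hmem {e : ι → τ} (he : Function.Injective e) {U : ι}
      (h : Finsupp.single (e U) 1 ≤ d) : U ∈ I e he := by
    rw [mem_preimage, Finsupp.mem_support_iff]
    rw [Finsupp.single_le_iff] at h
    omega
  have hsum {e : ι → τ} (he : Function.Injective e) (v : ι → A) {c : τ →₀ ℕ} (hc : c ≤ d) :
      coeff c (genSeries e v) = ∑ U ∈ I e he, coeff c (X (e U) : MvPowerSeries τ ℚ) • v U := by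
    rw [hgen he, finsum_eq_sum_of_support_subset]
    intro U hU
    have := coeff_X_ne_zero (s := e U) (d := c) fun h => hU (by simp only [h, zero_smul])
    exact hmem he (this ▸ hc)
  rw [coeff_mul, finsum_eq_sum_of_support_subset (s := I e₁ h₁ ×ˢ I e₂ h₂)]
  · have : ∀ p ∈ antidiagonal d, coeff p.1 (genSeries e₁ v) * coeff p.2 (genSeries e₂ w) =
        ∑ q ∈ I e₁ h₁ ×ˢ I e₂ h₂, (coeff p.1 (X (e₁ q.1) : MvPowerSeries τ ℚ) *
          coeff p.2 (X (e₂ q.2) : MvPowerSeries τ ℚ)) • (v q.1 * w q.2) := fun p hp => by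
      rw [HasAntidiagonal.mem_antidiagonal] at hp
      rw [hsum h₁ v (c := p.1) (hp ▸ le_self_add), hsum h₂ w (c := p.2) (hp ▸ le_add_self),
        sum_mul_sum, sum_product]
      exact sum_congr rfl fun i _ => sum_congr rfl fun j _ => by rw [smul_mul_smul_comm]
    rw [sum_congr rfl this, sum_comm]
    exact sum_congr rfl fun q _ => by rw [coeff_mul, sum_smul]
  · intro q hq
    have := coeff_X_mul_X_ne_zero (s := e₁ q.1) (t := e₂ q.2) (d := d)
      fun h => hq (by simp only [h, zero_smul])
    rw [coe_product, Set.mem_prod]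
    exact ⟨hmem h₁ (this ▸ le_self_add), hmem h₂ (this ▸ le_add_self)⟩

theorem ratBasis_repr_mul (U V W : ι) : (ratBasis b).repr (ratBasis b V * ratBasis b W) U =
    ((b.repr (b V * b W) U : ℤ) : ℚ) := by
  rw [ratBasis_apply, ratBasis_apply, toRatExt_mul]
  have := Module.Basis.baseChange_repr_tmul ℚ b (1 : ℚ) (b V * b W) U
  refine this.trans ?_
  simp

/-- The alphabet of one variable set in two families. -/
theorem coeff_combinedAlphabet (U : ι) (l : ℕ+) (d : (ι × ℕ+) ⊕ (ι × ℕ+) →₀ ℕ) :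
    coeff d (combinedAlphabet b U l) = coeff d (X (Sum.inl (U, l)) : TwoSeries ι) +
      coeff d (X (Sum.inr (U, l)) : TwoSeries ι) + ∑ᶠ VW : ι × ι,
        ((b.repr (b VW.1 * b VW.2) U : ℤ) : ℚ) *
          coeff d (X (Sum.inl (VW.1, l)) * X (Sum.inr (VW.2, l)) : TwoSeries ι) := by
  rw [combinedAlphabet, map_add, map_add, coeff_formalSum]
  rfl

/-- The family of all combined alphabets. -/
def combinedFamily (s : ι × ℕ+) : TwoSeries ι := combinedAlphabet b s.1 s.2

theorem hasSubst_combinedFamily : HasSubst (combinedFamily b) where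
  const_coeff s := by
    have : constantCoeff (combinedFamily b s) = 0 := by
      rw [← coeff_zero_eq_constantCoeff_apply, combinedFamily, coeff_combinedAlphabet,
        coeff_zero_X, coeff_zero_X, finsum_eq_zero_of_forall_eq_zero, add_zero, add_zero]
      intro VW
      rw [coeff_zero_X_mul, mul_zero]
    rw [this]
    exact IsNilpotent.zero
  coeff_zero d := by
    classical
    have h₁ := (hasSubst_X (σ := ι × ℕ+) (τ := (ι × ℕ+) ⊕ (ι × ℕ+)) Sum.inl_injective).coeff_zero d
    have h₂ := (hasSubst_X (σ := ι × ℕ+) (τ := (ι × ℕ+) ⊕ (ι × ℕ+)) Sum.inr_injective).coeff_zero d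
    let I₁ : Finset (ι × ℕ+) := d.support.preimage Sum.inl Sum.inl_injective.injOn
    let I₂ : Finset (ι × ℕ+) := d.support.preimage Sum.inr Sum.inr_injective.injOn
    -- A product term at `d` forces `(V, l)` and `(W, l)` into the support of `d`, and then `U` into
    -- the finite support of the product `V W` in the basis. This makes the substitution legitimate
    -- for infinite `ι`.
    let J : Finset (ι × ℕ+) := (I₁ ×ˢ I₂).biUnion fun p =>
      (b.repr (b p.1.1 * b p.2.1)).support ×ˢ {p.1.2}
    refine ((h₁.union h₂).union J.finite_toSet).subset ?_
    rintro ⟨U, l⟩ hs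
    by_contra hn
    simp only [Set.mem_union, Set.mem_ofPred_eq, not_or, not_not] at hn
    obtain ⟨⟨hn₁, hn₂⟩, hn₃⟩ := hn
    refine hs ?_
    rw [combinedFamily, coeff_combinedAlphabet, hn₁, hn₂, finsum_eq_zero_of_forall_eq_zero,
      add_zero, add_zero]
    intro VW
    by_contra hne
    have hd := coeff_X_mul_X_ne_zero (right_ne_zero_of_mul hne)
    refine hn₃ (mem_coe.2 (mem_biUnion.2 ⟨((VW.1, l), (VW.2, l)), mem_product.2 ⟨?_, ?_⟩, ?_⟩))
    · rw [mem_preimage, hd, Finsupp.mem_support_iff]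
      simp
    · rw [mem_preimage, hd, Finsupp.mem_support_iff]
      simp
    · rw [mem_product, Finsupp.mem_support_iff, mem_singleton]
      exact ⟨fun h => left_ne_zero_of_mul hne (by rw [h, Int.cast_zero]), rfl⟩

/-- The generic element `∑_U p_l^{(U)} U`. -/
def levelSeries (l : ℕ+) : MvPowerSeries (ι × ℕ+) (RatExt R) :=
  genSeries (fun U => (U, l)) (ratBasis b)

theorem level_injective (l : ℕ+) : Function.Injective fun U : ι => (U, l) :=
  fun _ _ h => congrArg Prod.fst h

/-- The identity `(1 + F(x)) (1 + F(y)) = 1 + F(z)`, checked on coordinates: the coordinate of `V W`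
at `U` is the structure constant in the combined alphabet. -/
theorem subs_combinedFamily (l : ℕ+) :
    subs (fun s => X (Sum.inl s)) (levelSeries b l) + subs (fun s => X (Sum.inr s)) (levelSeries b l)
      + subs (fun s => X (Sum.inl s)) (levelSeries b l) *
        subs (fun s => X (Sum.inr s)) (levelSeries b l) =
      subs (combinedFamily b) (levelSeries b l) := by
  classical
  ext d
  have hcoord {z : ι × ℕ+ → TwoSeries ι} (hz : HasSubst z) (U : ι) :
      (ratBasis b).repr (coeff d (subs z (levelSeries b l))) U = coeff d (z (U, l)) := by
    rw [levelSeries, coeff_subs_genSeries (level_injective l)]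
    have hfin : (Function.support fun V => coeff d (z (V, l)) • ratBasis b V).Finite := by
      refine ((hz.coeff_zero d).preimage (level_injective l).injOn).subset fun V hV => ?_
      exact fun h => hV (by simp only [h, zero_smul])
    have h1 : (ratBasis b).coord U (∑ᶠ V, coeff d (z (V, l)) • ratBasis b V) = _ :=
      ((ratBasis b).coord U).toAddMonoidHom.map_finsum hfin
    rw [← Module.Basis.coord_apply, h1, finsum_eq_single _ U]
    · simp
    · intro V hV
      simp [Finsupp.single_eq_of_ne hV.symm]
  refine (ratBasis b).ext_elem fun U => ?_
  rw [hcoord (hasSubst_combinedFamily b), map_add, map_add, map_add, map_add, Finsupp.add_apply,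
    Finsupp.add_apply, hcoord (hasSubst_X Sum.inl_injective), hcoord (hasSubst_X Sum.inr_injective),
    combinedFamily, coeff_combinedAlphabet]
  congr 1
  rw [levelSeries, subs_X_genSeries (level_injective l) Sum.inl_injective,
    subs_X_genSeries (level_injective l) Sum.inr_injective,
    coeff_genSeries_mul_genSeries (e₁ := fun U => Sum.inl (U, l)) (e₂ := fun U => Sum.inr (U, l))
      (Sum.inl_injective.comp (level_injective l)) (Sum.inr_injective.comp (level_injective l))]
  -- A linear functional passes through a `finsum` only if the support is finite; here `d`
  -- determines the pair.
  have hfin : (Function.support fun VW : ι × ι =>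
      coeff d (X (Sum.inl (VW.1, l)) * X (Sum.inr (VW.2, l)) : TwoSeries ι) •
        (ratBasis b VW.1 * ratBasis b VW.2)).Finite := by
    refine Set.Subsingleton.finite fun p hp q hq => ?_
    have h1 := coeff_X_mul_X_ne_zero (s := Sum.inl (p.1, l)) (t := Sum.inr (p.2, l)) (d := d)
      fun h => hp (by simp only [h, zero_smul])
    have h2 := coeff_X_mul_X_ne_zero (s := Sum.inl (q.1, l)) (t := Sum.inr (q.2, l)) (d := d)
      fun h => hq (by simp only [h, zero_smul])
    rw [h1] at h2
    have h3 := DFunLike.congr_fun h2 (Sum.inl (p.1, l))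
    have h4 := DFunLike.congr_fun h2 (Sum.inr (p.2, l))
    simp only [Finsupp.add_apply, Finsupp.single_apply, Sum.inl.injEq, Sum.inr.injEq, reduceCtorEq,
      Prod.mk.injEq, and_true, if_true, if_false, add_zero, zero_add] at h3 h4
    refine Prod.ext ?_ ?_
    · by_contra hne
      rw [if_neg fun h => hne h.symm] at h3
      exact one_ne_zero h3
    · by_contra hne
      rw [if_neg fun h => hne h.symm] at h4
      exact one_ne_zero h4
  have h1 := ((ratBasis b).coord U).toAddMonoidHom.map_finsum hfin
  refine h1.trans (finsum_congr fun VW => ?_)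
  change (ratBasis b).repr (coeff d _ • (ratBasis b VW.1 * ratBasis b VW.2)) U = _
  rw [map_smul, Finsupp.smul_apply, ratBasis_repr_mul, smul_eq_mul, mul_comm]

/-! ### The product formula in the enveloping algebra -/

theorem subs_map_envAction {z : σ → MvPowerSeries τ ℚ} (hz : HasSubst z)
    (f : MvPowerSeries σ (Env R)) :
    subs z (MvPowerSeries.map (envAction b).toRingHom f) =
      MvPowerSeries.map (envAction b).toRingHom (subs z f) :=
  subs_mapCoeff hz (envAction b).toLinearMap f

theorem map_envAction_injective : Function.Injective
    (MvPowerSeries.map (σ := τ) (envAction b).toRingHom) := fun f g h => by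
  ext d
  have := congrArg (coeff d) h
  rw [coeff_map, coeff_map] at this
  exact envAction_injective b this

/-- Checked in the representation: both sides implement the same substitution. -/
theorem subs_X_envTheta {e : ι → σ} (he : Function.Injective e) :
    subs (fun U => X (e U)) (envTheta b id) = envTheta b e := by
  refine map_envAction_injective b ?_
  rw [← subs_map_envAction b (hasSubst_X he)]
  have h := (implements_envTheta b id).subs (hasSubst_X he)
  rw [subs_X_genSeries Function.injective_id he] at h
  exact h.ext (implements_envTheta b e)

/-- Both sides act faithfully, as the substitutions by `(1 + F(x)) (1 + F(y))` and by `1 + F(z)`,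
which agree. -/
theorem subs_envTheta_mul (l : ℕ+) :
    subs (fun s => X (Sum.inl s)) (envTheta b fun U => (U, l)) *
      subs (fun s => X (Sum.inr s)) (envTheta b fun U => (U, l)) =
    subs (combinedFamily b) (envTheta b fun U => (U, l)) := by
  refine map_envAction_injective b ?_
  have h := implements_envTheta b fun U => (U, l)
  have h₁ := h.subs (hasSubst_X (τ := (ι × ℕ+) ⊕ (ι × ℕ+)) Sum.inl_injective)
  have h₂ := h.subs (hasSubst_X (τ := (ι × ℕ+) ⊕ (ι × ℕ+)) Sum.inr_injective)
  have h₃ := h₁.mul h₂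
  have h₄ := h.subs (hasSubst_combinedFamily b)
  change Implements b _ (subs _ (levelSeries b l)) at h₄
  rw [← subs_combinedFamily] at h₄
  rw [map_mul, ← subs_map_envAction b (hasSubst_X Sum.inl_injective),
    ← subs_map_envAction b (hasSubst_X Sum.inr_injective),
    ← subs_map_envAction b (hasSubst_combinedFamily b)]
  exact h₃.ext h₄

end Alphabets

end

section

open MvPowerSeries Finset
open scoped TensorProduct

/-! ### Product functionals on an infinite tensor product -/

section TensorFunctional

variable {κ K : Type*} [Field K] {A : κ → Type*} [∀ i, AddCommGroup (A i)] [∀ i, Module K (A i)]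

open Classical in
/-- The product of a family of scalars almost all of which are `1`, extended by `0`. -/
def finprodOrZero (u : κ → K) : K :=
  if (Function.mulSupport u).Finite then ∏ᶠ i, u i else 0

/-- Changing one entry does not affect whether almost all entries are 1, so the extension by 0 stays
linear in each entry. -/
theorem finprodOrZero_update [DecidableEq κ] (u : κ → K) (i : κ) (c : K) :
    finprodOrZero (Function.update u i c) = c * finprodOrZero (Function.update u i 1) := by
  have hsub (c d : K) : Function.mulSupport (Function.update u i c) ⊆
      Function.mulSupport (Function.update u i d) ∪ {i} := fun j hj => by
    by_cases hji : j = i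
    · exact Or.inr hji
    · refine Or.inl ?_
      rw [Function.mem_mulSupport, Function.update_of_ne hji] at hj ⊢
      exact hj
  by_cases h : (Function.mulSupport (Function.update u i 1)).Finite
  · have h' : (Function.mulSupport (Function.update u i c)).Finite :=
      (h.union (Set.finite_singleton i)).subset (hsub c 1)
    rw [finprodOrZero, finprodOrZero, if_pos h, if_pos h']
    have h1 : Function.update u i c = fun j => Pi.mulSingle (M := fun _ => K) i c j *
        Function.update u i 1 j := by
      funext j
      by_cases hji : j = i
      · rw [hji, Function.update_self, Function.update_self, Pi.mulSingle_eq_same, mul_one]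
      · rw [Function.update_of_ne hji, Function.update_of_ne hji, Pi.mulSingle_eq_of_ne hji,
          one_mul]
    rw [h1, finprod_mul_distrib _ h, finprod_eq_single _ i, Pi.mulSingle_eq_same]
    · exact fun j hj => Pi.mulSingle_eq_of_ne hj _
    · exact (Set.finite_singleton i).subset fun j hj => by
        by_contra hn
        exact hj (Pi.mulSingle_eq_of_ne hn _)
  · have h' : ¬ (Function.mulSupport (Function.update u i c)).Finite := fun h' =>
      h ((h'.union (Set.finite_singleton i)).subset (hsub 1 c))
    rw [finprodOrZero, finprodOrZero, if_neg h, if_neg h', mul_zero]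

/-- The product of a family of functionals, on families almost all of whose members have value
`1`, extended by `0`. -/
def prodFunctional (f : ∀ i, A i →ₗ[K] K) : MultilinearMap K A K where
  toFun a := finprodOrZero fun i => f i (a i)
  map_update_add' a i x y := by
    have h (x : A i) : (fun j => f j (Function.update a i x j)) =
        Function.update (fun j => f j (a j)) i (f i x) :=
      funext fun j => Function.apply_update (fun j => f j) a i x j
    simp only [h]
    rw [finprodOrZero_update, finprodOrZero_update _ _ (f i x), finprodOrZero_update _ _ (f i y),
      map_add, add_mul]
  map_update_smul' a i c x := by
    have h (x : A i) : (fun j => f j (Function.update a i x j)) =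
        Function.update (fun j => f j (a j)) i (f i x) :=
      funext fun j => Function.apply_update (fun j => f j) a i x j
    simp only [h]
    rw [finprodOrZero_update, finprodOrZero_update _ _ (f i x), map_smul, smul_eq_mul, smul_eq_mul,
      mul_assoc]

end TensorFunctional

/-! ### The levels, the infinite tensor product and its basis -/

section Level

variable {R : Type*} [Ring R] {ι : Type*} (b : Module.Basis ι ℤ R)

/-- The inclusion of the `l`-th tensor factor. -/
def singleGQ (l : ℕ+) : Env R →ₐ[ℚ] GQ R :=
  (PiTensorProduct.singleAlgHom (R := ℚ) (A := fun _ : ℕ+ => Env R) l).codRestrict (GQ R)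
    (single_mem_GQ l)

theorem coe_singleGQ (l : ℕ+) (x : Env R) : (singleGQ l x : ⨂[ℚ] _ : ℕ+, Env R) =
    PiTensorProduct.tprod ℚ (Pi.mulSingle l x) := rfl

theorem commute_singleGQ {l l' : ℕ+} (h : l ≠ l') (x y : Env R) :
    Commute (singleGQ l x) (singleGQ l' y) := by
  refine Subtype.ext ?_
  change (singleGQ l x : ⨂[ℚ] _ : ℕ+, Env R) * singleGQ l' y = singleGQ l' y * singleGQ l x
  rw [coe_singleGQ, coe_singleGQ, PiTensorProduct.tprod_mul_tprod, PiTensorProduct.tprod_mul_tprod]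
  exact congrArg _ (Pi.mulSingle_commute (f := fun _ : ℕ+ => Env R) h x y).eq

theorem thetaFactor_eq (l : ℕ+) : thetaFactor b l =
    MvPowerSeries.map (singleGQ l).toRingHom (envTheta b fun U => (U, l)) := by
  have h1 : pSeries b l = genSeries (fun U => (U, l)) (ratBasis b) := by
    rw [pSeries, genSeries]
    simp only [ratBasis_apply]
  rw [envTheta, ← map_expSeries (singleGQ l), ← h1]
  · rfl
  · rw [coeff_mapCoeff, coeff_zero_logOneAdd, map_zero]
    exact coeff_zero_genSeries _

/-- The exponents of the variables of level `l`. -/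
def slice (m : ι × ℕ+ →₀ ℕ) (l : ℕ+) : ι →₀ ℕ :=
  m.comapDomain (fun U => (U, l)) (level_injective l).injOn

theorem slice_apply (m : ι × ℕ+ →₀ ℕ) (l : ℕ+) (U : ι) : slice m l U = m (U, l) := rfl

theorem slice_eq_zero {m : ι × ℕ+ →₀ ℕ} {l : ℕ+} (h : ∀ s ∈ m.support, s.2 ≠ l) : slice m l = 0 :=
  Finsupp.ext fun U => by
    by_contra hn
    exact h (U, l) (Finsupp.mem_support_iff.2 hn) rfl

theorem coeff_thetaFactor {l : ℕ+} {m : ι × ℕ+ →₀ ℕ} (h : ∀ s ∈ m.support, s.2 = l) :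
    coeff m (thetaFactor b l) = singleGQ l (envCoeff b (slice m l)) := by
  have hm : (slice m l).mapDomain (fun U => (U, l)) = m :=
    Finsupp.mapDomain_comapDomain _ (level_injective l) m fun s hs => ⟨s.1, Prod.ext rfl (h s hs).symm⟩
  rw [thetaFactor_eq, coeff_map, ← subs_X_envTheta b (level_injective l)]
  conv_lhs => rw [← hm, coeff_subs_X (level_injective l)]
  rfl

theorem coeff_thetaFactor_of_ne {l : ℕ+} {m : ι × ℕ+ →₀ ℕ} (h : ∃ s ∈ m.support, s.2 ≠ l) :
    coeff m (thetaFactor b l) = 0 := by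
  classical
  obtain ⟨s, hs, hne⟩ := h
  rw [thetaFactor_eq, coeff_map, ← subs_X_envTheta b (level_injective l),
    coeff_subs_X_of_notMem, map_zero]
  rintro k rfl
  obtain ⟨U, -, rfl⟩ := mem_image.1 (Finsupp.mapDomain_support hs)
  exact hne rfl

/-- The coefficients of the product of all the factors. -/
def fullCoeff (m : ι × ℕ+ →₀ ℕ) : GQ R :=
  ⟨PiTensorProduct.tprod ℚ fun l => envCoeff b (slice m l), Submodule.subset_span ⟨_, by
    classical
    refine (m.support.image Prod.snd).finite_toSet.subset fun l hl => ?_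
    by_contra hn
    refine hl ?_
    rw [slice_eq_zero, envCoeff_zero]
    rintro s hs rfl
    exact hn (mem_coe.2 (mem_image_of_mem _ hs)), rfl⟩⟩

theorem fullCoeff_zero : fullCoeff b 0 = 1 := by
  refine Subtype.ext ?_
  change PiTensorProduct.tprod ℚ _ = PiTensorProduct.tprod ℚ 1
  congr 1
  funext l
  have h : slice (0 : ι × ℕ+ →₀ ℕ) l = 0 := Finsupp.ext fun _ => rfl
  rw [h, envCoeff_zero]
  rfl

theorem fullCoeff_level {l : ℕ+} {m : ι × ℕ+ →₀ ℕ} (h : ∀ s ∈ m.support, s.2 = l) :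
    fullCoeff b m = singleGQ l (envCoeff b (slice m l)) := by
  refine Subtype.ext ?_
  rw [coe_singleGQ]
  change PiTensorProduct.tprod ℚ _ = _
  congr 1
  funext l'
  by_cases hl : l' = l
  · rw [hl, Pi.mulSingle_eq_same]
  · rw [Pi.mulSingle_eq_of_ne hl, slice_eq_zero, envCoeff_zero]
    exact fun s hs hs' => hl (hs'.symm.trans (h s hs))

/-- The product of the first `N` factors. -/
def partialProd (N : ℕ) : MvPowerSeries (ι × ℕ+) (GQ R) :=
  ((List.range N).map fun l => thetaFactor b l.succPNat).prod

theorem partialProd_succ (N : ℕ) :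
    partialProd b (N + 1) = partialProd b N * thetaFactor b N.succPNat := by
  rw [partialProd, List.range_succ, List.map_append, List.prod_append, List.map_singleton,
    List.prod_singleton]
  rfl

/-- Each factor involves only the variables of its own level, so an exponent can be distributed over
the factors in just one way. `natPred` converts a level, counted from 1, into the index of its
factor, counted from 0. The vanishing half is what excludes other splittings in the induction. -/
theorem coeff_partialProd (N : ℕ) : ∀ m : ι × ℕ+ →₀ ℕ,
    ((∀ s ∈ m.support, s.2.natPred < N) → coeff m (partialProd b N) = fullCoeff b m) ∧
    ((∃ s ∈ m.support, N ≤ s.2.natPred) → coeff m (partialProd b N) = 0) := by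
  classical
  induction N with
  | zero =>
    intro m
    have h1 : partialProd b 0 = 1 := rfl
    constructor
    · intro h
      have : m = 0 := by
        rw [← Finsupp.support_eq_empty, eq_empty_iff_forall_notMem]
        exact fun s hs => Nat.not_lt_zero _ (h s hs)
      rw [this, h1, coeff_zero_one, fullCoeff_zero]
    · rintro ⟨s, hs, -⟩
      rw [h1, coeff_one, if_neg]
      rintro rfl
      simp at hs
  | succ N ih =>
    intro m
    rw [partialProd_succ, coeff_mul]
    constructor
    · intro h
      -- The only contributing splitting: `i` takes the levels of the first `N` factors, `j` the
      -- level of the last one.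
      set i : ι × ℕ+ →₀ ℕ := m.filter fun s => s.2.natPred < N with hi
      set j : ι × ℕ+ →₀ ℕ := m.filter fun s => ¬ s.2.natPred < N with hj
      have hij : i + j = m := Finsupp.filter_add_filter_not _ _
      have hi' : ∀ s ∈ i.support, s.2.natPred < N := fun s hs => by
        rw [hi, Finsupp.support_filter, mem_filter] at hs
        exact hs.2
      have hj' : ∀ s ∈ j.support, s.2 = N.succPNat := fun s hs => by
        rw [hj, Finsupp.support_filter, mem_filter] at hs
        have h1 := h s hs.1
        have h2 : s.2.natPred = N := by omega
        rw [← h2, PNat.succPNat_natPred]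
      rw [sum_eq_single (i, j)]
      · rw [(ih i).1 hi', coeff_thetaFactor b hj']
        refine Subtype.ext ?_
        change (fullCoeff b i : ⨂[ℚ] _ : ℕ+, Env R) *
          (singleGQ N.succPNat (envCoeff b (slice j N.succPNat)) : GQ R) = fullCoeff b m
        rw [coe_singleGQ]
        change PiTensorProduct.tprod ℚ _ * _ = PiTensorProduct.tprod ℚ _
        rw [PiTensorProduct.tprod_mul_tprod]
        congr 1
        funext l
        rw [Pi.mul_apply]
        have hs : slice m l = slice i l + slice j l := by
          rw [← hij]
          exact Finsupp.ext fun _ => rfl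
        by_cases hl : l = N.succPNat
        · have h0 : slice i l = 0 := slice_eq_zero fun s hs' h2 => by
            have := hi' s hs'
            rw [h2, hl, Nat.natPred_succPNat] at this
            exact lt_irrefl _ this
          rw [hs, h0, envCoeff_zero, one_mul, zero_add, hl, Pi.mulSingle_eq_same]
        · have h0 : slice j l = 0 := slice_eq_zero fun s hs' h2 => hl (h2.symm.trans (hj' s hs'))
          rw [hs, h0, add_zero, Pi.mulSingle_eq_of_ne hl, mul_one]
      · rintro ⟨i', j'⟩ hp hne
        rw [HasAntidiagonal.mem_antidiagonal] at hp
        change i' + j' = m at hp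
        by_contra hn
        have h1 : ∀ s ∈ i'.support, s.2.natPred < N := by
          by_contra hc
          push Not at hc
          exact left_ne_zero_of_mul hn ((ih i').2 hc)
        have h2 : ∀ s ∈ j'.support, s.2 = N.succPNat := by
          by_contra hc
          push Not at hc
          exact right_ne_zero_of_mul hn (coeff_thetaFactor_of_ne b hc)
        have h3 : i' = i := by
          ext s
          by_cases hs : s.2.natPred < N
          · rw [hi, Finsupp.filter_apply, if_pos hs, ← hp, Finsupp.add_apply]
            have : j' s = 0 := by
              by_contra hc
              have := h2 s (Finsupp.mem_support_iff.2 hc)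
              rw [this, Nat.natPred_succPNat] at hs
              exact lt_irrefl _ hs
            rw [this, add_zero]
          · rw [hi, Finsupp.filter_apply, if_neg hs]
            by_contra hc
            exact hs (h1 s (Finsupp.mem_support_iff.2 hc))
        refine hne (Prod.ext h3 ?_)
        rw [← hij, h3] at hp
        exact add_left_cancel hp
      · exact fun hn => absurd (HasAntidiagonal.mem_antidiagonal.2 hij) hn
    · rintro ⟨s, hs, hN⟩
      refine sum_eq_zero ?_
      rintro ⟨i, j⟩ hp
      rw [HasAntidiagonal.mem_antidiagonal] at hp
      change i + j = m at hp
      rw [Finsupp.mem_support_iff, ← hp, Finsupp.add_apply] at hs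
      by_cases hi : i s = 0
      · have hj : j s ≠ 0 := by omega
        rw [coeff_thetaFactor_of_ne b ⟨s, Finsupp.mem_support_iff.2 hj, ?_⟩, mul_zero]
        intro h
        rw [h, Nat.natPred_succPNat] at hN
        omega
      · rw [(ih i).2 ⟨s, Finsupp.mem_support_iff.2 hi, by omega⟩, zero_mul]

theorem coeff_partialProd_eventually (m : ι × ℕ+ →₀ ℕ) :
    ∀ᶠ N in Filter.atTop, coeff m (partialProd b N) = fullCoeff b m := by
  classical
  rw [Filter.eventually_atTop]
  refine ⟨m.support.sup (fun s => s.2.natPred) + 1, fun N hN => (coeff_partialProd b N m).1 ?_⟩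
  intro s hs
  have := le_sup (f := fun s : ι × ℕ+ => s.2.natPred) hs
  omega

/-! ### The product formula -/

theorem subs_thetaFactor_mul (l : ℕ+) :
    subs (fun s => X (Sum.inl s)) (thetaFactor b l) *
      subs (fun s => X (Sum.inr s)) (thetaFactor b l) =
    subs (combinedFamily b) (thetaFactor b l) := by
  have h {z : ι × ℕ+ → TwoSeries ι} (hz : HasSubst z) (f : MvPowerSeries (ι × ℕ+) (Env R)) :
      subs z (MvPowerSeries.map (singleGQ l).toRingHom f) =
        MvPowerSeries.map (singleGQ l).toRingHom (subs z f) :=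
    subs_mapCoeff hz (singleGQ l).toLinearMap f
  rw [thetaFactor_eq, h (hasSubst_X Sum.inl_injective), h (hasSubst_X Sum.inr_injective),
    h (hasSubst_combinedFamily b), ← map_mul, subs_envTheta_mul]

theorem commute_of_coeff {τ A : Type*} [Ring A] {f g : MvPowerSeries τ A}
    (h : ∀ i j, Commute (coeff i f) (coeff j g)) : Commute f g := by
  classical
  ext d
  rw [coeff_mul, coeff_mul_swap]
  exact sum_congr rfl fun p _ => h p.1 p.2

theorem commute_coeff_subs {σ τ τ' A : Type*} [Ring A] [Algebra ℚ A] {f g : MvPowerSeries σ A}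
    (h : ∀ i j, Commute (coeff i f) (coeff j g)) {z : σ → MvPowerSeries τ ℚ} (hz : HasSubst z)
    {z' : σ → MvPowerSeries τ' ℚ} (hz' : HasSubst z') (i : τ →₀ ℕ) (j : τ' →₀ ℕ) :
    Commute (coeff i (subs z f)) (coeff j (subs z' g)) := by
  have hK {τ : Type _} {z : σ → MvPowerSeries τ ℚ} (hz : HasSubst z) (e : τ →₀ ℕ) :
      ∀ k, coeff e (powProd z k) ≠ 0 → k ∈ (finite_coeff_powProd hz e).toFinset :=
    fun k h => by simpa using h
  have hK' {z : σ → MvPowerSeries τ' ℚ} (hz : HasSubst z) (e : τ' →₀ ℕ) :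
      ∀ k, coeff e (powProd z k) ≠ 0 → k ∈ (finite_coeff_powProd hz e).toFinset :=
    fun k h => by simpa using h
  rw [coeff_subs_eq_sum (hK hz i), coeff_subs_eq_sum (hK' hz' j)]
  exact Commute.sum_left _ _ _ fun k _ => Commute.sum_right _ _ _ fun k' _ =>
    ((h k k').smul_left _).smul_right _

theorem commute_coeff_thetaFactor_partialProd {l : ℕ+} {N : ℕ} (h : N ≤ l.natPred)
    (i j : ι × ℕ+ →₀ ℕ) :
    Commute (coeff i (thetaFactor b l)) (coeff j (partialProd b N)) := by
  classical
  induction N generalizing j with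
  | zero =>
    have h1 : partialProd b 0 = 1 := rfl
    rw [h1, coeff_one]
    split_ifs
    · exact Commute.one_right _
    · exact Commute.zero_right _
  | succ N ih =>
    rw [partialProd_succ, coeff_mul]
    refine Commute.sum_right _ _ _ fun p _ => Commute.mul_right (ih (by omega) _) ?_
    rw [thetaFactor_eq, thetaFactor_eq, coeff_map, coeff_map]
    refine commute_singleGQ ?_ _ _
    rintro rfl
    rw [Nat.natPred_succPNat] at h
    omega

/-- The first copy of a new factor commutes with the second copies of the earlier ones, as they sit
in different tensor factors; so the two products interleave level by level. -/
theorem subs_partialProd_mul (N : ℕ) :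
    subs (fun s => X (Sum.inl s)) (partialProd b N) *
      subs (fun s => X (Sum.inr s)) (partialProd b N) =
    subs (combinedFamily b) (partialProd b N) := by
  have h₁ := hasSubst_X (σ := ι × ℕ+) (τ := (ι × ℕ+) ⊕ (ι × ℕ+)) Sum.inl_injective
  have h₂ := hasSubst_X (σ := ι × ℕ+) (τ := (ι × ℕ+) ⊕ (ι × ℕ+)) Sum.inr_injective
  induction N with
  | zero =>
    have h1 : partialProd b 0 = C 1 := (map_one C).symm
    rw [h1, subs_C, subs_C, subs_C, ← map_mul, mul_one]
  | succ N ih =>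
    have hc : Commute (subs (fun s => (X (Sum.inl s) : TwoSeries ι)) (thetaFactor b N.succPNat))
        (subs (fun s => (X (Sum.inr s) : TwoSeries ι)) (partialProd b N)) :=
      commute_of_coeff (commute_coeff_subs (commute_coeff_thetaFactor_partialProd b
        (by rw [Nat.natPred_succPNat])) h₁ h₂)
    rw [partialProd_succ, subs_mul h₁, subs_mul h₂, subs_mul (hasSubst_combinedFamily b), ← ih,
      ← subs_thetaFactor_mul, mul_assoc, ← mul_assoc (subs _ (thetaFactor b _)), hc.eq]
    simp only [mul_assoc]

/-- The exponent of a monomial in two families of variables. -/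
def pairExp (m m' : ι × ℕ+ →₀ ℕ) : (ι × ℕ+) ⊕ (ι × ℕ+) →₀ ℕ :=
  m.mapDomain Sum.inl + m'.mapDomain Sum.inr

theorem pairExp_inl (m m' : ι × ℕ+ →₀ ℕ) (s : ι × ℕ+) : pairExp m m' (Sum.inl s) = m s := by
  rw [pairExp, Finsupp.add_apply, Finsupp.mapDomain_apply Sum.inl_injective,
    Finsupp.mapDomain_of_notMem_range _ _ (by simp), add_zero]

theorem pairExp_inr (m m' : ι × ℕ+ →₀ ℕ) (s : ι × ℕ+) : pairExp m m' (Sum.inr s) = m' s := by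
  rw [pairExp, Finsupp.add_apply, Finsupp.mapDomain_apply Sum.inr_injective,
    Finsupp.mapDomain_of_notMem_range _ _ (by simp), zero_add]

theorem pairExp_injective {m m' n n' : ι × ℕ+ →₀ ℕ} (h : pairExp m m' = pairExp n n') :
    m = n ∧ m' = n' := by
  constructor
  · ext s
    rw [← pairExp_inl m m', h, pairExp_inl]
  · ext s
    rw [← pairExp_inr m m', h, pairExp_inr]

theorem exists_pairExp (d : (ι × ℕ+) ⊕ (ι × ℕ+) →₀ ℕ) : ∃ m m', d = pairExp m m' := by
  refine ⟨d.comapDomain Sum.inl Sum.inl_injective.injOn,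
    d.comapDomain Sum.inr Sum.inr_injective.injOn, ?_⟩
  ext (s | s)
  · rw [pairExp_inl]; rfl
  · rw [pairExp_inr]; rfl

theorem coeff_pairExp_mul {A : Type*} [Ring A] [Algebra ℚ A]
    (f g : MvPowerSeries (ι × ℕ+) A) (m m' : ι × ℕ+ →₀ ℕ) :
    coeff (pairExp m m') (subs (fun s => X (Sum.inl s)) f * subs (fun s => X (Sum.inr s)) g) =
      coeff m f * coeff m' g := by
  classical
  rw [coeff_mul, sum_eq_single (m.mapDomain Sum.inl, m'.mapDomain Sum.inr)]
  · rw [coeff_subs_X Sum.inl_injective, coeff_subs_X Sum.inr_injective]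
  · rintro ⟨i, j⟩ hp hne
    rw [HasAntidiagonal.mem_antidiagonal] at hp
    by_cases hi : ∀ k : ι × ℕ+ →₀ ℕ, k.mapDomain Sum.inl ≠ i
    · rw [coeff_subs_X_of_notMem _ hi, zero_mul]
    by_cases hj : ∀ k : ι × ℕ+ →₀ ℕ, k.mapDomain Sum.inr ≠ j
    · rw [coeff_subs_X_of_notMem _ hj, mul_zero]
    push Not at hi hj
    obtain ⟨k, rfl⟩ := hi
    obtain ⟨k', rfl⟩ := hj
    obtain ⟨rfl, rfl⟩ := pairExp_injective (m := k) (m' := k') (n := m) (n' := m') hp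
    exact absurd rfl hne
  · intro hn
    rw [HasAntidiagonal.mem_antidiagonal] at hn
    exact absurd (by rw [pairExp]) hn

/-- Comparison of coefficients in `subs_partialProd_mul`, for one `N` at which the partial products
have reached their limits at `m`, at `m'` and at the finitely many `k`. -/
theorem fullCoeff_mul (m m' : ι × ℕ+ →₀ ℕ) {K : Finset (ι × ℕ+ →₀ ℕ)}
    (hK : ∀ k, coeff (pairExp m m') (powProd (combinedFamily b) k) ≠ 0 → k ∈ K) :
    fullCoeff b m * fullCoeff b m' =
      ∑ k ∈ K, coeff (pairExp m m') (powProd (combinedFamily b) k) • fullCoeff b k := by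
  have h1 := coeff_partialProd_eventually b m
  have h2 := coeff_partialProd_eventually b m'
  have h3 : ∀ᶠ N in Filter.atTop, ∀ k ∈ K, coeff k (partialProd b N) = fullCoeff b k :=
    (Filter.eventually_all_finset K).2 fun k _ => coeff_partialProd_eventually b k
  obtain ⟨N, h1, h2, h3⟩ := (h1.and (h2.and h3)).exists
  have h := congrArg (coeff (pairExp m m')) (subs_partialProd_mul b N)
  rw [coeff_pairExp_mul, h1, h2, coeff_subs_eq_sum hK] at h
  rw [h]
  exact sum_congr rfl fun k hk => by rw [h3 k hk]

/-! ### The basis of the infinite tensor product -/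

theorem slice_mapDomain (n : ι →₀ ℕ) (l : ℕ+) : slice (n.mapDomain fun U => (U, l)) l = n := by
  ext U
  rw [slice_apply]
  exact Finsupp.mapDomain_apply (level_injective l) n U

/-- A dual family is given by the products of the coordinate functionals at the slices of `m`. -/
theorem linearIndependent_fullCoeff : LinearIndependent ℚ (fullCoeff b) := by
  classical
  rw [linearIndependent_iff]
  intro c hc
  ext m
  let Φ : GQ R →ₗ[ℚ] ℚ := (PiTensorProduct.lift (prodFunctional fun l : ℕ+ =>
    (envBasis b).coord (slice m l))) ∘ₗ (GQ R).val.toLinearMap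
  have hΦ (k : ι × ℕ+ →₀ ℕ) : Φ (fullCoeff b k) = if k = m then 1 else 0 := by
    have h1 : Φ (fullCoeff b k) = finprodOrZero fun l : ℕ+ =>
        (envBasis b).coord (slice m l) (envCoeff b (slice k l)) :=
      PiTensorProduct.lift.tprod _
    have h2 (l : ℕ+) : (envBasis b).coord (slice m l) (envCoeff b (slice k l)) =
        if slice k l = slice m l then 1 else 0 := by
      rw [← envBasis_apply, Module.Basis.coord_apply, Module.Basis.repr_self,
        Finsupp.single_apply]
    simp only [h2] at h1
    rw [h1, finprodOrZero]
    -- For `k ≠ m` both branches of `finprodOrZero` give 0, so finiteness has to be checked only for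
    -- `k = m`.
    split_ifs with hf hkm hkm
    · simp only [hkm, if_true, finprod_one]
    · have : ∃ l, slice k l ≠ slice m l := by
        by_contra hn
        push Not at hn
        exact hkm (Finsupp.ext fun s => DFunLike.congr_fun (hn s.2) s.1)
      obtain ⟨l, hl⟩ := this
      exact finprod_eq_zero _ l (if_neg hl) hf
    · exfalso
      refine hf ?_
      simp [hkm]
    · rfl
  have h := congrArg Φ hc
  rw [Finsupp.linearCombination_apply, Finsupp.sum, map_sum, map_zero] at h
  simp only [map_smul, hΦ, smul_eq_mul, mul_ite, mul_one, mul_zero, sum_ite_eq',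
    Finsupp.mem_support_iff] at h
  by_contra hn
  exact hn ((ite_eq_right_iff.1 h) hn)

theorem mul_mem_span_fullCoeff {x y : GQ R} (hx : x ∈ Submodule.span ℚ (Set.range (fullCoeff b)))
    (hy : y ∈ Submodule.span ℚ (Set.range (fullCoeff b))) :
    x * y ∈ Submodule.span ℚ (Set.range (fullCoeff b)) := by
  have h := Submodule.mul_mem_mul hx hy
  rw [Submodule.span_mul_span] at h
  refine Submodule.span_le.2 ?_ h
  rintro _ ⟨_, ⟨m, rfl⟩, _, ⟨m', rfl⟩, rfl⟩
  have hK : ∀ k, coeff (pairExp m m') (powProd (combinedFamily b) k) ≠ 0 → k ∈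
      (finite_coeff_powProd (hasSubst_combinedFamily b) (pairExp m m')).toFinset :=
    fun k h => by simpa using h
  change fullCoeff b m * fullCoeff b m' ∈ _
  rw [fullCoeff_mul b m m' hK]
  exact sum_mem fun k _ => Submodule.smul_mem _ _ (Submodule.subset_span ⟨k, rfl⟩)

theorem singleGQ_mem_span (l : ℕ+) (x : Env R) :
    singleGQ l x ∈ Submodule.span ℚ (Set.range (fullCoeff b)) := by
  classical
  have hx : x ∈ Submodule.span ℚ (Set.range (envCoeff b)) := by rw [span_envCoeff]; trivial
  induction hx using Submodule.span_induction with
  | zero => rw [map_zero]; exact zero_mem _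
  | add x y _ _ hx hy => rw [map_add]; exact add_mem hx hy
  | smul c x _ hx => rw [map_smul]; exact Submodule.smul_mem _ _ hx
  | mem x hx =>
    obtain ⟨n, rfl⟩ := hx
    refine Submodule.subset_span ⟨n.mapDomain fun U => (U, l), ?_⟩
    rw [fullCoeff_level (l := l), slice_mapDomain]
    intro s hs
    obtain ⟨U, -, rfl⟩ := mem_image.1 (Finsupp.mapDomain_support hs)
    rfl

/-- A pure tensor with finitely many entries different from 1 is a finite product of tensors with
one such entry. These lie in the span by `span_envCoeff`, and the span is closed under products by
`fullCoeff_mul`. -/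
theorem span_fullCoeff : Submodule.span ℚ (Set.range (fullCoeff b)) = ⊤ := by
  classical
  set S := Submodule.span ℚ (Set.range (fullCoeff b)) with hS
  have hpure : ∀ s : Finset ℕ+, ∀ a : ℕ+ → Env R, (∀ l ∉ s, a l = 1) →
      ∃ x ∈ S, (x : ⨂[ℚ] _ : ℕ+, Env R) = PiTensorProduct.tprod ℚ a := by
    intro s
    induction s using Finset.induction_on with
    | empty =>
      intro a ha
      refine ⟨1, ?_, ?_⟩
      · rw [← fullCoeff_zero b]
        exact Submodule.subset_span ⟨0, rfl⟩
      · have : a = 1 := funext fun l => ha l (notMem_empty l)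
        rw [this]
        rfl
    | insert i s hi ih =>
      intro a ha
      obtain ⟨x, hx, hxe⟩ := ih (Function.update a i 1) fun l hl => by
        by_cases hli : l = i
        · rw [hli, Function.update_self]
        · rw [Function.update_of_ne hli]
          exact ha l fun h => (mem_insert.1 h).elim hli hl
      refine ⟨singleGQ i (a i) * x, mul_mem_span_fullCoeff b (singleGQ_mem_span b i _) hx, ?_⟩
      change (singleGQ i (a i) : ⨂[ℚ] _ : ℕ+, Env R) * x = _
      rw [coe_singleGQ, hxe, PiTensorProduct.tprod_mul_tprod]
      congr 1
      funext l
      rw [Pi.mul_apply]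
      by_cases hli : l = i
      · rw [hli, Function.update_self, Pi.mulSingle_eq_same, mul_one]
      · rw [Function.update_of_ne hli, Pi.mulSingle_eq_of_ne hli, one_mul]
  rw [eq_top_iff]
  rintro ⟨y, hy⟩ -
  have hy' : y ∈ Submodule.span ℚ {x | ∃ a : ℕ+ → Env R, {i | a i ≠ 1}.Finite ∧
    PiTensorProduct.tprod ℚ a = x} := hy
  suffices h : ∃ x ∈ S, (x : ⨂[ℚ] _ : ℕ+, Env R) = y by
    obtain ⟨x, hx, rfl⟩ := h
    exact hx
  clear hy
  induction hy' using Submodule.span_induction with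
  | zero => exact ⟨0, zero_mem _, rfl⟩
  | add x y _ _ hx hy =>
    obtain ⟨x, hx, rfl⟩ := hx
    obtain ⟨y, hy, rfl⟩ := hy
    exact ⟨x + y, add_mem hx hy, rfl⟩
  | smul c x _ hx =>
    obtain ⟨x, hx, rfl⟩ := hx
    exact ⟨c • x, Submodule.smul_mem _ _ hx, rfl⟩
  | mem x hx =>
    obtain ⟨a, ha, rfl⟩ := hx
    refine hpure ha.toFinset a fun l hl => ?_
    by_contra hn
    exact hl (ha.mem_toFinset.2 hn)

end Level

end

section

open Finset

/-! ### Complete symmetric functions and Newton's identity -/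

section Complete

/-- The weight `∑ l * m_l` of the exponents of a monomial in the power sums. -/
def wtExp : (ℕ+ →₀ ℕ) →+ ℕ := Finsupp.weight fun l : ℕ+ => (l : ℕ)

/-- `z_m = ∏ l ^ m_l * m_l!`. -/
def zExp (m : ℕ+ →₀ ℕ) : ℕ := m.prod fun l k => (l : ℕ) ^ k * k.factorial

theorem zExp_ne_zero (m : ℕ+ →₀ ℕ) : zExp m ≠ 0 :=
  prod_ne_zero_iff.2 fun l _ => mul_ne_zero (pow_ne_zero _ l.ne_zero) (Nat.factorial_ne_zero _)

theorem zExp_add_single (m : ℕ+ →₀ ℕ) (l : ℕ+) :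
    zExp (m + Finsupp.single l 1) = (l : ℕ) * (m l + 1) * zExp m := by
  classical
  have h1 (k : ℕ+ →₀ ℕ) (hk : k.support ⊆ insert l m.support) :
      zExp k = ∏ i ∈ insert l m.support, ((i : ℕ) ^ k i * (k i).factorial) :=
    Finsupp.prod_of_support_subset _ hk _ fun i _ => by simp
  rw [h1 m (subset_insert _ _), h1 (m + Finsupp.single l 1), ← mul_prod_erase _ _ (mem_insert_self l _),
    ← mul_prod_erase _ (fun i : ℕ+ => (i : ℕ) ^ m i * (m i).factorial) (mem_insert_self l _)]
  · have h2 : ∀ i ∈ (insert l m.support).erase l,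
        ((i : ℕ) ^ (m + Finsupp.single l 1 : ℕ+ →₀ ℕ) i *
          ((m + Finsupp.single l 1 : ℕ+ →₀ ℕ) i).factorial) =
          (i : ℕ) ^ m i * (m i).factorial := fun i hi => by
      rw [Finsupp.add_apply, Finsupp.single_eq_of_ne (ne_of_mem_erase hi), add_zero]
    rw [prod_congr rfl h2, Finsupp.add_apply, Finsupp.single_eq_same, pow_succ, Nat.factorial_succ]
    ring
  · intro i hi
    by_cases h : i = l
    · exact h ▸ mem_insert_self _ _
    · refine mem_insert_of_mem ?_
      rw [Finsupp.mem_support_iff, Finsupp.add_apply, Finsupp.single_eq_of_ne h, add_zero] at hi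
      exact Finsupp.mem_support_iff.2 hi

/-- The exponents of the monomial `p_μ`. -/
def partExp {n : ℕ} (μ : n.Partition) : ℕ+ →₀ ℕ :=
  Multiset.toFinsupp (μ.parts.map Nat.toPNat')

theorem map_toMultiset_partExp {n : ℕ} (μ : n.Partition) :
    (Finsupp.toMultiset (partExp μ)).map (fun l : ℕ+ => (l : ℕ)) = μ.parts := by
  rw [partExp, Multiset.toFinsupp_toMultiset, Multiset.map_map]
  conv_rhs => rw [← Multiset.map_id μ.parts]
  refine Multiset.map_congr rfl fun i hi => ?_
  exact PNat.toPNat'_coe (μ.parts_pos hi)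

theorem partExp_injective {n : ℕ} : Function.Injective (partExp (n := n)) := fun μ ν h => by
  refine Nat.Partition.ext ?_
  rw [← map_toMultiset_partExp μ, h, map_toMultiset_partExp]

theorem wtExp_single (l : ℕ+) (n : ℕ) : wtExp (Finsupp.single l n) = n * l := by
  rw [wtExp, Finsupp.weight_single, smul_eq_mul]

theorem wtExp_eq_sum (m : ℕ+ →₀ ℕ) :
    ((Finsupp.toMultiset m).map (fun l : ℕ+ => (l : ℕ))).sum = wtExp m := by
  induction m using Finsupp.induction_linear with
  | zero => simp
  | add f g hf hg => rw [map_add, map_add, Multiset.map_add, Multiset.sum_add, hf, hg]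
  | single l n =>
    rw [wtExp_single, Finsupp.toMultiset_single, Multiset.map_nsmul, Multiset.sum_nsmul,
      Multiset.map_singleton, Multiset.sum_singleton, smul_eq_mul]

theorem wtExp_partExp {n : ℕ} (μ : n.Partition) : wtExp (partExp μ) = n := by
  rw [← wtExp_eq_sum, map_toMultiset_partExp, μ.parts_sum]

theorem exists_partExp {n : ℕ} {m : ℕ+ →₀ ℕ} (h : wtExp m = n) :
    ∃ μ : n.Partition, partExp μ = m := by
  refine ⟨⟨(Finsupp.toMultiset m).map (fun l : ℕ+ => (l : ℕ)), ?_, ?_⟩, ?_⟩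
  · intro i hi
    obtain ⟨l, -, rfl⟩ := Multiset.mem_map.1 hi
    exact l.pos
  · rw [wtExp_eq_sum, h]
  · rw [partExp, Multiset.map_map]
    conv_rhs => rw [← Finsupp.toMultiset_toFinsupp m, ← Multiset.map_id (Finsupp.toMultiset m)]
    congr 1
    exact Multiset.map_congr rfl fun l _ => PNat.coe_toPNat' l

theorem zPart_eq {n : ℕ} (μ : n.Partition) : zPart μ = zExp (partExp μ) := by
  classical
  have hinj : Function.Injective fun l : ℕ+ => (l : ℕ) := PNat.coe_injective
  rw [zPart]
  conv_lhs => rw [← map_toMultiset_partExp μ]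
  rw [Multiset.toFinset_map, Finsupp.toFinset_toMultiset, prod_image hinj.injOn, zExp, Finsupp.prod]
  refine prod_congr rfl fun l _ => ?_
  rw [Multiset.count_map_eq_count' _ _ hinj, Finsupp.count_toMultiset]

theorem pPart_eq {n : ℕ} (μ : n.Partition) :
    pPart μ = MvPolynomial.monomial (partExp μ) 1 := by
  rw [pPart, partExp]
  induction μ.parts using Multiset.induction_on with
  | empty => simp
  | cons i s ih =>
    rw [Multiset.map_cons, Multiset.prod_cons, ih, Multiset.map_cons, ← Multiset.singleton_add,
      map_add, Multiset.toFinsupp_singleton, MvPolynomial.X, MvPolynomial.monomial_mul, one_mul]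

theorem coeff_hSym (n : ℕ) (m : ℕ+ →₀ ℕ) :
    MvPolynomial.coeff m (hSym n) = if wtExp m = n then ((zExp m : ℚ))⁻¹ else 0 := by
  classical
  rw [hSym, MvPolynomial.coeff_sum]
  simp only [pPart_eq, zPart_eq, MvPolynomial.coeff_smul, MvPolynomial.coeff_monomial, smul_eq_mul,
    mul_ite, mul_one, mul_zero]
  split_ifs with h
  · obtain ⟨μ, rfl⟩ := exists_partExp h
    rw [sum_eq_single μ, if_pos rfl]
    · exact fun ν _ hν => if_neg fun h => hν (partExp_injective h)
    · exact fun hn => absurd (mem_univ _) hn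
  · refine sum_eq_zero fun μ _ => if_neg ?_
    rintro rfl
    exact h (wtExp_partExp μ)

theorem hSym_zero : hSym 0 = 1 := by
  classical
  ext m
  rw [coeff_hSym, MvPolynomial.coeff_one]
  have h : wtExp m = 0 ↔ 0 = m := by
    constructor
    · intro h
      have : Finsupp.NonTorsionWeight ℕ fun l : ℕ+ => (l : ℕ) :=
        Finsupp.nonTorsionWeight_of ℕ (w := fun l : ℕ+ => (l : ℕ)) fun l => l.ne_zero
      exact ((Finsupp.weight_eq_zero_iff_eq_zero fun l : ℕ+ => (l : ℕ)).1 h).symm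
    · rintro rfl
      exact map_zero _
  by_cases hm : wtExp m = 0
  · rw [if_pos hm, if_pos (h.1 hm), ← h.1 hm]
    simp [zExp]
  · rw [if_neg hm, if_neg fun h' => hm (h.2 h')]

/-- The generator `p_i` for `i > 0`, and `0` for `i = 0`. -/
def pVal {B : Type*} [Zero B] (A : ℕ+ → B) (i : ℕ) : B := if i = 0 then 0 else A i.toPNat'

theorem pVal_zero {B : Type*} [Zero B] (A : ℕ+ → B) : pVal A 0 = 0 := if_pos rfl

theorem pVal_coe {B : Type*} [Zero B] (A : ℕ+ → B) (l : ℕ+) : pVal A l = A l := by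
  rw [pVal, if_neg l.ne_zero, PNat.coe_toPNat']

theorem exists_coe_eq {i : ℕ} (h : i ≠ 0) : ∃ l : ℕ+, (l : ℕ) = i :=
  ⟨i.toPNat', PNat.toPNat'_coe (Nat.pos_of_ne_zero h)⟩

theorem single_le_of_mem_support {σ : Type*} {m : σ →₀ ℕ} {l : σ} (h : l ∈ m.support) :
    Finsupp.single l 1 ≤ m := by
  rw [Finsupp.single_le_iff]
  exact Nat.one_le_iff_ne_zero.2 (Finsupp.mem_support_iff.1 h)

theorem coeff_X_mul_hSym (l : ℕ+) (j : ℕ) (m : ℕ+ →₀ ℕ) :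
    MvPolynomial.coeff m (MvPolynomial.X l * hSym j) =
      if wtExp m = l + j then (((l : ℕ) * m l : ℕ) : ℚ) * (zExp m : ℚ)⁻¹ else 0 := by
  classical
  rw [MvPolynomial.coeff_X_mul']
  by_cases hl : l ∈ m.support
  · rw [if_pos hl, coeff_hSym]
    set k := m - Finsupp.single l 1
    have hk : m = k + Finsupp.single l 1 :=
      (tsub_add_cancel_of_le (single_le_of_mem_support hl)).symm
    have hw : wtExp m = wtExp k + l := by
      conv_lhs => rw [hk]
      rw [map_add, wtExp_single, one_mul]
    by_cases h : wtExp k = j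
    · rw [if_pos h, if_pos (by omega), hk, zExp_add_single, Finsupp.add_apply,
        Finsupp.single_eq_same]
      have h1 : (zExp k : ℚ) ≠ 0 := Nat.cast_ne_zero.2 (zExp_ne_zero k)
      have h2 : ((l : ℕ) : ℚ) ≠ 0 := Nat.cast_ne_zero.2 l.ne_zero
      have h3 : ((k l : ℚ) + 1) ≠ 0 := by positivity
      push_cast
      field_simp
    · rw [if_neg h, if_neg (by omega)]
  · rw [if_neg hl, Finsupp.notMem_support_iff.1 hl]
    simp

/-- At the exponent `m` of weight `n`, the product of `p_l` with its complete function contributes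
`l * m l / z_m`, and `∑ l * m l = n`. -/
theorem newton_hSym (n : ℕ) : (n : ℚ) • hSym n =
    ∑ p ∈ antidiagonal n, pVal (fun l => (MvPolynomial.X l : SymQ)) p.1 * hSym p.2 := by
  classical
  ext m
  rw [MvPolynomial.coeff_smul, coeff_hSym, MvPolynomial.coeff_sum]
  by_cases hw : wtExp m = n
  · rw [if_pos hw]
    have h1 : ∑ l ∈ m.support, (((l : ℕ) * m l : ℕ) : ℚ) * (zExp m : ℚ)⁻¹ =
        ∑ p ∈ antidiagonal n,
          MvPolynomial.coeff m (pVal (fun l => (MvPolynomial.X l : SymQ)) p.1 * hSym p.2) := by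
      refine sum_of_injOn (fun l : ℕ+ => ((l : ℕ), n - l)) ?_ ?_ ?_ ?_
      · exact fun l _ l' _ h => PNat.coe_injective (congrArg Prod.fst h)
      · intro l hl
        have : (l : ℕ) ≤ n := hw ▸ Finsupp.le_weight_of_ne_zero' (w := fun l : ℕ+ => (l : ℕ))
          (Finsupp.mem_support_iff.1 hl)
        rw [mem_coe, HasAntidiagonal.mem_antidiagonal]
        change (l : ℕ) + (n - l) = n
        omega
      · rintro ⟨i, j⟩ hp hn
        rw [HasAntidiagonal.mem_antidiagonal] at hp
        change i + j = n at hp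
        by_cases hi : i = 0
        · simp [hi, pVal_zero]
        · obtain ⟨l, rfl⟩ := exists_coe_eq hi
          have hl : m l = 0 := by
            by_contra h
            exact hn ⟨l, Finsupp.mem_support_iff.2 h, Prod.ext rfl (by simp only; omega)⟩
          simp only [pVal_coe]
          rw [coeff_X_mul_hSym, hl]
          simp
      · intro l hl
        have : (l : ℕ) ≤ n := hw ▸ Finsupp.le_weight_of_ne_zero' (w := fun l : ℕ+ => (l : ℕ))
          (Finsupp.mem_support_iff.1 hl)
        simp only [pVal_coe]
        rw [coeff_X_mul_hSym, if_pos (by omega)]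
    rw [← h1, ← sum_mul, ← Nat.cast_sum, smul_eq_mul]
    congr 2
    rw [← hw, wtExp, Finsupp.weight_apply, Finsupp.sum]
    exact sum_congr rfl fun l _ => by rw [smul_eq_mul, mul_comm]
  · rw [if_neg hw, smul_zero]
    symm
    refine sum_eq_zero fun p hp => ?_
    rw [HasAntidiagonal.mem_antidiagonal] at hp
    by_cases hi : p.1 = 0
    · simp [hi, pVal_zero]
    · obtain ⟨l, hl⟩ := exists_coe_eq hi
      rw [← hl, pVal_coe, coeff_X_mul_hSym, if_neg (by omega)]

end Complete

end

section

open Finset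

/-! ### Evaluation at alphabets; integral alphabets -/

section Evaluation

variable {B : Type*} [CommRing B] [Algebra ℚ B]

/-- The value `h_n[A]` of the complete symmetric function at an alphabet with power sums `A`. -/
def hVal (A : ℕ+ → B) (n : ℕ) : B := MvPolynomial.aeval A (hSym n)

theorem hVal_zero (A : ℕ+ → B) : hVal A 0 = 1 := by rw [hVal, hSym_zero, map_one]

theorem map_hVal {B' : Type*} [CommRing B'] [Algebra ℚ B'] (φ : B →ₐ[ℚ] B') (A : ℕ+ → B) (n : ℕ) :
    φ (hVal A n) = hVal (fun l => φ (A l)) n := by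
  rw [hVal, hVal, ← AlgHom.comp_apply, MvPolynomial.comp_aeval]

theorem newton_hVal (A : ℕ+ → B) (n : ℕ) :
    (n : B) * hVal A n = ∑ p ∈ antidiagonal n, pVal A p.1 * hVal A p.2 := by
  have h := congrArg (MvPolynomial.aeval A) (newton_hSym n)
  rw [map_smul, map_sum, Algebra.smul_def, map_natCast] at h
  refine h.trans (sum_congr rfl fun p _ => ?_)
  rw [map_mul, pVal, pVal]
  split_ifs
  · rw [map_zero, hVal]
  · rw [MvPolynomial.aeval_X, hVal]

theorem natCast_mul_left_cancel {n : ℕ} (hn : n ≠ 0) {x y : B} (h : (n : B) * x = n * y) : x = y := by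
  have h2 := congrArg (fun z => (n : ℚ)⁻¹ • z) h
  have h3 (z : B) : (n : ℚ)⁻¹ • ((n : B) * z) = z := by
    rw [← map_natCast (algebraMap ℚ B), ← Algebra.smul_def, smul_smul,
      inv_mul_cancel₀ (Nat.cast_ne_zero.2 hn), one_smul]
  simpa only [h3] using h2

/-- The solution of Newton's recursion is determined up to a given degree by the power sums. -/
theorem eq_hVal_of_newton {A : ℕ+ → B} {N : ℕ} {c : ℕ → B} (h0 : c 0 = 1)
    (hc : ∀ n ≤ N, (n : B) * c n = ∑ p ∈ antidiagonal n, pVal A p.1 * c p.2) :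
    ∀ n ≤ N, c n = hVal A n := by
  intro n
  induction n using Nat.strong_induction_on with
  | _ n ih =>
    intro hn
    rcases Nat.eq_zero_or_pos n with rfl | hpos
    · rw [h0, hVal_zero]
    · refine natCast_mul_left_cancel hpos.ne' ?_
      rw [hc n hn, newton_hVal]
      refine sum_congr rfl fun p hp => ?_
      rw [HasAntidiagonal.mem_antidiagonal] at hp
      rcases Nat.eq_zero_or_pos p.1 with h | h
      · rw [h, pVal_zero, zero_mul, zero_mul]
      · rw [ih p.2 (by omega) (by omega)]

theorem hVal_congr {A A' : ℕ+ → B} {N : ℕ} (h : ∀ l : ℕ+, (l : ℕ) ≤ N → A l = A' l) :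
    ∀ n ≤ N, hVal A n = hVal A' n := by
  refine eq_hVal_of_newton (hVal_zero A) fun n hn => ?_
  rw [newton_hVal]
  refine sum_congr rfl fun p hp => ?_
  rw [HasAntidiagonal.mem_antidiagonal] at hp
  by_cases hi : p.1 = 0
  · rw [hi, pVal_zero, pVal_zero]
  · obtain ⟨l, hl⟩ := exists_coe_eq hi
    rw [← hl, pVal_coe, pVal_coe, h l (by omega)]

/-- The term `p_n h_0 = p_n` can be isolated in Newton's identity, so the recursion also determines
the power sums from the complete functions. -/
theorem eq_of_hVal_eq {A A' : ℕ+ → B} {N : ℕ} (h : ∀ n ≤ N, hVal A n = hVal A' n) :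
    ∀ l : ℕ+, (l : ℕ) ≤ N → A l = A' l := by
  suffices H : ∀ n : ℕ, n ≤ N → pVal A n = pVal A' n by
    intro l hl
    have := H l hl
    rwa [pVal_coe, pVal_coe] at this
  intro n
  induction n using Nat.strong_induction_on with
  | _ n ih =>
    intro hn
    have h1 := newton_hVal A n
    rw [h n hn, newton_hVal A' n] at h1
    have hmem : (n, 0) ∈ antidiagonal n := HasAntidiagonal.mem_antidiagonal.2 (add_zero n)
    rw [← add_sum_erase _ _ hmem, ← add_sum_erase _ _ hmem] at h1
    simp only [hVal_zero, mul_one] at h1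
    have h2 : ∑ p ∈ (antidiagonal n).erase (n, 0), pVal A p.1 * hVal A p.2 =
        ∑ p ∈ (antidiagonal n).erase (n, 0), pVal A' p.1 * hVal A' p.2 := by
      refine sum_congr rfl fun p hp => ?_
      rw [mem_erase, HasAntidiagonal.mem_antidiagonal] at hp
      have h3 : p.1 ≠ n := fun h => hp.1 (Prod.ext h (by have := hp.2; omega))
      rw [ih p.1 (by omega) (by omega), h p.2 (by omega)]
    rw [h2] at h1
    exact (add_right_cancel h1).symm

/-- The generating series `∑ h_n[A] t ^ n`. -/
def hSeries (A : ℕ+ → B) : PowerSeries B := PowerSeries.mk (hVal A)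

theorem coeff_hSeries (A : ℕ+ → B) (n : ℕ) : PowerSeries.coeff n (hSeries A) = hVal A n :=
  PowerSeries.coeff_mk _ _

omit [Algebra ℚ B] in
theorem coeff_X_mul_derivative (f : PowerSeries B) (n : ℕ) :
    PowerSeries.coeff n (PowerSeries.X * PowerSeries.derivative B f) =
      (n : B) * PowerSeries.coeff n f := by
  cases n with
  | zero => simp
  | succ n =>
    rw [PowerSeries.coeff_succ_X_mul, PowerSeries.coeff_derivative, mul_comm]
    push_cast
    rfl

theorem X_mul_derivative_hSeries (A : ℕ+ → B) :
    PowerSeries.X * PowerSeries.derivative B (hSeries A) = PowerSeries.mk (pVal A) * hSeries A := by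
  ext n
  rw [coeff_X_mul_derivative, coeff_hSeries, newton_hVal, PowerSeries.coeff_mul]
  simp only [PowerSeries.coeff_mk, coeff_hSeries]

/-- Newton's recursion, read as a differential equation for the generating series; with constant
term 1 its solution is unique. -/
theorem eq_hSeries {A : ℕ+ → B} {f : PowerSeries B} (h0 : PowerSeries.coeff 0 f = 1)
    (hf : PowerSeries.X * PowerSeries.derivative B f = PowerSeries.mk (pVal A) * f) :
    f = hSeries A := by
  ext N
  rw [coeff_hSeries]
  refine eq_hVal_of_newton (c := fun n => PowerSeries.coeff n f) (N := N) h0 (fun n _ => ?_) N le_rfl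
  rw [← coeff_X_mul_derivative, hf, PowerSeries.coeff_mul]
  simp only [PowerSeries.coeff_mk]

/-- By the Leibniz rule the logarithmic derivatives of the two series add. -/
theorem hSeries_add (A A' : ℕ+ → B) : hSeries (A + A') = hSeries A * hSeries A' := by
  symm
  refine eq_hSeries ?_ ?_
  · rw [PowerSeries.coeff_mul]
    simp [coeff_hSeries, hVal_zero]
  · have h : PowerSeries.mk (pVal (A + A')) =
        PowerSeries.mk (pVal A) + PowerSeries.mk (pVal A') := by
      ext n
      simp only [PowerSeries.coeff_mk, map_add, pVal]
      split_ifs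
      · rw [add_zero]
      · rfl
    rw [Derivation.leibniz, h, smul_eq_mul, smul_eq_mul]
    linear_combination hSeries A * X_mul_derivative_hSeries A' +
      hSeries A' * X_mul_derivative_hSeries A

theorem hSeries_zero : hSeries (0 : ℕ+ → B) = 1 := by
  symm
  refine eq_hSeries (by simp) ?_
  have h : PowerSeries.mk (pVal (0 : ℕ+ → B)) = 0 := by
    ext n
    simp [pVal]
  rw [h, zero_mul, Derivation.map_one_eq_zero, mul_zero]

theorem hSeries_mul_neg (A : ℕ+ → B) : hSeries A * hSeries (-A) = 1 := by
  rw [← hSeries_add, add_neg_cancel, hSeries_zero]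

/-- The power sums of the alphabet consisting of a single variable. -/
def geom (x : B) : ℕ+ → B := fun l => x ^ (l : ℕ)

theorem hVal_geom (x : B) (n : ℕ) : hVal (geom x) n = x ^ n := by
  symm
  refine eq_hVal_of_newton (c := fun n => x ^ n) (N := n) (pow_zero x) (fun n _ => ?_) n le_rfl
  have h : ∀ p ∈ antidiagonal n, pVal (geom x) p.1 * x ^ p.2 =
      if p.1 = 0 then 0 else x ^ n := fun p hp => by
    rw [HasAntidiagonal.mem_antidiagonal] at hp
    by_cases hi : p.1 = 0
    · rw [hi, pVal_zero, zero_mul, if_pos rfl]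
    · rw [if_neg hi]
      obtain ⟨l, hl⟩ := exists_coe_eq hi
      rw [← hl, pVal_coe, geom, hl, ← pow_add, hp]
  rw [sum_congr rfl h, Nat.sum_antidiagonal_eq_sum_range_succ (fun i _ => if i = 0 then 0 else x ^ n),
    sum_range_succ']
  simp

theorem hSeries_neg_geom (x : B) :
    hSeries (-geom x) = ((1 - Polynomial.C x * Polynomial.X : Polynomial B) : PowerSeries B) := by
  have h : hSeries (geom x) *
      ((1 - Polynomial.C x * Polynomial.X : Polynomial B) : PowerSeries B) = 1 := by
    rw [Polynomial.coe_sub, Polynomial.coe_mul, Polynomial.coe_one, Polynomial.coe_C,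
      Polynomial.coe_X, mul_sub, mul_one]
    ext n
    cases n with
    | zero =>
      have h0 := coeff_hSeries (geom x) 0
      rw [hVal_zero, PowerSeries.coeff_zero_eq_constantCoeff_apply] at h0
      simp [h0]
    | succ n =>
      rw [← mul_assoc, map_sub, PowerSeries.coeff_succ_mul_X, mul_comm, PowerSeries.coeff_C_mul,
        coeff_hSeries, coeff_hSeries, hVal_geom, hVal_geom, pow_succ, mul_comm, sub_self,
        PowerSeries.coeff_one, if_neg n.succ_ne_zero]
  rw [← one_mul (hSeries (-geom x)), ← h, mul_right_comm, hSeries_mul_neg, one_mul]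

theorem hSeries_multiset_sum (s : Multiset (ℕ+ → B)) :
    hSeries s.sum = (s.map hSeries).prod := by
  induction s using Multiset.induction_on with
  | empty => simp [hSeries_zero]
  | cons a s ih => rw [Multiset.sum_cons, hSeries_add, ih, Multiset.map_cons, Multiset.prod_cons]

/-- The alphabets at which the complete symmetric functions take values in a given subring. -/
def IsIntegralAlphabet (C : Subring B) (A : ℕ+ → B) : Prop := ∀ n, hVal A n ∈ C

variable {C : Subring B}

theorem IsIntegralAlphabet.zero : IsIntegralAlphabet C (0 : ℕ+ → B) := fun n => by
  rw [← coeff_hSeries, hSeries_zero, PowerSeries.coeff_one]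
  split_ifs
  · exact C.one_mem
  · exact C.zero_mem

theorem IsIntegralAlphabet.add {A A' : ℕ+ → B} (h : IsIntegralAlphabet C A)
    (h' : IsIntegralAlphabet C A') : IsIntegralAlphabet C (A + A') := fun n => by
  rw [← coeff_hSeries, hSeries_add, PowerSeries.coeff_mul]
  refine sum_mem fun p _ => ?_
  rw [coeff_hSeries, coeff_hSeries]
  exact C.mul_mem (h _) (h' _)

/-- The generating series of `-A` is the inverse of that of `A`, and a series with constant term 1
is inverted by a recursion without denominators. -/
theorem IsIntegralAlphabet.neg {A : ℕ+ → B} (h : IsIntegralAlphabet C A) :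
    IsIntegralAlphabet C (-A) := fun n => by
  induction n using Nat.strong_induction_on with
  | _ n ih =>
    rcases Nat.eq_zero_or_pos n with rfl | hpos
    · rw [hVal_zero]
      exact C.one_mem
    · have h1 := congrArg (PowerSeries.coeff n) (hSeries_mul_neg A)
      have hmem : (0, n) ∈ antidiagonal n := HasAntidiagonal.mem_antidiagonal.2 (zero_add n)
      rw [PowerSeries.coeff_mul, PowerSeries.coeff_one, if_neg hpos.ne', ← add_sum_erase _ _ hmem,
        coeff_hSeries, coeff_hSeries, hVal_zero, one_mul] at h1
      rw [eq_neg_of_add_eq_zero_left h1]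
      refine C.neg_mem (sum_mem fun p hp => ?_)
      rw [mem_erase, HasAntidiagonal.mem_antidiagonal] at hp
      rw [coeff_hSeries, coeff_hSeries]
      refine C.mul_mem (h _) (ih _ ?_)
      have h3 : p.2 ≠ n := fun h => hp.1 (Prod.ext (by have := hp.2; omega) h)
      omega

theorem IsIntegralAlphabet.sum {κ : Type*} (s : Finset κ) {A : κ → ℕ+ → B}
    (h : ∀ i ∈ s, IsIntegralAlphabet C (A i)) : IsIntegralAlphabet C (∑ i ∈ s, A i) := by
  classical
  induction s using Finset.induction_on with
  | empty => exact .zero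
  | insert i s hi ih =>
    rw [sum_insert hi]
    exact (h i (mem_insert_self i s)).add (ih fun j hj => h j (mem_insert_of_mem hj))

theorem IsIntegralAlphabet.zsmul {A : ℕ+ → B} (h : IsIntegralAlphabet C A) (n : ℤ) :
    IsIntegralAlphabet C (n • A) := by
  induction n using Int.induction_on with
  | zero => rw [zero_smul]; exact .zero
  | succ n ih => rw [add_smul, one_smul]; exact ih.add h
  | pred n ih => rw [sub_smul, one_smul, sub_eq_add_neg]; exact ih.add h.neg

theorem isIntegralAlphabet_geom {x : B} (hx : x ∈ C) : IsIntegralAlphabet C (geom x) := fun n => by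
  rw [hVal_geom]
  exact C.pow_mem hx n

theorem IsIntegralAlphabet.multiset_sum {s : Multiset (ℕ+ → B)}
    (h : ∀ A ∈ s, IsIntegralAlphabet C A) : IsIntegralAlphabet C s.sum := by
  induction s using Multiset.induction_on with
  | empty => exact .zero
  | cons a s ih =>
    rw [Multiset.sum_cons]
    exact (h a (Multiset.mem_cons_self a s)).add (ih fun A hA => h A (Multiset.mem_cons_of_mem hA))

end Evaluation

/-! ### Product alphabets by way of roots -/

section Roots

open Polynomial

theorem reverse_X_sub_C {K : Type*} [Field K] (x : K) : (X - C x : K[X]).reverse = 1 - C x * X := by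
  ext n
  rw [coeff_reverse, natDegree_X_sub_C]
  rcases n with _ | _ | n
  · rw [revAt_le zero_le_one]
    simp [coeff_C]
  · rw [revAt_le (by simp)]
    simp [coeff_one]
  · rw [revAt_eq_self_of_lt (by omega)]
    simp [coeff_X, coeff_one]

theorem reverse_multiset_prod {K : Type*} [Field K] (s : Multiset K[X]) :
    s.prod.reverse = (s.map reverse).prod := by
  induction s using Multiset.induction_on with
  | empty =>
    rw [Multiset.prod_zero, Multiset.map_zero, Multiset.prod_zero]
    exact reverse_C (1 : K)
  | cons a s ih => rw [Multiset.prod_cons, reverse_mul_of_domain, ih, Multiset.map_cons,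
      Multiset.prod_cons]

variable {K : Type*} [Field K] [Algebra ℚ K] [IsAlgClosed K] {C : Subring K}

/-- Up to a given degree, an integral alphabet is a finite set of integral elements. -/
theorem IsIntegralAlphabet.exists_roots (hC : ∀ x : K, IsIntegral C x → x ∈ C) {A : ℕ+ → K}
    (h : IsIntegralAlphabet C A) (N : ℕ) : ∃ s : Multiset K, (∀ x ∈ s, x ∈ C) ∧
      ∀ l : ℕ+, (l : ℕ) ≤ N → A l = (s.map geom).sum l := by
  -- The coefficients are those of `hSeries (-A)` in reverse order: the reverse of `f` is the
  -- truncation of that series at degree `N`, and it also equals the product of `1 - x t` over the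
  -- roots `x` of `f`.
  let g : C[X] := X ^ N + ∑ i : Fin N, Polynomial.C (⟨hVal (-A) (N - i), h.neg _⟩ : C) * X ^ (i : ℕ)
  have hg : g.Monic := monic_X_pow_add (degree_sum_fin_lt _)
  have hgN : g.natDegree = N := by
    refine natDegree_eq_of_degree_eq_some ?_
    have := degree_sum_fin_lt fun i : Fin N => (⟨hVal (-A) (N - i), h.neg _⟩ : C)
    rw [degree_add_eq_left_of_degree_lt, degree_X_pow]
    rwa [degree_X_pow]
  let f : K[X] := g.map C.subtype
  have hf : f.Monic := hg.map _
  have hfN : f.natDegree = N := by rw [hg.natDegree_map, hgN]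
  have hcoeff : ∀ n ≤ N, f.reverse.coeff n = hVal (-A) n := fun n hn => by
    rw [coeff_reverse, hfN, revAt_le hn, coeff_map]
    rcases Nat.eq_zero_or_pos n with rfl | hpos
    · rw [Nat.sub_zero, ← hgN, hg.coeff_natDegree, hVal_zero, map_one]
    · have hlt : N - n < N := by omega
      rw [coeff_add, coeff_X_pow, if_neg hlt.ne, zero_add, finsetSum_coeff,
        Finset.sum_eq_single ⟨N - n, hlt⟩]
      · rw [coeff_C_mul_X_pow, if_pos rfl]
        change hVal (-A) (N - (N - n)) = _
        rw [Nat.sub_sub_self hn]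
      · intro i _ hi
        rw [coeff_C_mul_X_pow, if_neg fun h => hi (Fin.ext h.symm)]
      · exact fun hn => absurd (Finset.mem_univ _) hn
  have hsplit := (IsAlgClosed.splits f).eq_prod_roots_of_monic hf
  refine ⟨f.roots, fun x hx => hC x ⟨g, hg, ?_⟩, ?_⟩
  · have := (mem_roots'.1 hx).2
    rw [IsRoot, eval_map] at this
    exact this
  · have h1 : hSeries (-(f.roots.map geom).sum) = (f.reverse : PowerSeries K) := by
      have h2 : (f.reverse : PowerSeries K) =
          ((f.roots.map fun x => -geom x).map hSeries).prod := by
        rw [Multiset.map_map]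
        conv_lhs => rw [hsplit, reverse_multiset_prod, Multiset.map_map]
        rw [← coeToPowerSeries.ringHom_apply, map_multiset_prod, Multiset.map_map]
        refine congrArg Multiset.prod (Multiset.map_congr rfl fun x _ => ?_)
        rw [Function.comp_apply, Function.comp_apply, Function.comp_apply, reverse_X_sub_C,
          hSeries_neg_geom, coeToPowerSeries.ringHom_apply]
      rw [h2, ← hSeries_multiset_sum, Multiset.sum_map_neg]
    have h3 : ∀ n ≤ N, hVal (-A) n = hVal (-(f.roots.map geom).sum) n := fun n hn => by
      rw [← hcoeff n hn, ← coeff_hSeries, h1, coeff_coe]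
    intro l hl
    exact neg_injective (eq_of_hVal_eq h3 l hl)

/-- A given `hVal` depends on finitely many power sums only, so both alphabets may be replaced by
finite multisets of elements of `C`; their product alphabet consists of the pairwise products. -/
theorem IsIntegralAlphabet.mul (hC : ∀ x : K, IsIntegral C x → x ∈ C) {A A' : ℕ+ → K}
    (h : IsIntegralAlphabet C A) (h' : IsIntegralAlphabet C A') : IsIntegralAlphabet C (A * A') := by
  intro N
  obtain ⟨s, hs, hA⟩ := h.exists_roots hC N
  obtain ⟨t, ht, hA'⟩ := h'.exists_roots hC N
  let S : Multiset (ℕ+ → K) := s.bind fun x => t.map fun y => geom (x * y)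
  have hS : (s.map geom).sum * (t.map geom).sum = S.sum := by
    rw [Multiset.sum_bind, ← Multiset.sum_map_mul_right]
    refine congrArg Multiset.sum (Multiset.map_congr rfl fun x _ => ?_)
    rw [← Multiset.sum_map_mul_left]
    refine congrArg Multiset.sum (Multiset.map_congr rfl fun y _ => ?_)
    exact funext fun l => (mul_pow x y l).symm
  rw [hVal_congr (A' := S.sum) (fun l hl => ?_) N le_rfl]
  · refine IsIntegralAlphabet.multiset_sum (fun B hB => ?_) N
    obtain ⟨x, hx, hB⟩ := Multiset.mem_bind.1 hB
    obtain ⟨y, hy, rfl⟩ := Multiset.mem_map.1 hB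
    exact isIntegralAlphabet_geom (C.mul_mem (hs _ hx) (ht _ hy))
  · rw [← hS, Pi.mul_apply, Pi.mul_apply, hA l hl, hA' l hl]

end Roots

end

section

open Finset

/-! ### Families unitriangular with respect to monomials -/

section Unitriangular

variable {σ M k : Type*} [CommRing k] [AddCommMonoid M]

/-- The polynomial `f` is the monomial with exponents `m`, up to monomials of the same `w`-weight
and larger `v`-weight. -/
def IsLeading (w : (σ →₀ ℕ) →+ M) (v : (σ →₀ ℕ) →+ ℕ) (m : σ →₀ ℕ) (f : MvPolynomial σ k) : Prop :=
  MvPolynomial.coeff m f = 1 ∧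
    ∀ e, MvPolynomial.coeff e f ≠ 0 → w e = w m ∧ (e = m ∨ v m < v e)

variable {w : (σ →₀ ℕ) →+ M} {v : (σ →₀ ℕ) →+ ℕ}

theorem IsLeading.one : IsLeading w v 0 (1 : MvPolynomial σ k) := by
  classical
  refine ⟨MvPolynomial.coeff_zero_one, fun e he => ?_⟩
  rw [MvPolynomial.coeff_one] at he
  have : 0 = e := by
    by_contra h
    exact he (if_neg h)
  rw [this]
  exact ⟨rfl, Or.inl rfl⟩

theorem IsLeading.le {m e : σ →₀ ℕ} {f : MvPolynomial σ k} (hf : IsLeading w v m f)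
    (he : MvPolynomial.coeff e f ≠ 0) : v m ≤ v e :=
  (hf.2 e he).2.elim (fun h => (congrArg v h).ge) le_of_lt

theorem IsLeading.mul {m n : σ →₀ ℕ} {f g : MvPolynomial σ k} (hf : IsLeading w v m f)
    (hg : IsLeading w v n g) : IsLeading w v (m + n) (f * g) := by
  classical
  constructor
  · rw [MvPolynomial.coeff_mul, sum_eq_single (m, n), hf.1, hg.1, one_mul]
    · intro p hp hne
      by_contra h
      have hl := left_ne_zero_of_mul h
      have hr := right_ne_zero_of_mul h
      rw [HasAntidiagonal.mem_antidiagonal] at hp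
      have h3 : v p.1 + v p.2 = v m + v n := by rw [← map_add, hp, map_add]
      have h1 := hf.le hl
      have h2 := hg.le hr
      refine hne (Prod.ext ((hf.2 _ hl).2.resolve_right ?_) ((hg.2 _ hr).2.resolve_right ?_))
      · exact fun h => (add_lt_add_of_lt_of_le h h2).ne' h3
      · exact fun h => (add_lt_add_of_le_of_lt h1 h).ne' h3
    · exact fun h => absurd (by rw [HasAntidiagonal.mem_antidiagonal]) h
  · intro e he
    rw [MvPolynomial.coeff_mul] at he
    obtain ⟨p, hp, hne⟩ := exists_ne_zero_of_sum_ne_zero he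
    have hl := left_ne_zero_of_mul hne
    have hr := right_ne_zero_of_mul hne
    rw [HasAntidiagonal.mem_antidiagonal] at hp
    rw [← hp, map_add, map_add, map_add, map_add, (hf.2 _ hl).1, (hg.2 _ hr).1]
    refine ⟨rfl, ?_⟩
    rcases (hf.2 _ hl).2 with h4 | h4
    · rcases (hg.2 _ hr).2 with h5 | h5
      · exact Or.inl (by rw [h4, h5])
      · exact Or.inr (add_lt_add_of_le_of_lt (hf.le hl) h5)
    · exact Or.inr (add_lt_add_of_lt_of_le h4 (hg.le hr))

theorem IsLeading.prod {κ : Type*} (s : Finset κ) {m : κ → σ →₀ ℕ} {f : κ → MvPolynomial σ k}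
    (h : ∀ i ∈ s, IsLeading w v (m i) (f i)) : IsLeading w v (∑ i ∈ s, m i) (∏ i ∈ s, f i) := by
  classical
  induction s using Finset.induction_on with
  | empty => exact .one
  | insert i s hi ih =>
    rw [sum_insert hi, prod_insert hi]
    exact (h i (mem_insert_self i s)).mul (ih fun j hj => h j (mem_insert_of_mem hj))

theorem IsLeading.rename {τ M' : Type*} [AddCommMonoid M'] {w' : (τ →₀ ℕ) →+ M'}
    {v' : (τ →₀ ℕ) →+ ℕ} {j : σ → τ} (hj : Function.Injective j) (g : M → M')
    (hw : ∀ e, w' (e.mapDomain j) = g (w e)) (hv : ∀ e, v' (e.mapDomain j) = v e)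
    {m : σ →₀ ℕ} {f : MvPolynomial σ k} (hf : IsLeading w v m f) :
    IsLeading w' v' (m.mapDomain j) (MvPolynomial.rename j f) := by
  refine ⟨by rw [MvPolynomial.coeff_rename_mapDomain j hj, hf.1], fun e he => ?_⟩
  obtain ⟨d, rfl, hd⟩ := MvPolynomial.coeff_rename_ne_zero j f e he
  obtain ⟨h1, h2⟩ := hf.2 d hd
  rw [hw, hw, hv, hv, h1]
  exact ⟨rfl, h2.imp (fun h => by rw [h]) id⟩

variable {Λ : Type*} {f : Λ → MvPolynomial σ k} {φ : Λ → σ →₀ ℕ}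

/-- Inside a `w`-weight `v` is bounded. Each monomial is its `f i` minus monomials of larger `v`,
which gives an induction on the room `N - v m` that is left. -/
theorem span_of_isLeading (hφ : Function.Surjective φ) (hf : ∀ i, IsLeading w v (φ i) (f i))
    (hN : ∀ a : M, ∃ N, ∀ e, w e = a → v e ≤ N) : Submodule.span k (Set.range f) = ⊤ := by
  classical
  have key : ∀ (a : M) (N : ℕ), (∀ e, w e = a → v e ≤ N) → ∀ (d : ℕ) (m : σ →₀ ℕ), w m = a →
      N - v m = d → MvPolynomial.monomial m (1 : k) ∈ Submodule.span k (Set.range f) := by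
    intro a N hN d
    induction d using Nat.strong_induction_on with
    | _ d ih =>
      intro m hm hd
      obtain ⟨i, rfl⟩ := hφ m
      have h1 : f i = MvPolynomial.monomial (φ i) 1 +
          ∑ e ∈ (f i).support.erase (φ i),
            MvPolynomial.coeff e (f i) • MvPolynomial.monomial e (1 : k) := by
        conv_lhs => rw [MvPolynomial.as_sum (f i)]
        simp only [MvPolynomial.smul_monomial, smul_eq_mul, mul_one]
        -- The second case is the zero ring, where the leading coefficient 1 vanishes.
        by_cases hi : φ i ∈ (f i).support
        · rw [← add_sum_erase _ _ hi, (hf i).1]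
        · have h0 : (1 : k) = 0 := by rw [← (hf i).1, MvPolynomial.notMem_support_iff.1 hi]
          rw [h0, MvPolynomial.monomial_zero, zero_add, erase_eq_of_notMem hi]
      rw [← sub_eq_iff_eq_add] at h1
      rw [← h1]
      refine Submodule.sub_mem _ (Submodule.subset_span ⟨i, rfl⟩)
        (Submodule.sum_mem _ fun e he => Submodule.smul_mem _ _ ?_)
      rw [mem_erase, MvPolynomial.mem_support_iff] at he
      obtain ⟨h2, h3⟩ := (hf i).2 e he.2
      have h4 : v (φ i) < v e := h3.resolve_left he.1
      have h5 := hN e (h2.trans hm)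
      exact ih (N - v e) (by omega) e (h2.trans hm) rfl
  rw [eq_top_iff]
  rintro p -
  rw [MvPolynomial.as_sum p]
  refine Submodule.sum_mem _ fun m _ => ?_
  obtain ⟨N, hN⟩ := hN (w m)
  have := key _ N hN _ m rfl rfl
  rw [← mul_one (MvPolynomial.coeff m p), ← smul_eq_mul, ← MvPolynomial.smul_monomial]
  exact Submodule.smul_mem _ _ this

/-- In a vanishing combination take an index with least `v` among those that occur: no other member
can contain its leading monomial. -/
theorem linearIndependent_of_isLeading (hφ : Function.Injective φ)
    (hf : ∀ i, IsLeading w v (φ i) (f i)) : LinearIndependent k f := by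
  classical
  rw [linearIndependent_iff]
  intro c hc
  by_contra hne
  obtain ⟨i, hi, hmin⟩ := exists_min_image c.support (fun i => v (φ i))
    (Finsupp.support_nonempty_iff.2 hne)
  have h1 := congrArg (MvPolynomial.coeff (φ i)) hc
  rw [Finsupp.linearCombination_apply, Finsupp.sum, MvPolynomial.coeff_sum, sum_eq_single i] at h1
  · rw [MvPolynomial.coeff_smul, (hf i).1, smul_eq_mul, mul_one, MvPolynomial.coeff_zero] at h1
    exact Finsupp.mem_support_iff.1 hi h1
  · intro j hj hji
    rw [MvPolynomial.coeff_smul]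
    by_contra h
    rcases ((hf j).2 _ (right_ne_zero_of_smul h)).2 with h2 | h2
    · exact hji (hφ h2.symm)
    · exact absurd (hmin j hj) (not_le.2 h2)
  · exact fun h => absurd hi h

end Unitriangular

/-! ### The leading monomial of the Schur determinant -/

section Diagrams

/-- The exponents of the monomial `h_μ`. -/
def diagExp (μ : YoungDiagram) : ℕ+ →₀ ℕ :=
  Multiset.toFinsupp ((μ.rowLens : Multiset ℕ).map Nat.toPNat')

theorem map_toMultiset_diagExp (μ : YoungDiagram) :
    (Finsupp.toMultiset (diagExp μ)).map (fun l : ℕ+ => (l : ℕ)) = (μ.rowLens : Multiset ℕ) := by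
  rw [diagExp, Multiset.toFinsupp_toMultiset, Multiset.map_map]
  conv_rhs => rw [← Multiset.map_id (μ.rowLens : Multiset ℕ)]
  exact Multiset.map_congr rfl fun i hi => PNat.toPNat'_coe (μ.pos_of_mem_rowLens i hi)

theorem diagExp_injective : Function.Injective diagExp := fun μ ν h => by
  have h1 : (μ.rowLens : Multiset ℕ) = ν.rowLens := by
    rw [← map_toMultiset_diagExp, h, map_toMultiset_diagExp]
  have h2 : μ.rowLens = ν.rowLens := (Multiset.coe_eq_coe.1 h1).eq_of_pairwise'
    μ.rowLens_sorted.pairwise ν.rowLens_sorted.pairwise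
  exact YoungDiagram.equivListRowLens.injective (Subtype.ext h2)

theorem diagExp_surjective : Function.Surjective diagExp := fun m => by
  let w : List ℕ := ((Finsupp.toMultiset m).map fun l : ℕ+ => (l : ℕ)).sort (· ≥ ·)
  have hw : w.SortedGE := (Multiset.pairwise_sort _ _).sortedGE
  have hpos : ∀ x ∈ w, 0 < x := fun x hx => by
    rw [Multiset.mem_sort, Multiset.mem_map] at hx
    obtain ⟨l, -, rfl⟩ := hx
    exact l.pos
  refine ⟨YoungDiagram.ofRowLens w hw, ?_⟩
  rw [diagExp, YoungDiagram.rowLens_ofRowLens_eq_self hpos, Multiset.sort_eq, Multiset.map_map]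
  conv_rhs => rw [← Finsupp.toMultiset_toFinsupp m, ← Multiset.map_id (Finsupp.toMultiset m)]
  exact congrArg _ (Multiset.map_congr rfl fun l _ => PNat.coe_toPNat' l)

theorem diagExp_bot : diagExp ⊥ = 0 := by
  have h : (⊥ : YoungDiagram).rowLens = [] := by
    rw [← List.length_eq_zero_iff, YoungDiagram.length_rowLens]
    simp [YoungDiagram.colLen]
  rw [diagExp, h]
  simp

/-- The exponents of `h_z`, for an integer `z`. -/
def intExp (z : ℤ) : ℕ+ →₀ ℕ := if z ≤ 0 then 0 else Finsupp.single z.toNat.toPNat' 1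

theorem diagExp_eq_sum (μ : YoungDiagram) :
    diagExp μ = ∑ i : Fin (μ.colLen 0), intExp (μ.rowLen i) := by
  have h : ∀ n ≤ μ.colLen 0, Multiset.toFinsupp
      ((((List.range n).map μ.rowLen : List ℕ) : Multiset ℕ).map Nat.toPNat') =
        ∑ i ∈ range n, intExp (μ.rowLen i) := by
    intro n
    induction n with
    | zero => simp
    | succ n ih =>
      intro hn
      have hpos : 0 < μ.rowLen n := μ.pos_of_mem_rowLens _
        (List.mem_map_of_mem (List.mem_range.2 hn))
      rw [List.range_succ, List.map_append, ← Multiset.coe_add, Multiset.map_add, map_add,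
        ih (Nat.le_of_succ_le hn), sum_range_succ, intExp, if_neg (by omega), Int.toNat_natCast,
        List.map_singleton, Multiset.coe_singleton, Multiset.map_singleton,
        Multiset.toFinsupp_singleton]
  rw [Fin.sum_univ_eq_sum_range (fun i => intExp (μ.rowLen i)), ← h _ le_rfl]
  rfl

theorem diagExp_eq_zero {μ : YoungDiagram} : diagExp μ = 0 ↔ μ = ⊥ :=
  ⟨fun h => diagExp_injective (h.trans diagExp_bot.symm), fun h => h ▸ diagExp_bot⟩

variable (k : Type*) [CommRing k]

/-- The generator `h_z`, for an integer `z`. -/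
def intGen (z : ℤ) : MvPolynomial ℕ+ k := if z < 0 then 0 else MvPolynomial.monomial (intExp z) 1

/-- The Schur function as a polynomial in the complete symmetric functions. -/
def schurPoly (μ : YoungDiagram) : MvPolynomial ℕ+ k :=
  Matrix.det (Matrix.of fun i j : Fin (μ.colLen 0) =>
    intGen k ((μ.rowLen i : ℤ) - (i : ℤ) + (j : ℤ)))

/-- The sum of the squares of the parts. -/
def sqExp : (ℕ+ →₀ ℕ) →+ ℕ := Finsupp.weight fun l : ℕ+ => (l : ℕ) ^ 2

theorem wtExp_intExp {z : ℤ} (hz : 0 ≤ z) : (wtExp (intExp z) : ℤ) = z := by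
  rw [intExp]
  split_ifs with h
  · rw [map_zero]
    omega
  · rw [wtExp_single, one_mul, PNat.toPNat'_coe (by omega)]
    omega

theorem sqExp_intExp {z : ℤ} (hz : 0 ≤ z) : (sqExp (intExp z) : ℤ) = z ^ 2 := by
  rw [intExp]
  split_ifs with h
  · have : z = 0 := by omega
    rw [this, map_zero]
    rfl
  · rw [sqExp, Finsupp.weight_single, one_smul, PNat.toPNat'_coe (by omega), Nat.cast_pow,
      Int.toNat_of_nonneg hz]

/-- A permutation in the determinant gives the monomial with parts `a (s i) + i`, where `a` is
strictly decreasing. The sum of the parts does not depend on `s`, and by the rearrangement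
inequality the sum of their squares is least for the identity alone. -/
theorem isLeading_schurPoly (μ : YoungDiagram) :
    IsLeading wtExp sqExp (diagExp μ) (schurPoly k μ) := by
  classical
  set n := μ.colLen 0 with hn
  let a : Fin n → ℤ := fun i => (μ.rowLen i : ℤ) - (i : ℤ)
  have ha : StrictAnti a := fun i j hij => by
    have h1 : μ.rowLen j ≤ μ.rowLen i := μ.rowLen_anti _ _ hij.le
    have h2 : (i : ℕ) < j := hij
    change (μ.rowLen j : ℤ) - (j : ℤ) < (μ.rowLen i : ℤ) - (i : ℤ)
    omega
  let E (s : Equiv.Perm (Fin n)) : ℕ+ →₀ ℕ := ∑ i, intExp (a (s i) + (i : ℤ))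
  -- The remaining permutations have a factor with negative index, which is 0. They must be set
  -- aside, because `intExp` is 0 at negative integers and the formulas for weight and squares fail
  -- there.
  let P (s : Equiv.Perm (Fin n)) : Prop := ∀ i, 0 ≤ a (s i) + (i : ℤ)
  have hdet : schurPoly k μ = ∑ s : Equiv.Perm (Fin n),
      (if P s then (Equiv.Perm.sign s : ℤ) • MvPolynomial.monomial (E s) (1 : k) else 0) := by
    rw [schurPoly, Matrix.det_apply]
    refine sum_congr rfl fun s _ => ?_
    split_ifs with h
    · rw [Units.smul_def, MvPolynomial.monomial_sum_one]
      refine congrArg _ (prod_congr rfl fun i _ => ?_)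
      rw [Matrix.of_apply, intGen, if_neg (not_lt.2 (h i))]
    · simp only [P, not_forall, not_le] at h
      obtain ⟨i, hi⟩ := h
      rw [prod_eq_zero (mem_univ i), smul_zero]
      rw [Matrix.of_apply, intGen, if_pos hi]
  have hP1 : P 1 := fun i => by
    change 0 ≤ (μ.rowLen i : ℤ) - (i : ℤ) + (i : ℤ)
    omega
  have hE1 : E 1 = diagExp μ := by
    rw [diagExp_eq_sum]
    refine sum_congr rfl fun i _ => congrArg _ ?_
    change (μ.rowLen i : ℤ) - (i : ℤ) + (i : ℤ) = _
    ring
  have hw : ∀ s, P s → (wtExp (E s) : ℤ) = ∑ i, a i + ∑ i : Fin n, (i : ℤ) := fun s hs => by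
    rw [map_sum, Nat.cast_sum, ← Equiv.sum_comp s a, ← sum_add_distrib]
    exact sum_congr rfl fun i _ => wtExp_intExp (hs i)
  -- Only the cross term depends on `s`.
  have hv : ∀ s, P s → (sqExp (E s) : ℤ) = ∑ i, a i ^ 2 + ∑ i : Fin n, (i : ℤ) ^ 2 +
      2 * ∑ i, a (s i) * (i : ℤ) := fun s hs => by
    rw [map_sum, Nat.cast_sum, ← Equiv.sum_comp s (fun i => a i ^ 2), mul_sum, ← sum_add_distrib,
      ← sum_add_distrib]
    refine sum_congr rfl fun i _ => (sqExp_intExp (hs i)).trans ?_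
    ring
  have hlt : ∀ s, s ≠ 1 → P s → sqExp (E 1) < sqExp (E s) := fun s hs hPs => by
    have hanti : Antivary a fun i : Fin n => (i : ℤ) := fun i j hij => by
      have : (i : ℤ) < (j : ℤ) := hij
      exact (ha (show i < j by rw [Fin.lt_def]; omega)).le
    have h1 : ∑ i, a i * (i : ℤ) < ∑ i, a (s i) * (i : ℤ) := by
      refine hanti.sum_mul_lt_sum_comp_perm_mul_iff.2 fun hc => hs ?_
      -- Equality in the rearrangement inequality would make `s` increasing, hence the identity.
      have hmono : StrictMono s := fun i j hij => by
        have h2 : a (s j) ≤ a (s i) := hc (show (i : ℤ) < (j : ℤ) by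
          rw [Fin.lt_def] at hij
          omega)
        exact lt_of_le_of_ne (ha.le_iff_ge.1 h2) fun h => hij.ne (s.injective h)
      refine Equiv.ext fun i => ?_
      exact congrFun (StrictMono.range_inj hmono (strictMono_id (α := Fin n)) |>.1
        (by rw [s.surjective.range_eq, Set.range_id])) i
    have h2 := hv s hPs
    have h3 := hv 1 hP1
    simp only [Equiv.Perm.coe_one, id_eq] at h3
    omega
  rw [← hE1]
  have hcoeff : ∀ e, MvPolynomial.coeff e (schurPoly k μ) = ∑ s : Equiv.Perm (Fin n),
      (if P s ∧ E s = e then ((Equiv.Perm.sign s : ℤ) : k) else 0) := fun e => by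
    rw [hdet, MvPolynomial.coeff_sum]
    refine sum_congr rfl fun s _ => ?_
    by_cases h : P s
    · rw [if_pos h, MvPolynomial.coeff_smul, MvPolynomial.coeff_monomial]
      by_cases h' : E s = e
      · rw [if_pos h', if_pos ⟨h, h'⟩, zsmul_one]
      · rw [if_neg h', if_neg fun h => h' h.2, smul_zero]
    · rw [if_neg h, if_neg fun h' => h h'.1, MvPolynomial.coeff_zero]
  constructor
  · rw [hcoeff, sum_eq_single 1, if_pos ⟨hP1, rfl⟩]
    · simp
    · exact fun s _ hs => if_neg fun h => (hlt s hs h.1).ne' (congrArg sqExp h.2)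
    · exact fun h => absurd (mem_univ _) h
  · intro e he
    rw [hcoeff] at he
    obtain ⟨s, -, hs⟩ := exists_ne_zero_of_sum_ne_zero he
    have h : P s ∧ E s = e := by
      by_contra h
      exact hs (if_neg h)
    rw [← h.2]
    refine ⟨?_, ?_⟩
    · have h1 := hw s h.1
      have h2 := hw 1 hP1
      omega
    · by_cases hs1 : s = 1
      · exact Or.inl (by rw [hs1])
      · exact Or.inr (hlt s hs1 h.1)

theorem map_intGen (z : ℤ) : MvPolynomial.map (Int.castRingHom k) (intGen ℤ z) = intGen k z := by
  rw [intGen, intGen]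
  split_ifs
  · rw [map_zero]
  · rw [MvPolynomial.map_monomial, map_one]

theorem map_schurPoly (μ : YoungDiagram) :
    MvPolynomial.map (Int.castRingHom k) (schurPoly ℤ μ) = schurPoly k μ := by
  rw [schurPoly, schurPoly, RingHom.map_det]
  congr 1
  ext1 i j
  rw [RingHom.mapMatrix_apply, Matrix.map_apply, Matrix.of_apply, Matrix.of_apply, map_intGen]

/-- The determinantal formula expresses the Schur functions in the complete symmetric functions. -/
theorem schur_eq_aeval (μ : YoungDiagram) :
    schur μ = MvPolynomial.aeval (fun l : ℕ+ => hSym l) (schurPoly ℚ μ) := by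
  rw [schur, schurPoly, AlgHom.map_det]
  congr 1
  ext1 i j
  rw [AlgHom.mapMatrix_apply, Matrix.map_apply, Matrix.of_apply, Matrix.of_apply, hSymInt, intGen]
  split_ifs with h
  · rw [map_zero]
  · rw [MvPolynomial.aeval_monomial, map_one, one_mul, intExp]
    split_ifs with h'
    · rw [Finsupp.prod_zero_index, Int.toNat_of_nonpos h', hSym_zero]
    · rw [Finsupp.prod_single_index (h := fun l n => hSym ((l : ℕ+) : ℕ) ^ n) (pow_zero _), pow_one,
        PNat.toPNat'_coe (by omega)]

end Diagrams

end

section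

open Finset

/-! ### Products of Schur functions over the index set -/

section Multi

variable {ι : Type*}

theorem mk_injective (U : ι) : Function.Injective fun l : ℕ+ => (U, l) := fun _ _ h =>
  (Prod.ext_iff.1 h).2

/-- The weight of a monomial in families of variables: the family of the weights of its parts. -/
def multiWt : (ι × ℕ+ →₀ ℕ) →+ (ι →₀ ℕ) :=
  Finsupp.weight fun s : ι × ℕ+ => Finsupp.single s.1 (s.2 : ℕ)

/-- The sum of the squares of the indices. -/
def multiSq : (ι × ℕ+ →₀ ℕ) →+ ℕ := Finsupp.weight fun s : ι × ℕ+ => (s.2 : ℕ) ^ 2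

theorem multiWt_mapDomain (U : ι) (e : ℕ+ →₀ ℕ) :
    multiWt (e.mapDomain fun l => (U, l)) = Finsupp.single U (wtExp e) := by
  induction e using Finsupp.induction_linear with
  | zero => simp
  | add f g hf hg => rw [Finsupp.mapDomain_add, map_add, hf, hg, map_add, Finsupp.single_add]
  | single l n =>
    rw [Finsupp.mapDomain_single, multiWt, Finsupp.weight_single, wtExp_single, Finsupp.smul_single,
      smul_eq_mul]

theorem multiSq_mapDomain (U : ι) (e : ℕ+ →₀ ℕ) :
    multiSq (e.mapDomain fun l => (U, l)) = sqExp e := by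
  induction e using Finsupp.induction_linear with
  | zero => simp
  | add f g hf hg => rw [Finsupp.mapDomain_add, map_add, hf, hg, map_add]
  | single l n => rw [Finsupp.mapDomain_single, multiSq, Finsupp.weight_single, sqExp,
      Finsupp.weight_single]

theorem degree_multiWt (e : ι × ℕ+ →₀ ℕ) :
    (multiWt e).degree = ∑ s ∈ e.support, e s * (s.2 : ℕ) := by
  rw [multiWt, Finsupp.weight_apply, Finsupp.sum, map_sum]
  exact sum_congr rfl fun s _ => by rw [Finsupp.smul_single, Finsupp.degree_single, smul_eq_mul]

theorem mul_le_degree_multiWt (e : ι × ℕ+ →₀ ℕ) (s : ι × ℕ+) :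
    e s * (s.2 : ℕ) ≤ (multiWt e).degree := by
  by_cases hs : s ∈ e.support
  · rw [degree_multiWt]
    exact single_le_sum (f := fun s => e s * (s.2 : ℕ)) (fun _ _ => Nat.zero_le _) hs
  · rw [Finsupp.notMem_support_iff.1 hs, zero_mul]
    exact Nat.zero_le _

theorem snd_le_degree_multiWt {e : ι × ℕ+ →₀ ℕ} {s : ι × ℕ+} (hs : s ∈ e.support) :
    (s.2 : ℕ) ≤ (multiWt e).degree :=
  (Nat.le_mul_of_pos_left _ (Nat.pos_of_ne_zero (Finsupp.mem_support_iff.1 hs))).trans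
    (mul_le_degree_multiWt e s)

theorem multiSq_le (e : ι × ℕ+ →₀ ℕ) : multiSq e ≤ (multiWt e).degree ^ 2 := by
  rw [multiSq, Finsupp.weight_apply, Finsupp.sum, sq]
  conv_rhs => rw [degree_multiWt e, sum_mul]
  refine sum_le_sum fun s hs => ?_
  rw [smul_eq_mul, sq, ← mul_assoc]
  have := snd_le_degree_multiWt hs
  rw [degree_multiWt] at this
  exact Nat.mul_le_mul_left _ this

theorem multiWt_apply_ne_zero {e : ι × ℕ+ →₀ ℕ} {s : ι × ℕ+} (hs : s ∈ e.support) :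
    multiWt e s.1 ≠ 0 := by
  rw [multiWt, Finsupp.weight_apply, Finsupp.sum, Finsupp.finsetSum_apply]
  refine (sum_pos' (fun _ _ => Nat.zero_le _) ⟨s, hs, ?_⟩).ne'
  rw [Finsupp.smul_single, Finsupp.single_eq_same, smul_eq_mul]
  exact Nat.mul_pos (Nat.pos_of_ne_zero (Finsupp.mem_support_iff.1 hs)) s.2.pos

/-- The weight bounds the variables that occur as well as their exponents. These finite sets are the
blocks of the change of basis between power sums and Schur functions. -/
theorem finite_multiWt_eq (a : ι →₀ ℕ) : {e : ι × ℕ+ →₀ ℕ | multiWt e = a}.Finite := by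
  classical
  -- `succPNat` exceeds the degree by one; it merely provides a bound in `ℕ+` even for degree 0.
  let S : Finset (ι × ℕ+) := a.support ×ˢ Finset.Icc 1 a.degree.succPNat
  refine (Set.finite_Iic (∑ s ∈ S, Finsupp.single s a.degree)).subset fun e he s => ?_
  change multiWt e = a at he
  by_cases hs : s ∈ e.support
  · have h1 : s ∈ S := by
      rw [mem_product, Finsupp.mem_support_iff, ← he, Finset.mem_Icc]
      refine ⟨multiWt_apply_ne_zero hs, one_le, ?_⟩
      rw [← PNat.coe_le_coe, Nat.succPNat_coe]
      exact (snd_le_degree_multiWt hs).trans (Nat.le_succ _)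
    rw [Finsupp.finsetSum_apply]
    refine le_trans ?_ (single_le_sum (f := fun t => (Finsupp.single t a.degree : ι × ℕ+ →₀ ℕ) s)
      (fun _ _ => Nat.zero_le _) h1)
    rw [Finsupp.single_eq_same, ← he]
    exact (Nat.le_mul_of_pos_right _ s.2.pos).trans (mul_le_degree_multiWt e s)
  · rw [Finsupp.notMem_support_iff.1 hs]
    exact Nat.zero_le _

/-- The exponents of the monomial `∏_U h_{lam(U)}`. -/
def multiExp (lam : MultiPartition ι) : ι × ℕ+ →₀ ℕ :=
  ∑ U ∈ lam.2.toFinset, (diagExp (lam.1 U)).mapDomain fun l => (U, l)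

theorem diagram_eq_bot_of_card {μ : YoungDiagram} (h : μ.card = 0) : μ = ⊥ :=
  YoungDiagram.ext (by rw [card_eq_zero.1 h]; rfl)

theorem multiExp_apply (lam : MultiPartition ι) (U : ι) (l : ℕ+) :
    multiExp lam (U, l) = diagExp (lam.1 U) l := by
  classical
  rw [multiExp, Finsupp.finsetSum_apply, sum_eq_single U]
  · exact Finsupp.mapDomain_apply (mk_injective U) _ l
  · intro V _ hV
    refine Finsupp.mapDomain_of_notMem_range _ _ ?_
    rintro ⟨l', h⟩
    exact hV (Prod.ext_iff.1 h).1
  · intro hU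
    rw [Set.Finite.mem_toFinset, Function.mem_support, not_not] at hU
    rw [diagram_eq_bot_of_card hU, diagExp_bot, Finsupp.mapDomain_zero]
    rfl

theorem multiExp_injective : Function.Injective (multiExp (ι := ι)) := fun lam mu h =>
  Subtype.ext (funext fun U => diagExp_injective (Finsupp.ext fun l => by
    rw [← multiExp_apply, h, multiExp_apply]))

theorem multiExp_surjective : Function.Surjective (multiExp (ι := ι)) := fun m => by
  classical
  choose d hd using diagExp_surjective
  let c (U : ι) : ℕ+ →₀ ℕ := m.comapDomain (fun l => (U, l)) (mk_injective U).injOn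
  refine ⟨⟨fun U => d (c U), (m.support.image Prod.fst).finite_toSet.subset fun U hU => ?_⟩, ?_⟩
  · by_contra hn
    refine hU ?_
    have : c U = 0 := Finsupp.ext fun l => by
      by_contra h
      exact hn (mem_coe.2 (mem_image.2 ⟨(U, l), Finsupp.mem_support_iff.2 h, rfl⟩))
    change (d (c U)).card = 0
    have h1 : d (c U) = ⊥ := by rw [← diagExp_eq_zero, hd, this]
    rw [h1]
    rfl
  · refine Finsupp.ext fun s => ?_
    exact (multiExp_apply _ s.1 s.2).trans (DFunLike.congr_fun (hd (c s.1)) s.2)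

variable (k : Type*) [CommRing k]

/-- The product of Schur functions, as a polynomial in the complete symmetric functions. -/
def multiSchurPoly (lam : MultiPartition ι) : MvPolynomial (ι × ℕ+) k :=
  ∏ U ∈ lam.2.toFinset, MvPolynomial.rename (fun l => (U, l)) (schurPoly k (lam.1 U))

theorem isLeading_multiSchurPoly (lam : MultiPartition ι) :
    IsLeading multiWt multiSq (multiExp lam) (multiSchurPoly k lam) :=
  IsLeading.prod _ fun U _ => (isLeading_schurPoly k (lam.1 U)).rename (mk_injective U)
    (Finsupp.single U) (multiWt_mapDomain U) (multiSq_mapDomain U)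

theorem linearIndependent_multiSchurPoly :
    LinearIndependent k (multiSchurPoly k : MultiPartition ι → _) :=
  linearIndependent_of_isLeading multiExp_injective (isLeading_multiSchurPoly k)

theorem span_multiSchurPoly :
    Submodule.span k (Set.range (multiSchurPoly k : MultiPartition ι → _)) = ⊤ :=
  span_of_isLeading multiExp_surjective (isLeading_multiSchurPoly k) fun a =>
    ⟨a.degree ^ 2, fun e he => he ▸ multiSq_le e⟩

theorem map_multiSchurPoly (lam : MultiPartition ι) :
    MvPolynomial.map (Int.castRingHom k) (multiSchurPoly ℤ lam) = multiSchurPoly k lam := by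
  rw [multiSchurPoly, multiSchurPoly, map_prod]
  exact prod_congr rfl fun U _ => by rw [MvPolynomial.map_rename, map_schurPoly]

variable {B B' : Type*} [CommRing B] [Algebra ℚ B] [CommRing B'] [Algebra ℚ B']

theorem schurProd_eq_aeval (lam : MultiPartition ι) (A : ι → ℕ+ → B) :
    schurProd lam A = MvPolynomial.aeval (fun s : ι × ℕ+ => hVal (A s.1) s.2)
      (multiSchurPoly ℚ lam) := by
  rw [schurProd, multiSchurPoly, map_prod]
  refine prod_congr rfl fun U _ => ?_
  rw [schur_eq_aeval, MvPolynomial.aeval_rename, ← AlgHom.comp_apply, MvPolynomial.comp_aeval]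
  rfl

theorem map_schurProd (φ : B →ₐ[ℚ] B') (lam : MultiPartition ι) (A : ι → ℕ+ → B) :
    φ (schurProd lam A) = schurProd lam fun U l => φ (A U l) := by
  rw [schurProd, schurProd, map_prod]
  exact prod_congr rfl fun U _ => by rw [← AlgHom.comp_apply, MvPolynomial.comp_aeval]

/-- The power sums are the coefficients of `t f' / f`, where `f` is the prescribed generating
series, invertible by its constant term 1. -/
theorem exists_hVal_eq {c : ℕ → B} (h0 : c 0 = 1) : ∃ A : ℕ+ → B, ∀ n, hVal A n = c n := by
  let f : PowerSeries B := PowerSeries.mk c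
  have hf0 : PowerSeries.constantCoeff f = ((1 : Bˣ) : B) := by
    rw [← PowerSeries.coeff_zero_eq_constantCoeff_apply, PowerSeries.coeff_mk, h0, Units.val_one]
  let P : PowerSeries B := PowerSeries.X * PowerSeries.derivative B f * PowerSeries.invOfUnit f 1
  let A : ℕ+ → B := fun l => PowerSeries.coeff l P
  have hP : PowerSeries.mk (pVal A) = P := by
    ext n
    rw [PowerSeries.coeff_mk]
    by_cases hn : n = 0
    · rw [hn, pVal_zero, PowerSeries.coeff_zero_eq_constantCoeff_apply, map_mul, map_mul,
        PowerSeries.constantCoeff_X, zero_mul, zero_mul]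
    · obtain ⟨l, rfl⟩ := exists_coe_eq hn
      rw [pVal_coe]
  have h : f = hSeries A := by
    refine eq_hSeries ?_ ?_
    · rw [PowerSeries.coeff_mk, h0]
    · rw [hP, mul_assoc, mul_comm _ f, PowerSeries.mul_invOfUnit f 1 hf0, mul_one]
  exact ⟨A, fun n => by rw [← coeff_hSeries, ← h, PowerSeries.coeff_mk]⟩

/-- The expression of the complete symmetric functions in the power sums. -/
def hToP (σ : Type*) : MvPolynomial (σ × ℕ+) ℚ →ₐ[ℚ] MvPolynomial (σ × ℕ+) ℚ :=
  MvPolynomial.aeval fun s : σ × ℕ+ => hVal (fun l => MvPolynomial.X (s.1, l)) s.2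

/-- The inverse sends the power sums to an alphabet `q` whose complete functions are the variables.
The second composite is compared through complete functions, since these determine the power sums.
-/
theorem exists_inverse_hToP (σ : Type*) : ∃ g : MvPolynomial (σ × ℕ+) ℚ →ₐ[ℚ] MvPolynomial (σ × ℕ+) ℚ,
    g.comp (hToP σ) = AlgHom.id ℚ _ ∧ (hToP σ).comp g = AlgHom.id ℚ _ := by
  have hq (U : σ) := exists_hVal_eq (B := MvPolynomial (σ × ℕ+) ℚ)
    (c := fun n => if n = 0 then 1 else MvPolynomial.X (U, n.toPNat')) (if_pos rfl)
  choose q hq using hq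
  have hq' (U : σ) (n : ℕ+) : hVal (q U) n = MvPolynomial.X (U, n) := by
    rw [hq, if_neg n.ne_zero, PNat.coe_toPNat']
  refine ⟨MvPolynomial.aeval fun s => q s.1 s.2, ?_, ?_⟩
  · refine MvPolynomial.algHom_ext fun s => ?_
    rw [AlgHom.comp_apply, hToP, MvPolynomial.aeval_X, map_hVal, AlgHom.id_apply]
    simp only [MvPolynomial.aeval_X]
    exact hq' s.1 s.2
  · refine MvPolynomial.algHom_ext fun s => ?_
    rw [AlgHom.comp_apply, MvPolynomial.aeval_X, AlgHom.id_apply]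
    refine eq_of_hVal_eq (A := fun l => hToP σ (q s.1 l))
      (A' := fun l => MvPolynomial.X (s.1, l)) (N := s.2) (fun n _ => ?_) s.2 le_rfl
    rw [← map_hVal]
    by_cases hn : n = 0
    · rw [hn, hVal_zero, hVal_zero, map_one]
    · obtain ⟨l, rfl⟩ := exists_coe_eq hn
      rw [hq', hToP, MvPolynomial.aeval_X]

/-- The polynomial rings in the complete symmetric functions and in the power sums agree. -/
def hEquivP (σ : Type*) : MvPolynomial (σ × ℕ+) ℚ ≃ₐ[ℚ] MvPolynomial (σ × ℕ+) ℚ :=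
  AlgEquiv.ofAlgHom (hToP σ) (exists_inverse_hToP σ).choose (exists_inverse_hToP σ).choose_spec.2
    (exists_inverse_hToP σ).choose_spec.1

theorem hEquivP_apply (σ : Type*) (f : MvPolynomial (σ × ℕ+) ℚ) : hEquivP σ f = hToP σ f := rfl

/-- The product `∏_U s_{lam(U)}` as a polynomial in the power sums. -/
def schurP (lam : MultiPartition ι) : MvPolynomial (ι × ℕ+) ℚ :=
  schurProd lam fun U l => MvPolynomial.X (U, l)

theorem schurP_eq (lam : MultiPartition ι) : schurP lam = hEquivP ι (multiSchurPoly ℚ lam) :=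
  schurProd_eq_aeval lam _

/-- The products of Schur functions are a basis of the polynomial ring in the power sums. -/
def schurBasis : Module.Basis (MultiPartition ι) ℚ (MvPolynomial (ι × ℕ+) ℚ) :=
  (Module.Basis.mk (linearIndependent_multiSchurPoly ℚ) (span_multiSchurPoly ℚ).ge).map
    (hEquivP ι).toLinearEquiv

theorem schurBasis_apply (lam : MultiPartition ι) : schurBasis lam = schurP lam := by
  rw [schurBasis, Module.Basis.map_apply, Module.Basis.mk_apply, schurP_eq]
  rfl

theorem isWeightedHomogeneous_hVal (U : ι) (n : ℕ) : MvPolynomial.IsWeightedHomogeneous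
    (fun s : ι × ℕ+ => Finsupp.single s.1 (s.2 : ℕ))
    (hVal (fun l => (MvPolynomial.X (U, l) : MvPolynomial (ι × ℕ+) ℚ)) n) (Finsupp.single U n) := by
  intro d hd
  have h : hVal (fun l => (MvPolynomial.X (U, l) : MvPolynomial (ι × ℕ+) ℚ)) n =
      MvPolynomial.rename (fun l => (U, l)) (hSym n) := by
    rw [hVal]
    refine DFunLike.congr_fun (MvPolynomial.algHom_ext fun l => ?_) (hSym n)
    rw [MvPolynomial.aeval_X, MvPolynomial.rename_X]
  rw [h] at hd
  obtain ⟨e, rfl, he⟩ := MvPolynomial.coeff_rename_ne_zero _ _ _ hd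
  rw [coeff_hSym] at he
  have hw : wtExp e = n := by
    by_contra h
    exact he (if_neg h)
  rw [← hw]
  exact multiWt_mapDomain U e

/-- Homogeneity for a weight with values in `ι →₀ ℕ`: this is the block structure of the change of
basis. -/
theorem coeff_schurP_ne_zero {lam : MultiPartition ι} {m : ι × ℕ+ →₀ ℕ}
    (h : MvPolynomial.coeff m (schurP lam) ≠ 0) : multiWt m = multiWt (multiExp lam) := by
  have H : MvPolynomial.IsWeightedHomogeneous (fun s : ι × ℕ+ => Finsupp.single s.1 (s.2 : ℕ))
      (schurP lam) (multiWt (multiExp lam)) := by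
    rw [schurP_eq, hEquivP_apply, MvPolynomial.as_sum (multiSchurPoly ℚ lam), map_sum]
    refine MvPolynomial.IsWeightedHomogeneous.sum _ _ _ fun e he => ?_
    have h1 := ((isLeading_multiSchurPoly ℚ lam).2 e (MvPolynomial.mem_support_iff.1 he)).1
    rw [hToP, MvPolynomial.aeval_monomial, ← h1, ← zero_add (multiWt e)]
    refine (MvPolynomial.isWeightedHomogeneous_C _ _).mul ?_
    rw [multiWt, Finsupp.weight_apply]
    exact MvPolynomial.IsWeightedHomogeneous.prod _ _ _ fun s _ =>
      (isWeightedHomogeneous_hVal s.1 s.2).pow _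
  exact H h

end Multi

end

section

open Finset

/-! ### Integrality of the Schur expansion -/

section Integrality

variable {ι : Type*}

/-- By the determinantal formula Schur functions are polynomials with integer coefficients in the
complete functions. -/
theorem IsIntegralAlphabet.schurProd_mem {B : Type*} [CommRing B] [Algebra ℚ B] {C : Subring B}
    {A : ι → ℕ+ → B} (h : ∀ U, IsIntegralAlphabet C (A U)) (lam : MultiPartition ι) :
    schurProd lam A ∈ C := by
  rw [schurProd_eq_aeval, ← map_multiSchurPoly]
  induction multiSchurPoly ℤ lam using MvPolynomial.induction_on with
  | C a =>
    rw [MvPolynomial.map_C, MvPolynomial.aeval_C]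
    have : algebraMap ℚ B ((Int.castRingHom ℚ) a) = (a : B) := by simp
    rw [this]
    exact intCast_mem C a
  | add p q hp hq =>
    rw [map_add, map_add]
    exact C.add_mem hp hq
  | mul_X p s hp =>
    rw [map_mul, map_mul, MvPolynomial.map_X, MvPolynomial.aeval_X]
    exact C.mul_mem hp (h _ _)

/-- The values of the power sums at the alphabets `𝐱_U, 𝐲_U, ⨁ (𝐱_V 𝐲_W)^{⊕ N}`, for finitely many
pairs of indices. -/
def combine {B : Type*} [CommRing B] (n : ι × ι → ι → ℤ) (F : Finset (ι × ι)) (A A' : ι → ℕ+ → B)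
    (U : ι) : ℕ+ → B :=
  A U + A' U + ∑ p ∈ F, n p U • (A p.1 * A' p.2)

theorem map_combine {B B' : Type*} [CommRing B] [Algebra ℚ B] [CommRing B'] [Algebra ℚ B']
    (φ : B →ₐ[ℚ] B') (n : ι × ι → ι → ℤ) (F : Finset (ι × ι)) (A A' : ι → ℕ+ → B) (U : ι) (l : ℕ+) :
    φ (combine n F A A' U l) =
      combine n F (fun U l => φ (A U l)) (fun U l => φ (A' U l)) U l := by
  simp only [combine, Pi.add_apply, Finset.sum_apply, Pi.smul_apply, Pi.mul_apply, map_add, map_sum,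
    map_zsmul, map_mul]

attribute [local instance] MvPolynomial.algebraMvPolynomial

/-- In the polynomial ring on the complete symmetric functions, integrality over the integral
polynomials means having integral coefficients. -/
theorem exists_map_eq_of_isIntegral {σ : Type*} {g : MvPolynomial σ ℚ}
    (hg : IsIntegral (MvPolynomial σ ℤ) g) :
    ∃ g₀ : MvPolynomial σ ℤ, MvPolynomial.map (Int.castRingHom ℚ) g₀ = g := by
  have h := MvPolynomial.isIntegral_iff_isIntegral_coeff.1 hg
  have h' : ∀ m, ∃ z : ℤ, (z : ℚ) = MvPolynomial.coeff m g := fun m =>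
    IsIntegrallyClosed.isIntegral_iff.1 (h m)
  have hmem : g ∈ Set.range (MvPolynomial.map (σ := σ) (Int.castRingHom ℚ)) := by
    rw [MvPolynomial.mem_range_map_iff_coeffs_subset]
    intro x hx
    obtain ⟨m, -, rfl⟩ := MvPolynomial.mem_coeffs_iff.1 hx
    exact h' m
  exact hmem

/-- The alphabets `q u` are the universal ones: their complete functions are the variables. In `K`
let `C` be the integral closure of the integral polynomials; the universal alphabets are integral
over `C`, hence so are the combined ones and the values of Schur functions at them. -/
theorem isIntegral_schurProd_combine (n : ι × ι → ι → ℤ) (F : Finset (ι × ι))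
    (lam : MultiPartition ι) {q : ι ⊕ ι → ℕ+ → MvPolynomial ((ι ⊕ ι) × ℕ+) ℚ}
    (hq : ∀ u (l : ℕ+), hVal (q u) l = MvPolynomial.X (u, l)) {K : Type*} [Field K] [Algebra ℚ K]
    [IsAlgClosed K] {ψ : MvPolynomial ((ι ⊕ ι) × ℕ+) ℚ →ₐ[ℚ] K} (hinj : Function.Injective ψ) :
    IsIntegral (MvPolynomial ((ι ⊕ ι) × ℕ+) ℤ)
      (schurProd lam (combine n F (fun U => q (Sum.inl U)) fun U => q (Sum.inr U))) := by
  let Z := MvPolynomial ((ι ⊕ ι) × ℕ+) ℤ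
  let Q := MvPolynomial ((ι ⊕ ι) × ℕ+) ℚ
  let : Algebra Q K := ψ.toRingHom.toAlgebra
  let : Algebra Z K := ((algebraMap Q K).comp (algebraMap Z Q)).toAlgebra
  have : IsScalarTower Z Q K := IsScalarTower.of_algebraMap_eq fun _ => rfl
  have hψ : ∀ x, ψ x = algebraMap Q K x := fun _ => rfl
  rw [← isIntegral_algebraMap_iff (show Function.Injective (algebraMap Q K) from hinj)]
  let C : Subring K := (integralClosure Z K).toSubring
  have hC : ∀ x : K, IsIntegral C x → x ∈ C := fun x hx =>
    isIntegral_trans (A := integralClosure Z K) x hx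
  have hgen (u : ι ⊕ ι) : IsIntegralAlphabet C fun l => ψ (q u l) := fun m => by
    rw [← map_hVal]
    by_cases hm : m = 0
    · rw [hm, hVal_zero, map_one]
      exact C.one_mem
    · obtain ⟨l, rfl⟩ := exists_coe_eq hm
      rw [hq, hψ]
      have : algebraMap Q K (MvPolynomial.X (u, l)) = algebraMap Z K (MvPolynomial.X (u, l)) := by
        rw [IsScalarTower.algebraMap_apply Z Q K]
        refine congrArg _ ?_
        exact (MvPolynomial.map_X (algebraMap ℤ ℚ) (u, l)).symm
      rw [this]
      exact isIntegral_algebraMap (R := Z) (A := K) (x := MvPolynomial.X (u, l))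
  rw [← hψ, map_schurProd]
  refine IsIntegralAlphabet.schurProd_mem (C := C) (fun U => ?_) lam
  simp only [map_combine]
  refine ((hgen _).add (hgen _)).add (.sum _ fun p _ => .zsmul ?_ _)
  exact (hgen _).mul hC (hgen _)

theorem exists_schurProd_combine_eq_map (n : ι × ι → ι → ℤ) (F : Finset (ι × ι))
    (lam : MultiPartition ι) {q : ι ⊕ ι → ℕ+ → MvPolynomial ((ι ⊕ ι) × ℕ+) ℚ}
    (hq : ∀ u (l : ℕ+), hVal (q u) l = MvPolynomial.X (u, l)) :
    ∃ g₀ : MvPolynomial ((ι ⊕ ι) × ℕ+) ℤ, MvPolynomial.map (Int.castRingHom ℚ) g₀ =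
      schurProd lam (combine n F (fun U => q (Sum.inl U)) fun U => q (Sum.inr U)) := by
  refine exists_map_eq_of_isIntegral ?_
  let Q := MvPolynomial ((ι ⊕ ι) × ℕ+) ℚ
  let K := AlgebraicClosure (FractionRing Q)
  let ψ : Q →ₐ[ℚ] K :=
    { (algebraMap (FractionRing Q) K).comp (algebraMap Q (FractionRing Q)) with
      commutes' := fun r => by simp }
  exact isIntegral_schurProd_combine n F lam hq (ψ := ψ)
    ((FaithfulSMul.algebraMap_injective (FractionRing Q) K).comp
      (IsFractionRing.injective Q (FractionRing Q)))

/-- The coefficients of the expansion of a product of Schur functions of a combined alphabet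
into Schur functions are integers. -/
theorem exists_int_expansion_combine {B : Type*} [CommRing B] [Algebra ℚ B] (n : ι × ι → ι → ℤ)
    (F : Finset (ι × ι)) (lam : MultiPartition ι) (A A' : ι → ℕ+ → B) :
    ∃ c : MultiPartition (ι ⊕ ι) →₀ ℤ, schurProd lam (combine n F A A') =
      c.sum fun κ z => (z : ℚ) • schurProd κ (Sum.elim A A') := by
  have hq (u : ι ⊕ ι) := exists_hVal_eq (B := MvPolynomial ((ι ⊕ ι) × ℕ+) ℚ)
    (c := fun n => if n = 0 then 1 else MvPolynomial.X (u, n.toPNat')) (if_pos rfl)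
  choose q hq using hq
  have hq' (u : ι ⊕ ι) (n : ℕ+) : hVal (q u) n = MvPolynomial.X (u, n) := by
    rw [hq, if_neg n.ne_zero, PNat.coe_toPNat']
  obtain ⟨g₀, hg₀⟩ := exists_schurProd_combine_eq_map n F lam hq'
  -- Unitriangularity holds over ℤ, so the Schur products span the integral polynomials in the
  -- complete functions; the integer coefficients come from here.
  have hmem : g₀ ∈ Submodule.span ℤ (Set.range (multiSchurPoly ℤ : MultiPartition (ι ⊕ ι) → _)) := by
    rw [span_multiSchurPoly]
    trivial
  obtain ⟨c, hc⟩ := Finsupp.mem_span_range_iff_exists_finsupp.1 hmem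
  -- Specialization of the universal case: the variables go to the complete functions of the given
  -- alphabets, hence the universal power sums go to the given ones.
  let φ : MvPolynomial ((ι ⊕ ι) × ℕ+) ℚ →ₐ[ℚ] B :=
    MvPolynomial.aeval fun s => hVal (Sum.elim A A' s.1) s.2
  have hφ (u : ι ⊕ ι) (l : ℕ+) : φ (q u l) = Sum.elim A A' u l := by
    refine eq_of_hVal_eq (A := fun l => φ (q u l)) (N := l) (fun n _ => ?_) l le_rfl
    rw [← map_hVal]
    by_cases hn : n = 0
    · rw [hn, hVal_zero, hVal_zero, map_one]
    · obtain ⟨l, rfl⟩ := exists_coe_eq hn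
      rw [hq', MvPolynomial.aeval_X]
  refine ⟨c, ?_⟩
  have h1 := congrArg φ hg₀
  rw [map_schurProd] at h1
  simp only [map_combine, hφ, Sum.elim_inl, Sum.elim_inr] at h1
  refine Eq.trans ?_ (h1.symm.trans ?_)
  · rfl
  · rw [← hc, Finsupp.sum, Finsupp.sum, map_sum, map_sum]
    refine sum_congr rfl fun κ _ => ?_
    rw [schurProd_eq_aeval, ← map_multiSchurPoly ℚ, map_zsmul, map_zsmul,
      ← Int.cast_smul_eq_zsmul ℚ]

end Integrality

/-! ### Splitting an index set in two -/

section Split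

variable {ι κ : Type*}

/-- The members of a family of partitions along an injection of index sets. -/
def MultiPartition.restrict {j : κ → ι} (hj : Function.Injective j) (lam : MultiPartition ι) :
    MultiPartition κ :=
  ⟨fun U => lam.1 (j U), lam.2.preimage hj.injOn⟩

theorem schurProd_sum {B : Type*} [CommRing B] [Algebra ℚ B] (lam : MultiPartition (ι ⊕ κ))
    (A : ι → ℕ+ → B) (A' : κ → ℕ+ → B) : schurProd lam (Sum.elim A A') =
      schurProd (lam.restrict Sum.inl_injective) A *
        schurProd (lam.restrict Sum.inr_injective) A' := by
  classical
  have h : lam.2.toFinset = (lam.restrict Sum.inl_injective).2.toFinset.disjSum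
      (lam.restrict Sum.inr_injective).2.toFinset := by
    ext u
    cases u with
    | inl U =>
      rw [inl_mem_disjSum, Set.Finite.mem_toFinset, Set.Finite.mem_toFinset]
      rfl
    | inr U =>
      rw [inr_mem_disjSum, Set.Finite.mem_toFinset, Set.Finite.mem_toFinset]
      rfl
  rw [schurProd, h, prod_disjSum]
  rfl

end Split

end

section

open MvPowerSeries Finset

/-! ### Substitution in Schur functions -/

section SubsHom

variable {σ τ : Type*}

theorem subs_X {z : σ → MvPowerSeries τ ℚ} (s : σ) : subs z (X s : MvPowerSeries σ ℚ) = z s := by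
  classical
  ext e
  rw [coeff_subs, finsum_eq_single _ (Finsupp.single s 1), powProd_single, coeff_index_single_self_X,
    smul_eq_mul, mul_one]
  intro k hk
  rw [coeff_X, if_neg hk, smul_zero]

/-- Substitution as an algebra homomorphism of scalar series. -/
def subsHom {z : σ → MvPowerSeries τ ℚ} (hz : HasSubst z) :
    MvPowerSeries σ ℚ →ₐ[ℚ] MvPowerSeries τ ℚ where
  toFun := subs z
  map_one' := subs_C 1
  map_mul' := subs_mul hz
  map_zero' := by
    have h := subs_C (z := z) (0 : ℚ)
    rwa [map_zero, map_zero] at h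
  map_add' := subs_add hz
  commutes' := fun r => subs_C r

theorem subs_schurSeries {ι : Type*} {z : ι × ℕ+ → MvPowerSeries τ ℚ} (hz : HasSubst z)
    (lam : MultiPartition ι) : subs z (schurSeries lam) = schurProd lam fun U l => z (U, l) := by
  have h := map_schurProd (subsHom hz) lam fun U l => X (U, l)
  refine h.trans ?_
  congr 1
  funext U l
  exact subs_X _

end SubsHom

/-! ### Transition between power sums and Schur functions -/

section Transition

variable {ι : Type*}

theorem coeff_schurSeries (lam : MultiPartition ι) (m : ι × ℕ+ →₀ ℕ) :
    coeff m (schurSeries lam) = MvPolynomial.coeff m (schurP lam) := by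
  have h := map_schurProd (MvPolynomial.coeToMvPowerSeries.algHom (R := ℚ) (σ := ι × ℕ+) ℚ) lam
    fun U l => MvPolynomial.X (U, l)
  have h1 : schurSeries lam = (schurP lam : MvPowerSeries (ι × ℕ+) ℚ) := by
    rw [schurSeries]
    refine Eq.trans ?_ (h.symm.trans ?_)
    · congr 1
      funext U l
      rw [MvPolynomial.coeToMvPowerSeries.algHom_apply]
      simp
    · rw [MvPolynomial.coeToMvPowerSeries.algHom_apply]
      simp [schurP]
  rw [h1, MvPolynomial.coeff_coe]

/-- The multi-weight of a family of partitions. -/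
def sizes (lam : MultiPartition ι) : ι →₀ ℕ := multiWt (multiExp lam)

/-- The exponents of given multi-weight. -/
def expBlock (a : ι →₀ ℕ) : Finset (ι × ℕ+ →₀ ℕ) := (finite_multiWt_eq a).toFinset

/-- The families of partitions of given multi-weight. -/
def mpBlock (a : ι →₀ ℕ) : Finset (MultiPartition ι) :=
  ((finite_multiWt_eq a).preimage multiExp_injective.injOn).toFinset

theorem mem_expBlock {a : ι →₀ ℕ} {m : ι × ℕ+ →₀ ℕ} : m ∈ expBlock a ↔ multiWt m = a :=
  Set.Finite.mem_toFinset _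

theorem mem_mpBlock {a : ι →₀ ℕ} {lam : MultiPartition ι} : lam ∈ mpBlock a ↔ sizes lam = a :=
  Set.Finite.mem_toFinset _

theorem mem_mpBlock_of_coeff_ne_zero {lam : MultiPartition ι} {m : ι × ℕ+ →₀ ℕ}
    (h : MvPolynomial.coeff m (schurP lam) ≠ 0) : lam ∈ mpBlock (multiWt m) :=
  mem_mpBlock.2 (coeff_schurP_ne_zero h).symm

/-- The coefficients of the monomials in the power sums with respect to the Schur basis. -/
def toSchur (m : ι × ℕ+ →₀ ℕ) : MultiPartition ι →₀ ℚ :=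
  schurBasis.repr (MvPolynomial.monomial m 1)

theorem sum_toSchur (m : ι × ℕ+ →₀ ℕ) :
    ∑ lam ∈ (toSchur m).support, toSchur m lam • schurP lam = MvPolynomial.monomial m (1 : ℚ) := by
  have h := schurBasis.linearCombination_repr (MvPolynomial.monomial m (1 : ℚ) :
    MvPolynomial (ι × ℕ+) ℚ)
  rw [Finsupp.linearCombination_apply, Finsupp.sum] at h
  simp only [schurBasis_apply] at h
  exact h

/-- By homogeneity, dropping the terms of the wrong weight from the expansion still yields the
monomial; uniqueness of the expansion shows that there were none. -/
theorem multiWt_eq_of_toSchur_ne_zero {m : ι × ℕ+ →₀ ℕ} {lam : MultiPartition ι}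
    (h : toSchur m lam ≠ 0) : multiWt m = sizes lam := by
  classical
  have h1 : ∑ mu ∈ (toSchur m).support with sizes mu = multiWt m, toSchur m mu • schurP mu =
      MvPolynomial.monomial m (1 : ℚ) := by
    ext m'
    by_cases hm : multiWt m' = multiWt m
    · rw [← sum_toSchur, MvPolynomial.coeff_sum, MvPolynomial.coeff_sum]
      refine sum_subset (filter_subset _ _) fun mu hmu hn => ?_
      rw [MvPolynomial.coeff_smul]
      by_contra hne
      exact hn (mem_filter.2 ⟨hmu,
        (coeff_schurP_ne_zero (right_ne_zero_of_smul hne)).symm.trans hm⟩)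
    · rw [MvPolynomial.coeff_sum, MvPolynomial.coeff_monomial, if_neg fun h => hm (by rw [h])]
      refine sum_eq_zero fun mu hmu => ?_
      rw [MvPolynomial.coeff_smul]
      by_contra hne
      exact hm ((coeff_schurP_ne_zero (right_ne_zero_of_smul hne)).trans (mem_filter.1 hmu).2)
  have h2 := congrArg (fun p => schurBasis.repr p lam) h1
  simp only [map_sum, map_smul, ← schurBasis_apply, Module.Basis.repr_self] at h2
  rw [Finsupp.finsetSum_apply] at h2
  by_contra hne
  refine h (h2.symm.trans (sum_eq_zero fun mu hmu => ?_))
  rw [Finsupp.smul_apply, Finsupp.single_eq_of_ne, smul_zero]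
  rintro rfl
  exact hne (mem_filter.1 hmu).2.symm

open Classical in
theorem sum_toSchur_mul_coeff (m m' : ι × ℕ+ →₀ ℕ) :
    ∑ lam ∈ mpBlock (multiWt m'), toSchur m lam * MvPolynomial.coeff m' (schurP lam) =
      if m = m' then 1 else 0 := by
  have h := congrArg (MvPolynomial.coeff m') (sum_toSchur m)
  rw [MvPolynomial.coeff_sum, MvPolynomial.coeff_monomial] at h
  rw [← h]
  simp only [MvPolynomial.coeff_smul, smul_eq_mul]
  refine sum_congr_of_eq_on_inter ?_ ?_ fun _ _ _ => rfl
  · intro lam _ hn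
    rw [Finsupp.notMem_support_iff.1 hn, zero_mul]
  · intro lam _ hn
    by_contra hne
    exact hn (mem_mpBlock_of_coeff_ne_zero (right_ne_zero_of_mul hne))

open Classical in
theorem sum_coeff_mul_toSchur (lam mu : MultiPartition ι) :
    ∑ m ∈ expBlock (sizes mu), toSchur m mu * MvPolynomial.coeff m (schurP lam) =
      if lam = mu then 1 else 0 := by
  have h := congrArg (fun p => schurBasis.repr p mu) (MvPolynomial.as_sum (schurP lam))
  have h0 : ∀ m, MvPolynomial.monomial m (MvPolynomial.coeff m (schurP lam)) =
      MvPolynomial.coeff m (schurP lam) • MvPolynomial.monomial m (1 : ℚ) := fun m => by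
    rw [MvPolynomial.smul_monomial, smul_eq_mul, mul_one]
  simp only [h0, map_sum, map_smul] at h
  rw [← schurBasis_apply, Module.Basis.repr_self, Finsupp.single_apply, schurBasis_apply,
    Finsupp.finsetSum_apply] at h
  rw [h]
  simp only [Finsupp.smul_apply, smul_eq_mul]
  refine sum_congr_of_eq_on_inter ?_ ?_ fun m _ _ => mul_comm _ _
  · intro m _ hn
    rw [MvPolynomial.notMem_support_iff.1 hn, mul_zero]
  · intro m _ hn
    by_contra hne
    exact hn (mem_expBlock.2 (multiWt_eq_of_toSchur_ne_zero (right_ne_zero_of_mul hne)))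

variable {V : Type*} [AddCommGroup V] [Module ℚ V]

/-- Inversion of the transition between power sums and Schur functions. -/
theorem transition_iff (D : (ι × ℕ+ →₀ ℕ) → V) (Z : MultiPartition ι → V) :
    (∀ m, D m = ∑ lam ∈ mpBlock (multiWt m), MvPolynomial.coeff m (schurP lam) • Z lam) ↔
      ∀ lam, Z lam = ∑ m ∈ expBlock (sizes lam), toSchur m lam • D m := by
  classical
  constructor
  · intro h lam
    have h1 : ∀ m ∈ expBlock (sizes lam), toSchur m lam • D m = ∑ mu ∈ mpBlock (sizes lam),
        (toSchur m lam * MvPolynomial.coeff m (schurP mu)) • Z mu := fun m hm => by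
      rw [h m, mem_expBlock.1 hm, smul_sum]
      exact sum_congr rfl fun _ _ => smul_smul _ _ _
    rw [sum_congr rfl h1, sum_comm]
    simp only [← sum_smul, sum_coeff_mul_toSchur, ite_smul, one_smul, zero_smul]
    rw [sum_ite_eq' (mpBlock (sizes lam)) lam, if_pos (mem_mpBlock.2 rfl)]
  · intro h m
    have h1 : ∀ lam ∈ mpBlock (multiWt m), MvPolynomial.coeff m (schurP lam) • Z lam =
        ∑ m' ∈ expBlock (multiWt m),
          (toSchur m' lam * MvPolynomial.coeff m (schurP lam)) • D m' := fun lam hlam => by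
      rw [h lam, mem_mpBlock.1 hlam, smul_sum]
      exact sum_congr rfl fun _ _ => by rw [smul_smul, mul_comm]
    rw [sum_congr rfl h1, sum_comm]
    simp only [← sum_smul, sum_toSchur_mul_coeff, ite_smul, one_smul, zero_smul]
    rw [sum_ite_eq' (expBlock (multiWt m)) m, if_pos (mem_expBlock.2 rfl)]

/-- `transition_iff` once in each index, the first time with values in functions of the second
exponent. -/
theorem transition_two_iff (D : (ι × ℕ+ →₀ ℕ) → (ι × ℕ+ →₀ ℕ) → ℚ)
    (c : MultiPartition ι → MultiPartition ι → ℚ) :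
    (∀ m m', D m m' = ∑ mu ∈ mpBlock (multiWt m), ∑ nu ∈ mpBlock (multiWt m'),
      c mu nu * (MvPolynomial.coeff m (schurP mu) * MvPolynomial.coeff m' (schurP nu))) ↔
    ∀ mu nu, c mu nu = ∑ m ∈ expBlock (sizes mu), ∑ m' ∈ expBlock (sizes nu),
      toSchur m mu * toSchur m' nu * D m m' := by
  have h1 := transition_iff D fun mu m' => ∑ nu ∈ mpBlock (multiWt m'),
    MvPolynomial.coeff m' (schurP nu) • c mu nu
  have h2 := fun mu => transition_iff (fun m' => ∑ m ∈ expBlock (sizes mu), toSchur m mu • D m m')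
    (c mu)
  refine Iff.trans ?_ (h1.trans (Iff.trans ?_ (forall_congr' h2 |>.trans ?_)))
  · refine forall_congr' fun m => Iff.trans ?_ funext_iff.symm
    refine forall_congr' fun m' => Eq.congr rfl ?_
    rw [Finset.sum_apply]
    refine sum_congr rfl fun mu _ => ?_
    rw [Pi.smul_apply, smul_sum]
    exact sum_congr rfl fun nu _ => by simp only [smul_eq_mul]; ring
  · refine forall_congr' fun mu => funext_iff.trans (forall_congr' fun m' => ?_)
    rw [Finset.sum_apply]
    exact eq_comm
  · refine forall_congr' fun mu => forall_congr' fun nu => Eq.congr rfl ?_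
    simp only [smul_sum]
    rw [sum_comm]
    exact sum_congr rfl fun m _ => sum_congr rfl fun m' _ => by simp only [smul_eq_mul]; ring

end Transition

end

section

open MvPowerSeries Finset

/-! ### Structure constants and the elements `Z` -/

section Combined

variable {R : Type*} [Ring R] {ι : Type*} (b : Module.Basis ι ℤ R)

theorem schurProd_inl (mu : MultiPartition ι) :
    schurProd mu (fun V l => (X (Sum.inl (V, l)) : TwoSeries ι)) =
      subs (fun s => X (Sum.inl s)) (schurSeries mu) :=
  (subs_schurSeries (hasSubst_X Sum.inl_injective) mu).symm

theorem schurProd_inr (nu : MultiPartition ι) :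
    schurProd nu (fun V l => (X (Sum.inr (V, l)) : TwoSeries ι)) =
      subs (fun s => X (Sum.inr s)) (schurSeries nu) :=
  (subs_schurSeries (hasSubst_X Sum.inr_injective) nu).symm

theorem coeff_pairExp_schurProd (mu nu : MultiPartition ι) (m m' : ι × ℕ+ →₀ ℕ) :
    coeff (pairExp m m') (schurProd mu (fun V l => (X (Sum.inl (V, l)) : TwoSeries ι)) *
      schurProd nu (fun V l => (X (Sum.inr (V, l)) : TwoSeries ι))) =
      MvPolynomial.coeff m (schurP mu) * MvPolynomial.coeff m' (schurP nu) := by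
  rw [schurProd_inl, schurProd_inr, coeff_pairExp_mul, coeff_schurSeries, coeff_schurSeries]

theorem combinedSchur_eq_subs (lam : MultiPartition ι) :
    combinedSchur b lam = subs (combinedFamily b) (schurSeries lam) :=
  (subs_schurSeries (hasSubst_combinedFamily b) lam).symm

theorem coeff_combinedSchur (lam : MultiPartition ι) {e : (ι × ℕ+) ⊕ (ι × ℕ+) →₀ ℕ}
    {K : Finset (ι × ℕ+ →₀ ℕ)} (hK : ∀ k, coeff e (powProd (combinedFamily b) k) ≠ 0 → k ∈ K) :
    coeff e (combinedSchur b lam) =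
      ∑ k ∈ K, coeff e (powProd (combinedFamily b) k) * MvPolynomial.coeff k (schurP lam) := by
  rw [combinedSchur_eq_subs, coeff_subs_eq_sum hK]
  exact sum_congr rfl fun k _ => by rw [coeff_schurSeries, smul_eq_mul]

/-- The series all of whose monomials involve a variable outside of `S`. -/
def outsideIdeal {τ : Type*} (S : Set τ) : Ideal (MvPowerSeries τ ℚ) where
  carrier := {f | ∀ e : τ →₀ ℕ, (e.support : Set τ) ⊆ S → coeff e f = 0}
  zero_mem' := fun _ _ => map_zero _
  add_mem' := fun hf hg e he => by rw [map_add, hf e he, hg e he, add_zero]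
  smul_mem' := fun f g hg e he => by
    classical
    rw [smul_eq_mul, coeff_mul]
    refine sum_eq_zero fun p hp => ?_
    rw [HasAntidiagonal.mem_antidiagonal] at hp
    rw [hg p.2, mul_zero]
    refine Set.Subset.trans (coe_subset.2 ?_) he
    rw [← hp]
    exact Finsupp.support_mono le_add_self

theorem coeff_eq_of_sub_mem {τ : Type*} {S : Set τ} {f g : MvPowerSeries τ ℚ}
    (h : f - g ∈ outsideIdeal S) {e : τ →₀ ℕ} (he : (e.support : Set τ) ⊆ S) :
    coeff e f = coeff e g := sub_eq_zero.1 (by rw [← map_sub]; exact h e he)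

/-- Evaluation of Schur functions commutes with the homomorphism to the quotient by the ideal. -/
theorem schurProd_sub_mem {τ : Type*} {S : Set τ} {A A' : ι → ℕ+ → MvPowerSeries τ ℚ}
    (h : ∀ U l, A U l - A' U l ∈ outsideIdeal S) (lam : MultiPartition ι) :
    schurProd lam A - schurProd lam A' ∈ outsideIdeal S := by
  have h1 (A : ι → ℕ+ → MvPowerSeries τ ℚ) :
      Ideal.Quotient.mk (outsideIdeal S) (schurProd lam A) =
        schurProd lam fun U l => Ideal.Quotient.mk (outsideIdeal S) (A U l) :=
    map_schurProd (Ideal.Quotient.mkₐ ℚ (outsideIdeal S)) lam A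
  rw [← Ideal.Quotient.eq, h1, h1]
  simp only [fun U l => Ideal.Quotient.eq.2 (h U l)]

/-- The variables with index in a given set. -/
def indexed (F : Finset ι) : Set ((ι × ℕ+) ⊕ (ι × ℕ+)) := {s | Sum.elim Prod.fst Prod.fst s ∈ F}

/-- The multiplicities in a combined alphabet. -/
def multiplicity (p : ι × ι) (U : ι) : ℤ := b.repr (b p.1 * b p.2) U

/-- A product of variables that occurs at an exponent supported on `F` has both indices in `F`. This
cuts the infinite sum of product alphabets down to a finite one, to which the integrality result
applies. -/
theorem combinedAlphabet_sub_mem (F : Finset ι) (U : ι) (l : ℕ+) :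
    combinedAlphabet b U l - combine (multiplicity b) (F ×ˢ F)
      (fun V l => (X (Sum.inl (V, l)) : TwoSeries ι)) (fun V l => X (Sum.inr (V, l))) U l ∈
        outsideIdeal (indexed F) := by
  intro e he
  rw [map_sub, sub_eq_zero, coeff_combinedAlphabet, combine, Pi.add_apply, Pi.add_apply, map_add,
    map_add, Finset.sum_apply, map_sum]
  refine congrArg _ ?_
  rw [finsum_eq_sum_of_support_subset (s := F ×ˢ F)]
  · refine sum_congr rfl fun p _ => ?_
    rw [Pi.smul_apply, Pi.mul_apply, ← Int.cast_smul_eq_zsmul ℚ, coeff_smul]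
    rfl
  · intro p hp
    have h1 := coeff_X_mul_X_ne_zero (s := Sum.inl (p.1, l)) (t := Sum.inr (p.2, l)) (d := e)
      fun h => hp (by simp only [h, mul_zero])
    rw [coe_product, Set.mem_prod]
    have hmem (s : (ι × ℕ+) ⊕ (ι × ℕ+)) (hs : Finsupp.single s 1 ≤ e) : s ∈ indexed F := by
      refine he (mem_coe.2 (Finsupp.mem_support_iff.2 ?_))
      rw [Finsupp.single_le_iff] at hs
      omega
    exact ⟨hmem (Sum.inl (p.1, l)) (h1 ▸ le_self_add), hmem (Sum.inr (p.2, l)) (h1 ▸ le_add_self)⟩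

/-- The coefficient of `∏ s_{mu(V)}(𝐱_V) ∏ s_{nu(W)}(𝐲_W)` in a product of Schur functions of the
combined alphabets. -/
def combinedCoeff (lam mu nu : MultiPartition ι) : ℚ :=
  ∑ m ∈ expBlock (sizes mu), ∑ m' ∈ expBlock (sizes nu),
    toSchur m mu * toSchur m' nu * coeff (pairExp m m') (combinedSchur b lam)

theorem exists_combinedCoeff_eq_int (lam mu nu : MultiPartition ι) :
    ∃ z : ℤ, combinedCoeff b lam mu nu = z := by
  classical
  -- Exponents of the weights of `mu` and `nu` involve only variables with index in `F`.
  let F : Finset ι := (sizes mu).support ∪ (sizes nu).support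
  obtain ⟨c, hc⟩ := exists_int_expansion_combine (multiplicity b) (F ×ˢ F) lam
    (fun V l => (X (Sum.inl (V, l)) : TwoSeries ι)) fun V l => X (Sum.inr (V, l))
  let inlPart (κ : MultiPartition (ι ⊕ ι)) : MultiPartition ι := κ.restrict Sum.inl_injective
  let inrPart (κ : MultiPartition (ι ⊕ ι)) : MultiPartition ι := κ.restrict Sum.inr_injective
  have h1 : ∀ m ∈ expBlock (sizes mu), ∀ m' ∈ expBlock (sizes nu),
      coeff (pairExp m m') (combinedSchur b lam) = ∑ κ ∈ c.support, (c κ : ℚ) *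
        (MvPolynomial.coeff m (schurP (inlPart κ)) *
          MvPolynomial.coeff m' (schurP (inrPart κ))) := fun m hm m' hm' => by
    rw [mem_expBlock] at hm hm'
    have hs : ((pairExp m m').support : Set _) ⊆ indexed F := by
      rintro (s | s) hs
      · rw [mem_coe, Finsupp.mem_support_iff, pairExp_inl] at hs
        refine mem_union_left _ (Finsupp.mem_support_iff.2 ?_)
        rw [← hm]
        exact multiWt_apply_ne_zero (Finsupp.mem_support_iff.2 hs)
      · rw [mem_coe, Finsupp.mem_support_iff, pairExp_inr] at hs
        refine mem_union_right _ (Finsupp.mem_support_iff.2 ?_)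
        rw [← hm']
        exact multiWt_apply_ne_zero (Finsupp.mem_support_iff.2 hs)
    rw [combinedSchur, coeff_eq_of_sub_mem
      (schurProd_sub_mem (combinedAlphabet_sub_mem b F) lam) hs]
    have h2 : schurProd lam (fun U l => combine (multiplicity b) (F ×ˢ F)
        (fun V l => (X (Sum.inl (V, l)) : TwoSeries ι)) (fun V l => X (Sum.inr (V, l))) U l) = _ := hc
    rw [h2, Finsupp.sum, map_sum]
    refine sum_congr rfl fun κ _ => ?_
    rw [coeff_smul, schurProd_sum, coeff_pairExp_schurProd]
  -- Pairing with the two dual families extracts from the integral expansion over `ι ⊕ ι` the terms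
  -- whose halves are `mu` and `nu`.
  refine ⟨∑ κ ∈ c.support, c κ * ((if inlPart κ = mu then 1 else 0) *
    (if inrPart κ = nu then 1 else 0)), ?_⟩
  push_cast
  rw [combinedCoeff, sum_congr rfl fun m hm => sum_congr rfl fun m' hm' => by rw [h1 m hm m' hm']]
  simp only [mul_sum]
  rw [sum_congr rfl fun m _ => sum_comm, sum_comm]
  refine sum_congr rfl fun κ _ => ?_
  rw [← sum_coeff_mul_toSchur, ← sum_coeff_mul_toSchur, sum_mul_sum, mul_sum]
  refine sum_congr rfl fun m _ => ?_
  rw [mul_sum]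
  exact sum_congr rfl fun m' _ => by ring

theorem isSchurExpansion_iff (lam : MultiPartition ι) (c : MultiPartition ι → MultiPartition ι → ℚ) :
    IsSchurExpansion (combinedSchur b lam) c ↔ ∀ mu nu, c mu nu = combinedCoeff b lam mu nu := by
  refine Iff.trans ?_ (transition_two_iff
    (fun m m' => coeff (pairExp m m') (combinedSchur b lam)) c)
  have h1 (m m' : ι × ℕ+ →₀ ℕ) : coeff (pairExp m m') (formalSum fun mn :
      MultiPartition ι × MultiPartition ι => c mn.1 mn.2 •
        (schurProd mn.1 (fun V l => MvPowerSeries.X (Sum.inl (V, l))) *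
          schurProd mn.2 (fun W l => MvPowerSeries.X (Sum.inr (W, l))) : TwoSeries ι)) =
      ∑ mu ∈ mpBlock (multiWt m), ∑ nu ∈ mpBlock (multiWt m'),
        c mu nu * (MvPolynomial.coeff m (schurP mu) * MvPolynomial.coeff m' (schurP nu)) := by
    rw [coeff_formalSum, finsum_eq_sum_of_support_subset
      (s := mpBlock (multiWt m) ×ˢ mpBlock (multiWt m')), sum_product]
    · refine sum_congr rfl fun mu _ => sum_congr rfl fun nu _ => ?_
      rw [coeff_smul, coeff_pairExp_schurProd]
    · rintro ⟨mu, nu⟩ h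
      rw [Function.mem_support, coeff_smul, coeff_pairExp_schurProd] at h
      have h' := right_ne_zero_of_mul h
      rw [coe_product, Set.mem_prod]
      exact ⟨mem_mpBlock_of_coeff_ne_zero (left_ne_zero_of_mul h'),
        mem_mpBlock_of_coeff_ne_zero (right_ne_zero_of_mul h')⟩
  rw [IsSchurExpansion]
  constructor
  · intro h m m'
    rw [← h1, ← h]
  · intro h
    refine MvPowerSeries.ext fun d => ?_
    obtain ⟨m, m', rfl⟩ := exists_pairExp d
    rw [h1]
    exact h m m'

/-! ### The elements `Z_lam` -/

/-- The elements `Z_lam`. -/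
def zElement (lam : MultiPartition ι) : GQ R :=
  ∑ m ∈ expBlock (sizes lam), toSchur m lam • fullCoeff b m

theorem fullCoeff_eq_sum (m : ι × ℕ+ →₀ ℕ) : fullCoeff b m =
    ∑ lam ∈ mpBlock (multiWt m), MvPolynomial.coeff m (schurP lam) • zElement b lam :=
  (transition_iff (fullCoeff b) (zElement b)).2 (fun _ => rfl) m

/-- At each exponent the series in the `Z` has a finite sum over one block, and the product of the
factors has the limit `fullCoeff`. Inverting the blocks gives existence and uniqueness at once. -/
theorem isZFamily_iff (Z : MultiPartition ι → GQ R) : IsZFamily b Z ↔ Z = zElement b := by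
  have h1 (m : ι × ℕ+ →₀ ℕ) :
      coeff m (formalSum fun lam => tensorCoeff (schurSeries lam) (Z lam)) =
        ∑ lam ∈ mpBlock (multiWt m), MvPolynomial.coeff m (schurP lam) • Z lam := by
    have h2 (lam : MultiPartition ι) : coeff m (tensorCoeff (schurSeries lam) (Z lam)) =
        MvPolynomial.coeff m (schurP lam) • Z lam := by
      rw [← coeff_schurSeries]
      rfl
    rw [coeff_formalSum, finsum_congr h2]
    refine finsum_eq_sum_of_support_subset _ fun lam h => ?_
    exact mem_mpBlock_of_coeff_ne_zero (left_ne_zero_of_smul h)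
  refine Iff.trans (forall_congr' fun m => ?_)
    ((transition_iff (fullCoeff b) Z).trans funext_iff.symm)
  rw [h1]
  constructor
  · intro h
    obtain ⟨N, h2, h3⟩ := (h.and (coeff_partialProd_eventually b m)).exists
    exact h3.symm.trans h2
  · intro h
    rw [← h]
    exact coeff_partialProd_eventually b m

/-- The functionals that send `fullCoeff b m` to the coefficient of the monomial `m` in a Schur
product are dual to the family. -/
theorem linearIndependent_zElement : LinearIndependent ℚ (zElement b) := by
  classical
  let D : Module.Basis (ι × ℕ+ →₀ ℕ) ℚ (GQ R) :=
    Module.Basis.mk (linearIndependent_fullCoeff b) (span_fullCoeff b).ge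
  have hdual (mu : MultiPartition ι) : ∃ φ : GQ R →ₗ[ℚ] ℚ,
      ∀ lam, φ (zElement b lam) = if mu = lam then 1 else 0 := by
    refine ⟨D.constr ℚ fun m => MvPolynomial.coeff m (schurP mu), fun lam => ?_⟩
    rw [zElement, map_sum, ← sum_coeff_mul_toSchur]
    refine sum_congr rfl fun m _ => ?_
    have : fullCoeff b m = D m := (Module.Basis.mk_apply _ _ m).symm
    rw [map_smul, this, Module.Basis.constr_basis, smul_eq_mul]
  rw [linearIndependent_iff']
  intro s g hg mu hmu
  obtain ⟨φ, hφ⟩ := hdual mu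
  have h := congrArg φ hg
  rw [map_sum, map_zero] at h
  simp only [map_smul, hφ, smul_eq_mul, mul_ite, mul_one, mul_zero] at h
  rwa [sum_ite_eq, if_pos hmu] at h

theorem span_zElement : Submodule.span ℚ (Set.range (zElement b)) = ⊤ := by
  rw [eq_top_iff, ← span_fullCoeff b, Submodule.span_le]
  rintro _ ⟨m, rfl⟩
  rw [fullCoeff_eq_sum]
  exact Submodule.sum_mem _ fun lam _ => Submodule.smul_mem _ _ (Submodule.subset_span ⟨lam, rfl⟩)

theorem fullCoeff_mul_eq_sum (m m' : ι × ℕ+ →₀ ℕ) {L : Finset (MultiPartition ι)}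
    (hL : ∀ k lam, coeff (pairExp m m') (powProd (combinedFamily b) k) ≠ 0 →
      MvPolynomial.coeff k (schurP lam) ≠ 0 → lam ∈ L) :
    fullCoeff b m * fullCoeff b m' =
      ∑ lam ∈ L, coeff (pairExp m m') (combinedSchur b lam) • zElement b lam := by
  have hfin := finite_coeff_powProd (hasSubst_combinedFamily b) (pairExp m m')
  have hK : ∀ k, coeff (pairExp m m') (powProd (combinedFamily b) k) ≠ 0 → k ∈ hfin.toFinset :=
    fun k hk => hfin.mem_toFinset.2 hk
  rw [fullCoeff_mul b m m' hK]
  have h1 : ∀ k ∈ hfin.toFinset, coeff (pairExp m m') (powProd (combinedFamily b) k) •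
      fullCoeff b k = ∑ lam ∈ L, (coeff (pairExp m m') (powProd (combinedFamily b) k) *
        MvPolynomial.coeff k (schurP lam)) • zElement b lam := fun k hk => by
    rw [fullCoeff_eq_sum, smul_sum]
    refine (sum_congr rfl fun _ _ => smul_smul _ _ _).trans
      (sum_congr_of_eq_on_inter ?_ ?_ fun _ _ _ => rfl)
    · intro lam _ hn
      by_contra hne
      have h := left_ne_zero_of_smul hne
      exact hn (hL k lam (left_ne_zero_of_mul h) (right_ne_zero_of_mul h))
    · intro lam _ hn
      by_contra hne
      exact hn (mem_mpBlock_of_coeff_ne_zero (right_ne_zero_of_mul (left_ne_zero_of_smul hne)))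
  rw [sum_congr rfl h1, sum_comm]
  refine sum_congr rfl fun lam _ => ?_
  rw [← sum_smul, coeff_combinedSchur b lam hK]

/-- The structure constants of the family `Z`. -/
theorem exists_structureConstants : ∃ a : MultiPartition ι → MultiPartition ι → MultiPartition ι →₀ ℤ,
    (∀ lam mu nu, combinedCoeff b lam mu nu = a mu nu lam) ∧
    ∀ mu nu, zElement b mu * zElement b nu = (a mu nu).sum fun lam k => k • zElement b lam := by
  classical
  choose z hz using exists_combinedCoeff_eq_int b
  -- One finite set for all exponents in both blocks. It makes the product formula a finite sum over
  -- a common index set and contains every nonzero structure constant.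
  have hfin (mu nu : MultiPartition ι) : ∃ L : Finset (MultiPartition ι),
      ∀ m ∈ expBlock (sizes mu), ∀ m' ∈ expBlock (sizes nu), ∀ k lam,
        coeff (pairExp m m') (powProd (combinedFamily b) k) ≠ 0 →
          MvPolynomial.coeff k (schurP lam) ≠ 0 → lam ∈ L := by
    refine ⟨(expBlock (sizes mu)).biUnion fun m => (expBlock (sizes nu)).biUnion fun m' =>
      (finite_coeff_powProd (hasSubst_combinedFamily b) (pairExp m m')).toFinset.biUnion fun k =>
        mpBlock (multiWt k), ?_⟩
    intro m hm m' hm' k lam hk hlam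
    exact mem_biUnion.2 ⟨m, hm, mem_biUnion.2 ⟨m', hm', mem_biUnion.2
      ⟨k, (Set.Finite.mem_toFinset _).2 hk, mem_mpBlock_of_coeff_ne_zero hlam⟩⟩⟩
  choose L hL using hfin
  have hsupp (mu nu lam : MultiPartition ι) (h : z lam mu nu ≠ 0) : lam ∈ L mu nu := by
    have h1 : combinedCoeff b lam mu nu ≠ 0 := by
      rw [hz]
      exact Int.cast_ne_zero.2 h
    obtain ⟨m, hm, h2⟩ := exists_ne_zero_of_sum_ne_zero h1
    obtain ⟨m', hm', h3⟩ := exists_ne_zero_of_sum_ne_zero h2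
    have h4 := right_ne_zero_of_mul h3
    rw [coeff_combinedSchur b lam (fun k hk => (finite_coeff_powProd (hasSubst_combinedFamily b)
      (pairExp m m')).mem_toFinset.2 hk)] at h4
    obtain ⟨k, -, h5⟩ := exists_ne_zero_of_sum_ne_zero h4
    exact hL mu nu m hm m' hm' k lam (left_ne_zero_of_mul h5) (right_ne_zero_of_mul h5)
  refine ⟨fun mu nu => Finsupp.onFinset (L mu nu) (fun lam => z lam mu nu) (hsupp mu nu),
    hz, fun mu nu => ?_⟩
  refine Eq.trans ?_ (Finsupp.onFinset_sum (hsupp mu nu)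
    (g := fun lam k => k • zElement b lam) fun lam => zero_smul ℤ (zElement b lam)).symm
  have h1 : ∀ lam ∈ L mu nu, z lam mu nu • zElement b lam =
      ∑ m ∈ expBlock (sizes mu), ∑ m' ∈ expBlock (sizes nu), (toSchur m mu * toSchur m' nu *
        coeff (pairExp m m') (combinedSchur b lam)) • zElement b lam := fun lam _ => by
    rw [← Int.cast_smul_eq_zsmul ℚ, ← hz, combinedCoeff, sum_smul]
    exact sum_congr rfl fun m _ => sum_smul
  rw [sum_congr rfl h1, sum_comm]
  conv_lhs => rw [zElement, zElement, sum_mul_sum]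
  refine sum_congr rfl fun m hm => ?_
  rw [sum_comm]
  refine sum_congr rfl fun m' hm' => ?_
  rw [smul_mul_smul_comm, fullCoeff_mul_eq_sum b m m' (hL mu nu m hm m' hm'), smul_sum]
  exact sum_congr rfl fun lam _ => smul_smul _ _ _

/-- The family of empty partitions. -/
def emptyPartition : MultiPartition ι := ⟨fun _ => ⊥, by
  refine Set.finite_empty.subset fun U hU => ?_
  exact hU rfl⟩

theorem toFinset_emptyPartition : (emptyPartition (ι := ι)).2.toFinset = ∅ := by
  rw [Set.Finite.toFinset_eq_empty]
  exact Set.eq_empty_of_forall_notMem fun U hU => hU rfl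

theorem schurP_emptyPartition : schurP (emptyPartition (ι := ι)) = 1 := by
  rw [schurP, schurProd, toFinset_emptyPartition, prod_empty]

/-- The block of weight 0 has the single exponent 0, and its transition coefficient is 1. -/
theorem zElement_emptyPartition : zElement b emptyPartition = 1 := by
  classical
  have h0 : sizes (emptyPartition (ι := ι)) = 0 := by
    rw [sizes, multiExp, toFinset_emptyPartition, sum_empty, map_zero]
  have h1 : expBlock (sizes (emptyPartition (ι := ι))) = {0} := by
    ext m
    rw [mem_expBlock, mem_singleton, h0]
    constructor
    · intro h
      rw [← Finsupp.support_eq_empty, eq_empty_iff_forall_notMem]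
      exact fun s hs => multiWt_apply_ne_zero hs (by rw [h]; rfl)
    · rintro rfl
      exact map_zero _
  have h2 := sum_coeff_mul_toSchur (emptyPartition (ι := ι)) emptyPartition
  rw [h1, sum_singleton, schurP_emptyPartition, MvPolynomial.coeff_zero_one, mul_one,
    if_pos rfl] at h2
  rw [zElement, h1, sum_singleton, h2, one_smul, fullCoeff_zero]

end Combined

end

end

end WreathRing

theorem theorem4p14 {R : Type*} [Ring R] {ι : Type*} (b : Module.Basis ι ℤ R) :
    -- the family `Z` is well defined by its generating function
    ∃ Z : MultiPartition ι → GQ R, (∀ Z' : MultiPartition ι → GQ R, IsZFamily b Z' ↔ Z' = Z) ∧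
      -- the `ℤ`-span of the `Z_lam` is a subring
      (∃ S : Subring (GQ R), (S : Set (GQ R)) = Submodule.span ℤ (Set.range Z)) ∧
      -- it is an integral form: its `ℤ`-basis `Z` is a `ℚ`-basis of the rational algebra
      LinearIndependent ℚ Z ∧ Submodule.span ℚ (Set.range Z) = ⊤ ∧
      -- the structure constants are integers, and are coefficients of Schur functions
      ∃ a : MultiPartition ι → MultiPartition ι → MultiPartition ι →₀ ℤ,
        (∀ (lam : MultiPartition ι) (c : MultiPartition ι → MultiPartition ι → ℚ),
          IsSchurExpansion (combinedSchur b lam) c ↔ ∀ mu nu, c mu nu = (a mu nu lam : ℚ)) ∧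
        ∀ mu nu, Z mu * Z nu = (a mu nu).sum fun lam k => k • Z lam := by
  obtain ⟨a, ha, hmul⟩ := exists_structureConstants b
  refine ⟨zElement b, isZFamily_iff b, ⟨{
    carrier := Submodule.span ℤ (Set.range (zElement b))
    one_mem' := Submodule.subset_span ⟨emptyPartition, zElement_emptyPartition b⟩
    zero_mem' := Submodule.zero_mem _
    add_mem' := Submodule.add_mem _
    neg_mem' := Submodule.neg_mem _
    mul_mem' := fun {x y} hx hy => ?_ }, rfl⟩, linearIndependent_zElement b, span_zElement b, a,
    fun lam c => ?_, hmul⟩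
  -- By bilinearity two members of the family suffice, where the structure constants are integers.
  · have h := Submodule.mul_mem_mul hx hy
    rw [Submodule.span_mul_span] at h
    refine Submodule.span_le.2 ?_ h
    rintro _ ⟨_, ⟨mu, rfl⟩, _, ⟨nu, rfl⟩, rfl⟩
    change zElement b mu * zElement b nu ∈ Submodule.span ℤ (Set.range (zElement b))
    rw [hmul]
    exact Submodule.sum_mem _ fun lam _ =>
      Submodule.smul_mem _ _ (Submodule.subset_span ⟨lam, rfl⟩)
  · rw [isSchurExpansion_iff]
    simp only [ha]
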